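/- Let $\mathbb K$ be a field of characteristic $0$. Let $V$ be a nonunitary, commutative and cocommutative bialgebra: a commutative, associative, not necessarily unitary $\mathbb K$-algebra with a coassociative, cocommutative coproduct $\delta_V$ with counit $\epsilon_V$, both multiplicative. We write $\delta_V(v)=v'\otimes v''$. Let $uV=\mathbb K\oplus V$ be its unitary extension, a bialgebra with $\delta_{uV}(\lambda+v)=\lambda\,1\otimes 1+\delta_V(v)$ and $\epsilon_{uV}(\lambda+v)=\lambda+\epsilon_V(v)$. For an algebra $A$, let $m_{1,3,24}(a\otimes b\otimes c\otimes d)=a\otimes c\otimes bd$, and let $c$ denote the flip. A double bialgebra over $V$ is a tuple $(B,m,\Delta,\delta,\rho)$ such that - $(B,m,\Delta)$ is a bialgebra with counit $\varepsilon_\Delta$, and $(B,m,\delta)$ is a bialgebra with the same unit and with counit $\epsilon_\delta$; - $(\Delta\otimes \mathrm{Id})\circ\delta=m_{1,3,24}\circ(\delta\otimes\delta)\circ\Delta$ and $(\varepsilon_\Delta\otimes\mathrm{Id})\circ\delta(x)=\varepsilon_\Delta(x)1_B$ for all $x\in B$; - $\rho:B\to B\otimes uV$ is a (coassociative, counitary)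 right coaction of $uV$ on $B$ and an algebra morphism, $(\Delta\otimes\mathrm{Id})\circ\rho=m_{1,3,24}\circ(\rho\otimes\rho)\circ\Delta$, $(\varepsilon_\Delta\otimes\mathrm{Id})\circ\rho(x)=\varepsilon_\Delta(x)1_{uV}$ for all $x\in B$, and $\rho(\ker\varepsilon_\Delta)\subseteq B\otimes V$; - $(\mathrm{Id}\otimes c)\circ(\rho\otimes\mathrm{Id})\circ\delta=(\delta\otimes\mathrm{Id})\circ\rho$. A morphism of double bialgebras over $V$ is a linear map compatible with the products, the units, the coproducts $\Delta$ and $\delta$, their counits $\varepsilon_\Delta$ and $\epsilon_\delta$, and the coactions $\rho$. Put $\tilde\Delta(x)=\Delta(x)-x\otimes 1-1\otimes x$, $\tilde\Delta^{(0)}=\mathrm{Id}$ and $\tilde\Delta^{(n)}=(\tilde\Delta^{(n-1)}\otimes\mathrm{Id})\circ\tilde\Delta$. The double bialgebra $B$ over $V$ is connected if for every $x\in\ker\varepsilon_\Delta$ there is an $n$ with $\tilde\Delta^{(n)}(x)=0$. The double bialgebra $\mathrm{QSh}(V)$ over $V$ is the space $T(V)=\bigoplus_{n\ge 0}V^{\otimes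 n}$ of words in $V$ with the following structure: - the quasishuffle product $\uplus $, given by $1\uplus w=w\uplus 1=w$ and $xv\uplus yw=x(v\uplus yw)+y(xv\uplus w)+(x\cdot y)(v\uplus w)$ for $x,y\in V$ and words $v,w$; - the deconcatenation coproduct $\Delta(v_1\cdots v_n)=\sum_{i=0}^n v_1\cdots v_i\otimes v_{i+1}\cdots v_n$, with $\varepsilon_\Delta(1)=1$ and $\varepsilon_\Delta(v_1\cdots v_n)=0$ for $n\ge 1$; - the coproduct $\delta(w)=\sum |w_1'|\cdots|w_k'|\otimes (w_1''\uplus \cdots\uplus w_k'')$, where the sum is over all ways to cut $w$ into nonempty consecutive subwords $w=w_1\cdots w_k$, and for a word $u=u_1\cdots u_l$ one writes $|u'|\otimes u''=(u_1'\cdot\ldots\cdot u_l')\otimes (u_1''\cdots u_l'')\in V\otimes V^{\otimes l}$; its counit is $\epsilon_\delta(1)=1$, $\epsilon_\delta(v)=\epsilon_V(v)$ for $v\in V$, and $\epsilon_\delta=0$ on $V^{\otimes n}$ for $n\ge 2$; - the coaction $\rho(v_1\cdots v_n)=v_1'\cdots v_n'\otimes v_1''\cdot\ldots\cdot v_n''$,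 with $\rho(1)=1\otimes 1$. **Theorem.** Let $B$ be a connected double bialgebra over $V$. There exists a unique morphism $\phi$ of double bialgebras over $V$ from $B$ to $\mathrm{QSh}(V)$. For any $x\in\ker\varepsilon_\Delta$, $$\phi(x)=\sum_{n=1}^{\infty}\underbrace{\big((\epsilon_\delta\otimes\mathrm{Id})\circ\rho\big)^{\otimes n}\circ\tilde\Delta^{(n-1)}(x)}_{\in V^{\otimes n}},$$ where $\tilde\Delta^{(n-1)}(x)=0$ for all sufficiently large $n$. -/

import Mathlib

open scoped TensorProduct
set_option linter.unusedSectionVars false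
set_option linter.unusedSimpArgs false
set_option synthInstance.maxHeartbeats 200000

/-! Shortcut instances for nested tensor products. -/

section Shortcuts

variable {K M N : Type*} [CommSemiring K] [AddCommMonoid M] [AddCommMonoid N] [Module K M]
  [Module K N]

instance (priority := 100000) LinearMap.addHomClass_shortcut : AddHomClass (M →ₗ[K] N) M N :=
  ⟨LinearMap.map_add⟩
instance (priority := 100000) LinearMap.zeroHomClass_shortcut : ZeroHomClass (M →ₗ[K] N) M N :=
  ⟨LinearMap.map_zero⟩
instance (priority := 100000) LinearEquiv.addHomClass_shortcut : AddHomClass (M ≃ₗ[K] N) M N :=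
  ⟨LinearEquiv.map_add⟩
instance (priority := 100000) LinearEquiv.zeroHomClass_shortcut : ZeroHomClass (M ≃ₗ[K] N) M N :=
  ⟨LinearEquiv.map_zero⟩

end Shortcuts

/-- A not necessarily unitary `K`-bialgebra `(V, ·, δ_V)`, counitary with counit `ε_V`. -/
class NonUnitalBialgebra (K V : Type*) [CommRing K] [NonUnitalRing V] [Module K V]
    [IsScalarTower K V V] [SMulCommClass K V V] extends Coalgebra K V where
  counit_mul' : ∀ v w : V, counit (v * w) = counit v * counit w
  comul_mul' : ∀ v w : V, comul (v * w) = comul v * comul w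

namespace NonUnitalBialgebra

variable {K V : Type*} [CommRing K] [NonUnitalCommRing V] [Module K V]
  [IsScalarTower K V V] [SMulCommClass K V V] [NonUnitalBialgebra K V]

/-- The inclusion `V → uV` as a linear map. -/
noncomputable abbrev inrL (K V : Type*) [CommRing K] [NonUnitalCommRing V] [Module K V] :
    V →ₗ[K] Unitization K V := Unitization.inrHom K K V

lemma inrL_mul (v w : V) : inrL K V (v * w) = inrL K V v * inrL K V w := Unitization.inr_mul K v w

lemma map_inrL_mul (s t : V ⊗[K] V) : TensorProduct.map (inrL K V) (inrL K V) (s * t) =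
    TensorProduct.map (inrL K V) (inrL K V) s * TensorProduct.map (inrL K V) (inrL K V) t := by
  induction s with
  | zero => simp
  | add a b ha hb => simp only [add_mul, map_add, ha, hb]
  | tmul a b =>
    induction t with
    | zero => simp
    | add a b ha hb => simp only [mul_add, map_add, ha, hb]
    | tmul c d =>
      simp only [Algebra.TensorProduct.tmul_mul_tmul, TensorProduct.map_tmul, inrL_mul]

/-- `δ_{uV}(λ + v) = λ 1 ⊗ 1 + δ_V(v)`. -/
noncomputable def uComul : Unitization K V →ₐ[K] Unitization K V ⊗[K] Unitization K V :=
  Unitization.lift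
    { toFun := fun v => TensorProduct.map (inrL K V) (inrL K V) (Coalgebra.comul (R := K) v)
      map_smul' := by intro r v; simp
      map_zero' := by simp
      map_add' := by intro v w; simp
      map_mul' := by intro v w; rw [comul_mul', map_inrL_mul] }

/-- `ε_{uV}(λ + v) = λ + ε_V(v)`. -/
noncomputable def uCounit : Unitization K V →ₐ[K] K :=
  Unitization.lift
    { toFun := fun v => Coalgebra.counit (R := K) v
      map_smul' := by intro r v; simp
      map_zero' := by simp
      map_add' := by intro v w; simp
      map_mul' := by intro v w; rw [counit_mul'] }

@[simp] lemma uComul_inr (v : V) : uComul (K := K) (v : Unitization K V) =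
    TensorProduct.map (inrL K V) (inrL K V) (Coalgebra.comul (R := K) v) := by
  simp [uComul]

@[simp] lemma uCounit_inr (v : V) : uCounit (K := K) (v : Unitization K V) = Coalgebra.counit (R := K) v := by
  simp [uCounit]

set_option synthInstance.maxHeartbeats 200000 in
lemma uCoassoc_aux (t : V ⊗[K] V) :
    TensorProduct.assoc K _ _ _ ((uComul (K := K) (V := V)).toLinearMap.rTensor _
      (TensorProduct.map (inrL K V) (inrL K V) t)) =
    TensorProduct.map (inrL K V) (TensorProduct.map (inrL K V) (inrL K V))
      (TensorProduct.assoc K _ _ _ ((Coalgebra.comul (R := K) (A := V)).rTensor _ t)) := by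
  induction t with
  | zero => simp
  | add a b ha hb => simp only [map_add, ha, hb]
  | tmul a b =>
    simp only [TensorProduct.map_tmul, LinearMap.rTensor_tmul, AlgHom.toLinearMap_apply,
      Unitization.inrHom_apply, uComul_inr]
    induction Coalgebra.comul (R := K) a with
    | zero => simp
    | add a b ha hb => simp only [map_add, TensorProduct.add_tmul, ha, hb]
    | tmul c d => simp

lemma uCoassoc_aux' (t : V ⊗[K] V) :
    (uComul (K := K) (V := V)).toLinearMap.lTensor _ (TensorProduct.map (inrL K V) (inrL K V) t) =
    TensorProduct.map (inrL K V) (TensorProduct.map (inrL K V) (inrL K V))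
      ((Coalgebra.comul (R := K) (A := V)).lTensor _ t) := by
  induction t with
  | zero => simp
  | add a b ha hb => simp only [map_add, ha, hb]
  | tmul a b => simp

lemma uCounit_aux (t : V ⊗[K] V) :
    (uCounit (K := K) (V := V)).toLinearMap.rTensor _ (TensorProduct.map (inrL K V) (inrL K V) t) =
    (inrL K V).lTensor K ((Coalgebra.counit (R := K) (A := V)).rTensor _ t) := by
  induction t with
  | zero => simp
  | add a b ha hb => simp only [map_add, ha, hb]
  | tmul a b => simp

lemma uCounit_aux' (t : V ⊗[K] V) :
    (uCounit (K := K) (V := V)).toLinearMap.lTensor _ (TensorProduct.map (inrL K V) (inrL K V) t) =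
    (inrL K V).rTensor K ((Coalgebra.counit (R := K) (A := V)).lTensor _ t) := by
  induction t with
  | zero => simp
  | add a b ha hb => simp only [map_add, ha, hb]
  | tmul a b => simp

/-- The unitary extension `uV = K ⊕ V` as a bialgebra. -/
noncomputable instance : Bialgebra K (Unitization K V) :=
  Bialgebra.ofAlgHom uComul uCounit
    (by
      refine Unitization.algHom_ext'' fun v => ?_
      have h1 := uCoassoc_aux (Coalgebra.comul (R := K) v)
      have h2 := uCoassoc_aux' (Coalgebra.comul (R := K) v)
      rw [Coalgebra.coassoc_apply, ← h2] at h1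
      rw [← uComul_inr] at h1
      exact h1)
    (by
      refine Unitization.algHom_ext'' fun v => ?_
      have h1 := uCounit_aux (Coalgebra.comul (R := K) v)
      rw [Coalgebra.rTensor_counit_comul, ← uComul_inr] at h1
      exact h1)
    (by
      refine Unitization.algHom_ext'' fun v => ?_
      have h1 := uCounit_aux' (Coalgebra.comul (R := K) v)
      rw [Coalgebra.lTensor_counit_comul, ← uComul_inr] at h1
      exact h1)

@[simp] lemma comul_inr (v : V) : Coalgebra.comul (R := K) (v : Unitization K V) =
    TensorProduct.map (inrL K V) (inrL K V) (Coalgebra.comul (R := K) v) := uComul_inr v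

@[simp] lemma counit_inr (v : V) : Coalgebra.counit (R := K) (v : Unitization K V) =
    Coalgebra.counit (R := K) v := uCounit_inr v

end NonUnitalBialgebra

/-- The unitary extension `uV = K ⊕ V` of `V`. -/
def UExt (K V : Type*) : Type _ := Unitization K V

namespace UExt

section Algebra

variable {K V : Type*} [CommRing K] [NonUnitalCommRing V] [Module K V]
  [IsScalarTower K V V] [SMulCommClass K V V]

noncomputable instance : CommRing (UExt K V) := inferInstanceAs (CommRing (Unitization K V))
noncomputable instance : Algebra K (UExt K V) := inferInstanceAs (Algebra K (Unitization K V))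

variable (K V) in
/-- The inclusion `V → uV`. -/
noncomputable def inr : V →ₗ[K] UExt K V := Unitization.inrHom K K V

variable (K V) in
/-- The projection `uV → V`. -/
noncomputable def snd : UExt K V →ₗ[K] V := Unitization.sndHom K K V

@[simp] theorem inr_mul (v w : V) : inr K V (v * w) = inr K V v * inr K V w :=
  Unitization.inr_mul K v w
@[simp] theorem snd_inr (v : V) : snd K V (inr K V v) = v := rfl
@[simp] theorem snd_one : snd K V 1 = 0 := rfl

theorem inr_mul_eq (v : V) (u : UExt K V) : inr K V v * u = inr K V (snd K V (inr K V v * u)) := by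
  refine Unitization.ext ?_ rfl
  change 0 * _ = (0 : K)
  rw [zero_mul]

theorem ind {p : UExt K V → Prop} (h : ∀ (r : K) (v : V), p (r • 1 + inr K V v)) (u : UExt K V) :
    p u := by
  have := h (Unitization.toProd u).1 (Unitization.toProd u).2
  have e : (Unitization.toProd u).1 • (1 : UExt K V) + inr K V (Unitization.toProd u).2 = u := by
    refine Unitization.ext ?_ ?_
    · change (Unitization.toProd u).1 * 1 + 0 = (Unitization.toProd u).1
      simp
    · change (Unitization.toProd u).1 • (0 : V) + (Unitization.toProd u).2 = (Unitization.toProd u).2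
      simp
  rwa [e] at this

end Algebra

section Bialgebra

variable {K V : Type*} [CommRing K] [NonUnitalCommRing V] [Module K V]
  [IsScalarTower K V V] [SMulCommClass K V V] [NonUnitalBialgebra K V]

noncomputable instance : Bialgebra K (UExt K V) := inferInstanceAs (Bialgebra K (Unitization K V))

@[simp] theorem comul_inr (v : V) : Coalgebra.comul (R := K) (inr K V v) =
    TensorProduct.map (inr K V) (inr K V) (Coalgebra.comul (R := K) v) :=
  NonUnitalBialgebra.comul_inr v

@[simp] theorem counit_inr (v : V) : Coalgebra.counit (R := K) (inr K V v) =
    Coalgebra.counit (R := K) v := NonUnitalBialgebra.counit_inr v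

end Bialgebra

end UExt

/-- The underlying vector space `T(V)` of `QSh(V)`; its product is the quasishuffle product, not the
concatenation. -/
def QSh (K V : Type*) [CommRing K] [AddCommGroup V] [Module K V] : Type _ := TensorAlgebra K V

namespace QSh

section Words

variable {K V M : Type*} [CommRing K] [AddCommGroup V] [Module K V] [AddCommGroup M] [Module K M]

noncomputable instance : AddCommGroup (QSh K V) := inferInstanceAs (AddCommGroup (TensorAlgebra K V))
noncomputable instance : Module K (QSh K V) := inferInstanceAs (Module K (TensorAlgebra K V))

variable (K V) in
/-- The identification of vector spaces `T(V) = QSh(V)`. -/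
noncomputable def ofTensorAlgebra : TensorAlgebra K V ≃ₗ[K] QSh K V := LinearEquiv.refl K _

variable (K V) in
/-- The empty word. -/
noncomputable def nil : QSh K V := ofTensorAlgebra K V 1

/-- `cons x w = xw` adds the letter `x` in front of `w`. -/
noncomputable def cons : V →ₗ[K] QSh K V →ₗ[K] QSh K V :=
  LinearMap.mk₂ K (fun x w => ofTensorAlgebra K V
      (TensorAlgebra.ι K x * (ofTensorAlgebra K V).symm w))
    (by intros; simp [add_mul]) (by intros; simp) (by intros; simp [mul_add]) (by intros; simp)

theorem induction_words {p : QSh K V → Prop} (hn : p (nil K V))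
    (hc : ∀ x w, p w → p (cons x w)) (ha : ∀ u v, p u → p v → p (u + v))
    (hs : ∀ (r : K) u, p u → p (r • u)) (w : QSh K V) : p w := by
  have key : ∀ a : TensorAlgebra K V, ∀ w : QSh K V, p w →
      p (ofTensorAlgebra K V (a * (ofTensorAlgebra K V).symm w)) := by
    intro a
    induction a using TensorAlgebra.induction with
    | algebraMap r =>
      intro w hw
      have := hs r w hw
      rwa [← Algebra.smul_def, map_smul, LinearEquiv.apply_symm_apply]
    | ι x => intro w hw; exact hc x w hw
    | mul a b iha ihb =>
      intro w hw
      have := iha _ (ihb w hw)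
      rwa [LinearEquiv.symm_apply_apply, ← mul_assoc] at this
    | add a b iha ihb =>
      intro w hw
      rw [add_mul, map_add]
      exact ha _ _ (iha w hw) (ihb w hw)
  have := key ((ofTensorAlgebra K V).symm w) _ hn
  simpa [nil] using this

theorem symm_cons (x : V) (w : QSh K V) : (ofTensorAlgebra K V).symm (cons x w) =
    TensorAlgebra.ι K x * (ofTensorAlgebra K V).symm w := rfl

/-- The action `(w, m) ↦ (xw, s₁(x, w) + s₂(x, m))` of a letter `x` on `T(V) × M`. -/
noncomputable def recStep (s₁ : V →ₗ[K] QSh K V →ₗ[K] M) (s₂ : V →ₗ[K] M →ₗ[K] M) :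
    V →ₗ[K] Module.End K (QSh K V × M) :=
  LinearMap.mk₂ K (fun x p => (cons x p.1, s₁ x p.1 + s₂ x p.2))
    (by intros; ext <;> simp; abel) (by intros; ext <;> simp)
    (by intros; ext <;> simp; abel) (by intros; ext <;> simp)

/-- The linear map `F` on `T(V)` with `F(1) = a` and `F(xw) = s₁(x, w) + s₂(x, F(w))`. -/
noncomputable def recLin (a : M) (s₁ : V →ₗ[K] QSh K V →ₗ[K] M) (s₂ : V →ₗ[K] M →ₗ[K] M) :
    QSh K V →ₗ[K] M :=
  LinearMap.snd K (QSh K V) M ∘ₗ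
    LinearMap.applyₗ (R := K) (M := QSh K V × M) (M₂ := QSh K V × M) (nil K V, a) ∘ₗ
    (TensorAlgebra.lift K (recStep s₁ s₂)).toLinearMap ∘ₗ
    (ofTensorAlgebra K V).symm.toLinearMap

section
variable (a : M) (s₁ : V →ₗ[K] QSh K V →ₗ[K] M) (s₂ : V →ₗ[K] M →ₗ[K] M)

@[simp] theorem recLin_nil : recLin a s₁ s₂ (nil K V) = a := by
  simp [recLin, nil]

@[simp] theorem recLin_cons (x : V) (w : QSh K V) :
    recLin a s₁ s₂ (cons x w) = s₁ x w + s₂ x (recLin a s₁ s₂ w) := by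
  have key : ∀ w : QSh K V, TensorAlgebra.lift K (recStep s₁ s₂)
      ((ofTensorAlgebra K V).symm w) (nil K V, a) = (w, recLin a s₁ s₂ w) := by
    intro w
    refine Prod.ext ?_ rfl
    induction w using induction_words with
    | hn => simp [nil]
    | hc x w ih =>
      rw [symm_cons, map_mul, TensorAlgebra.lift_ι_apply, Module.End.mul_apply, recStep,
        LinearMap.mk₂_apply, ← recStep, ih]
    | ha u v hu hv => rw [map_add, map_add, LinearMap.add_apply, Prod.fst_add, hu, hv]
    | hs r u hu => rw [map_smul, map_smul, LinearMap.smul_apply, Prod.smul_fst, hu]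
  have h2 := congrArg Prod.snd (key (cons x w))
  rw [symm_cons, map_mul, TensorAlgebra.lift_ι_apply, Module.End.mul_apply, key w] at h2
  exact h2.symm

end

/-- Two linear maps on `T(V)` which satisfy the same recursion are equal. -/
theorem ext_words {f g : QSh K V →ₗ[K] M} (hn : f (nil K V) = g (nil K V))
    (hc : ∀ x w, f w = g w → f (cons x w) = g (cons x w)) : f = g := by
  ext w
  induction w using induction_words with
  | hn => exact hn
  | hc x w ih => exact hc x w ih
  | ha u v hu hv => simp [hu, hv]
  | hs r u hu => simp [hu]

end Words

section Quasishuffle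

variable {K V : Type*} [CommRing K] [NonUnitalCommRing V] [Module K V]
  [IsScalarTower K V V] [SMulCommClass K V V]

/-- For `u ∈ T(V)`, `x ∈ V` and `f = (u ⧢ ·)`, this is `(xu ⧢ ·) = g`, with `g(1) = xu` and
`g(yw) = x f(yw) + y g(w) + (x · y) f(w)`. -/
noncomputable def qshStep (x : V) (u : QSh K V) (f : QSh K V →ₗ[K] QSh K V) :
    QSh K V →ₗ[K] QSh K V :=
  recLin (cons x u) (cons.compr₂ (cons x ∘ₗ f) + (cons ∘ₗ LinearMap.mul K V x).compl₂ f) cons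

@[simp] theorem qshStep_nil (x : V) (u : QSh K V) (f : QSh K V →ₗ[K] QSh K V) :
    qshStep x u f (nil K V) = cons x u := by simp [qshStep]

@[simp] theorem qshStep_cons (x : V) (u : QSh K V) (f : QSh K V →ₗ[K] QSh K V) (y : V)
    (w : QSh K V) : qshStep x u f (cons y w) =
      cons x (f (cons y w)) + cons y (qshStep x u f w) + cons (x * y) (f w) := by
  simp [qshStep]; abel

variable (K V) in
/-- The quasishuffle product, defined by `1 ⧢ w = w`, `v ⧢ 1 = v` and
`xv ⧢ yw = x(v ⧢ yw) + y(xv ⧢ w) + (x · y)(v ⧢ w)`. -/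
noncomputable def qsh : QSh K V →ₗ[K] QSh K V →ₗ[K] QSh K V :=
  recLin LinearMap.id
    (LinearMap.mk₂ K (fun x u => qshStep x u 0)
      (fun x y u => by
        refine ext_words (by simp) (fun z w h => ?_)
        simp only [LinearMap.add_apply] at h
        simp [h])
      (fun r x u => by
        refine ext_words (by simp) (fun z w h => ?_)
        simp only [LinearMap.smul_apply] at h
        simp [h])
      (fun x u v => by
        refine ext_words (by simp) (fun z w h => ?_)
        simp only [LinearMap.add_apply] at h
        simp [h])
      (fun r x u => by
        refine ext_words (by simp) (fun z w h => ?_)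
        simp only [LinearMap.smul_apply] at h
        simp [h]))
    (LinearMap.mk₂ K (fun x f => qshStep x 0 f)
      (fun x y u => by
        refine ext_words (by simp) (fun z w h => ?_)
        simp only [LinearMap.add_apply] at h
        simp [h, add_mul]; abel)
      (fun r x u => by
        refine ext_words (by simp) (fun z w h => ?_)
        simp only [LinearMap.smul_apply] at h
        simp [h, smul_mul_assoc])
      (fun x u v => by
        refine ext_words (by simp) (fun z w h => ?_)
        simp only [LinearMap.add_apply] at h
        simp [h]; abel)
      (fun r x u => by
        refine ext_words (by simp) (fun z w h => ?_)
        simp only [LinearMap.smul_apply] at h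
        simp [h]))

theorem nil_qsh (w : QSh K V) : qsh K V (nil K V) w = w := by simp [qsh]

theorem qsh_cons_aux (x : V) (u : QSh K V) :
    qsh K V (cons x u) = qshStep x u (qsh K V u) := by
  rw [qsh, recLin_cons, ← qsh]
  refine ext_words (by simp) (fun z w h => ?_)
  simp only [LinearMap.add_apply, LinearMap.mk₂_apply] at h ⊢
  simp [← h]; abel

theorem qsh_nil (w : QSh K V) : qsh K V w (nil K V) = w := by
  induction w using induction_words with
  | hn => exact nil_qsh _
  | hc x w ih => rw [qsh_cons_aux, qshStep_nil]
  | ha u v hu hv => simp [hu, hv]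
  | hs r u hu => simp [hu]

theorem cons_qsh_cons (x y : V) (v w : QSh K V) : qsh K V (cons x v) (cons y w) =
    cons x (qsh K V v (cons y w)) + cons y (qsh K V (cons x v) w) + cons (x * y) (qsh K V v w) := by
  rw [qsh_cons_aux, qshStep_cons]

theorem qsh_comm (u v : QSh K V) : qsh K V u v = qsh K V v u := by
  induction u using induction_words generalizing v with
  | hn => rw [nil_qsh, qsh_nil]
  | hc x u ihu =>
    induction v using induction_words with
    | hn => rw [nil_qsh, qsh_nil]
    | hc y v ihv =>
      rw [cons_qsh_cons, cons_qsh_cons, ihu, ihu, ihv, mul_comm x y]; abel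
    | ha u v hu hv => simp [hu, hv]
    | hs r u hu => simp [hu]
  | ha a b hu hv => simp [hu, hv]
  | hs r u hu => simp [hu]

theorem qsh_assoc (u v w : QSh K V) :
    qsh K V (qsh K V u v) w = qsh K V u (qsh K V v w) := by
  induction u using induction_words generalizing v w with
  | hn => rw [nil_qsh, nil_qsh]
  | hc x u ihu =>
    induction v using induction_words generalizing w with
    | hn => rw [nil_qsh, qsh_nil]
    | hc y v ihv =>
      induction w using induction_words with
      | hn => rw [qsh_nil, qsh_nil]
      | hc z w ihw =>
        have hx := congrArg (cons x) (ihu (cons y v) (cons z w))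
        have hz := congrArg (cons z) ihw
        simp only [cons_qsh_cons y z v w, map_add] at hx
        simp only [cons_qsh_cons x y u v, map_add, LinearMap.add_apply] at hz
        simp only [cons_qsh_cons, map_add, LinearMap.add_apply]
        rw [hx, ihu v (cons z w), ihu (cons y v) w, ihu v w, ihv (cons z w), ihv w, mul_assoc]
        rw [← sub_eq_zero] at hz ⊢
        rw [← hz]
        abel
      | ha u v hu hv => simp [hu, hv]
      | hs r u hu => simp [hu]
    | ha u v hu hv => simp [hu, hv]
    | hs r u hu => simp [hu]
  | ha a b hu hv => simp [hu, hv]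
  | hs r u hu => simp [hu]

end Quasishuffle

end QSh

namespace QSh

section Quasishuffle

variable {K V : Type*} [CommRing K] [NonUnitalCommRing V] [Module K V]
  [IsScalarTower K V V] [SMulCommClass K V V]

noncomputable instance : CommRing (QSh K V) :=
  { (inferInstance : AddCommGroup (QSh K V)) with
    mul := fun u v => qsh K V u v
    one := nil K V
    left_distrib := fun u v w => map_add (qsh K V u) v w
    right_distrib := fun u v w => LinearMap.map_add₂ (qsh K V) u v w
    zero_mul := fun u => LinearMap.map_zero₂ (qsh K V) u
    mul_zero := fun u => map_zero (qsh K V u)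
    mul_assoc := qsh_assoc
    one_mul := nil_qsh
    mul_one := qsh_nil
    mul_comm := qsh_comm }

noncomputable instance : Algebra K (QSh K V) :=
  Algebra.ofModule (fun r u v => LinearMap.map_smul₂ (qsh K V) r u v)
    (fun r u v => map_smul (qsh K V u) r v)

theorem mul_def (u v : QSh K V) : u * v = qsh K V u v := rfl
theorem nil_eq_one : nil K V = 1 := rfl

theorem cons_mul_cons (x y : V) (v w : QSh K V) : cons x v * cons y w =
    cons x (v * cons y w) + cons y (cons x v * w) + cons (x * y) (v * w) := cons_qsh_cons x y v w

@[simp] theorem recLin_one {M : Type*} [AddCommGroup M] [Module K M] (a : M)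
    (s₁ : V →ₗ[K] QSh K V →ₗ[K] M) (s₂ : V →ₗ[K] M →ₗ[K] M) :
    recLin a s₁ s₂ (1 : QSh K V) = a := recLin_nil a s₁ s₂

theorem ind {p : QSh K V → Prop} (hn : p 1)
    (hc : ∀ x w, p w → p (cons x w)) (ha : ∀ u v, p u → p v → p (u + v))
    (hs : ∀ (r : K) u, p u → p (r • u)) (w : QSh K V) : p w :=
  induction_words hn hc ha hs w

theorem ext_lin {M : Type*} [AddCommGroup M] [Module K M] {f g : QSh K V →ₗ[K] M} (hn : f 1 = g 1)
    (hc : ∀ x w, f w = g w → f (cons x w) = g (cons x w)) : f = g := ext_words hn hc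

variable {A : Type*} [CommRing A] [Algebra K A]

variable (K V A) in
/-- The bilinear map `(v ⊗ a, w ⊗ b) ↦ vw ⊗ ab`. -/
noncomputable def consA : V ⊗[K] A →ₗ[K] QSh K V ⊗[K] A →ₗ[K] QSh K V ⊗[K] A :=
  TensorProduct.map₂ cons (LinearMap.mul K A)

@[simp] theorem consA_tmul (x : V) (a : A) (w : QSh K V) (b : A) :
    consA K V A (x ⊗ₜ a) (w ⊗ₜ b) = cons x w ⊗ₜ (a * b) := by simp [consA]

theorem consA_mul (z z' : V ⊗[K] A) (s t : QSh K V ⊗[K] A) :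
    consA K V A z s * consA K V A z' t = consA K V A z (s * consA K V A z' t) +
      consA K V A z' (consA K V A z s * t) + consA K V A (z * z') (s * t) := by
  induction s with
  | zero => simp
  | add a b ha hb => simp only [map_add, add_mul, ha, hb]; abel
  | tmul u c =>
  induction t with
  | zero => simp
  | add a b ha hb => simp only [map_add, mul_add, ha, hb]; abel
  | tmul v d =>
  induction z with
  | zero => simp
  | add a b ha hb => simp only [map_add, add_mul, ha, hb, LinearMap.add_apply]; abel
  | tmul x a =>
  induction z' with
  | zero => simp
  | add a b ha hb => simp only [map_add, mul_add, ha, hb, LinearMap.add_apply]; abel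
  | tmul y b =>
    simp only [consA_tmul, Algebra.TensorProduct.tmul_mul_tmul, cons_mul_cons,
      TensorProduct.add_tmul]
    congr 2
    · congr 1; ring
    · congr 1; ring
    · ring

theorem consA_mul_right (z : V ⊗[K] A) (s : QSh K V ⊗[K] A) (a : A) :
    consA K V A z s * (1 ⊗ₜ a) = consA K V A z (s * (1 ⊗ₜ a)) := by
  induction s with
  | zero => simp
  | add a b ha hb => simp only [map_add, add_mul, ha, hb]
  | tmul u c =>
  induction z with
  | zero => simp
  | add a b ha hb => simp only [map_add, add_mul, ha, hb, LinearMap.add_apply]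
  | tmul x a => simp [mul_assoc]

/-! Deconcatenation -/

variable (K V) in
/-- The counit: `ε(1) = 1` and `ε(xw) = 0`. -/
noncomputable def counitL : QSh K V →ₗ[K] K := recLin 1 0 0

variable (K V) in
/-- The deconcatenation coproduct: `Δ(1) = 1 ⊗ 1` and `Δ(xw) = 1 ⊗ xw + (x ⊗ 1)Δ(w)` (here `x ⊗ 1`
acts by concatenation). -/
noncomputable def deconc : QSh K V →ₗ[K] QSh K V ⊗[K] QSh K V :=
  recLin (1 ⊗ₜ 1) (cons.compr₂ (TensorProduct.mk K (QSh K V) (QSh K V) 1))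
    (LinearMap.rTensorHom (QSh K V) ∘ₗ cons)

@[simp] theorem counitL_one : counitL K V 1 = 1 := by simp [counitL]
@[simp] theorem counitL_cons (x : V) (w : QSh K V) : counitL K V (cons x w) = 0 := by simp [counitL]
@[simp] theorem deconc_one : deconc K V 1 = 1 ⊗ₜ 1 := by simp [deconc]
theorem deconc_cons (x : V) (w : QSh K V) : deconc K V (cons x w) =
    1 ⊗ₜ cons x w + (cons x).rTensor _ (deconc K V w) := by simp [deconc]

theorem rTensor_cons_eq (x : V) (t : QSh K V ⊗[K] A) :
    (cons x).rTensor A t = consA K V A (x ⊗ₜ 1) t := by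
  induction t with
  | zero => simp
  | add a b ha hb => simp only [map_add, ha, hb]
  | tmul u c => simp

theorem counitL_mul (u v : QSh K V) : counitL K V (u * v) = counitL K V u * counitL K V v := by
  induction u using ind generalizing v with
  | hn => simp
  | hc x u ihu =>
    induction v using ind with
    | hn => simp
    | hc y v ihv => simp [cons_mul_cons]
    | ha u v hu hv => simp [hu, hv, mul_add]
    | hs r u hu => simp [hu, mul_assoc, mul_left_comm]
  | ha a b hu hv => simp [hu, hv, add_mul]
  | hs r u hu => simp [hu, mul_assoc, mul_left_comm]

theorem deconc_mul (u v : QSh K V) : deconc K V (u * v) = deconc K V u * deconc K V v := by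
  induction u using ind generalizing v with
  | hn => rw [deconc_one, one_mul, ← Algebra.TensorProduct.one_def, one_mul]
  | hc x u ihu =>
    induction v using ind with
    | hn => rw [deconc_one, mul_one, ← Algebra.TensorProduct.one_def, mul_one]
    | hc y v ihv =>
      rw [cons_mul_cons, map_add, map_add, deconc_cons, deconc_cons, deconc_cons, ihu, ihu, ihv,
        deconc_cons, deconc_cons]
      simp only [rTensor_cons_eq, add_mul, mul_add, consA_mul, map_add, consA_mul_right,
        Algebra.TensorProduct.tmul_mul_tmul, one_mul, mul_one]
      rw [mul_comm (1 ⊗ₜ[K] cons x u) (consA K V _ _ _), consA_mul_right,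
        mul_comm _ (1 ⊗ₜ[K] cons x u), cons_mul_cons, TensorProduct.tmul_add,
        TensorProduct.tmul_add]
      abel
    | ha u v hu hv => simp only [hu, hv, mul_add, map_add]
    | hs r u hu => simp only [hu, mul_smul_comm, map_smul]
  | ha a b hu hv => simp only [hu, hv, add_mul, map_add]
  | hs r u hu => simp only [hu, smul_mul_assoc, map_smul]

theorem deconc_coassoc_aux (x : V) (t : QSh K V ⊗[K] QSh K V) :
    TensorProduct.assoc K _ _ _ ((deconc K V).rTensor _ ((cons x).rTensor _ t)) =
      1 ⊗ₜ ((cons x).rTensor _ t) +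
        (cons x).rTensor _ (TensorProduct.assoc K _ _ _ ((deconc K V).rTensor _ t)) := by
  induction t with
  | zero => simp
  | add a b ha hb => simp only [map_add, ha, hb, TensorProduct.tmul_add]; abel
  | tmul u c =>
    simp only [LinearMap.rTensor_tmul, deconc_cons, TensorProduct.add_tmul, map_add,
      TensorProduct.assoc_tmul]
    congr 1
    induction deconc K V u with
    | zero => simp
    | add a b ha hb => simp only [map_add, ha, hb, TensorProduct.add_tmul]
    | tmul u c => simp

theorem lTensor_rTensor' {M N P Q : Type*} [AddCommGroup M] [AddCommGroup N] [AddCommGroup P]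
    [AddCommGroup Q] [Module K M] [Module K N] [Module K P] [Module K Q]
    (f : M →ₗ[K] N) (g : P →ₗ[K] Q) (t : M ⊗[K] P) :
    g.lTensor _ (f.rTensor _ t) = f.rTensor _ (g.lTensor _ t) := by
  rw [← LinearMap.comp_apply, ← LinearMap.comp_apply, LinearMap.lTensor_comp_rTensor,
    LinearMap.rTensor_comp_lTensor]

noncomputable instance : Coalgebra K (QSh K V) where
  comul := deconc K V
  counit := counitL K V
  coassoc := by
    refine ext_lin (by simp) (fun x w h => ?_)
    simp only [LinearMap.comp_apply, LinearEquiv.coe_coe] at h ⊢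
    rw [deconc_cons, map_add, map_add, map_add, deconc_coassoc_aux, h, lTensor_rTensor',
      LinearMap.rTensor_tmul, LinearMap.lTensor_tmul, deconc_cons, deconc_one,
      TensorProduct.assoc_tmul, TensorProduct.tmul_add]
    abel
  rTensor_counit_comp_comul := by
    refine ext_lin (by simp) (fun x w h => ?_)
    have : counitL K V ∘ₗ cons x = 0 := by ext; simp
    simp only [LinearMap.comp_apply] at h ⊢
    rw [deconc_cons, map_add, ← LinearMap.comp_apply (LinearMap.rTensor _ (counitL K V)),
      ← LinearMap.rTensor_comp, this]
    simp
  lTensor_counit_comp_comul := by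
    refine ext_lin (by simp) (fun x w h => ?_)
    simp only [LinearMap.comp_apply] at h ⊢
    rw [deconc_cons, map_add, lTensor_rTensor', h]
    simp

noncomputable instance : Bialgebra K (QSh K V) :=
  Bialgebra.mk' K (QSh K V) counitL_one (counitL_mul _ _)
    (by exact deconc_one) (deconc_mul _ _)

theorem comul_eq : Coalgebra.comul (R := K) (A := QSh K V) = deconc K V := rfl
theorem counit_eq : Coalgebra.counit (R := K) (A := QSh K V) = counitL K V := rfl

end Quasishuffle

end QSh

/-- The map `b₁ ⊗ v₂ ⊗ b₃ ⊗ v₄ ↦ b₁ ⊗ b₃ ⊗ v₂ · v₄`. -/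
noncomputable def m1324 (K B W : Type*) [CommRing K] [AddCommGroup B] [Module K B]
    [Ring W] [Algebra K W] : (B ⊗[K] W) ⊗[K] (B ⊗[K] W) →ₗ[K] (B ⊗[K] B) ⊗[K] W :=
  (LinearMap.mul' K W).lTensor (B ⊗[K] B) ∘ₗ
    (TensorProduct.tensorTensorTensorComm K B W B W).toLinearMap

@[simp] theorem m1324_tmul {K B W : Type*} [CommRing K] [AddCommGroup B] [Module K B]
    [Ring W] [Algebra K W] (b c : B) (v w : W) :
    m1324 K B W ((b ⊗ₜ v) ⊗ₜ (c ⊗ₜ w)) = (b ⊗ₜ c) ⊗ₜ (v * w) := by simp [m1324]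

namespace QSh

section Coaction

variable {K V : Type*} [CommRing K] [NonUnitalCommRing V] [Module K V]
  [IsScalarTower K V V] [SMulCommClass K V V]

variable {A : Type*} [CommRing A] [Algebra K A]

/-- The map `F` with `F(1) = 1 ⊗ 1` and `F(xw) = z(x) F(w)`. -/
noncomputable def foldA (z : V →ₗ[K] V ⊗[K] A) : QSh K V →ₗ[K] QSh K V ⊗[K] A :=
  recLin (1 ⊗ₜ 1) 0 (consA K V A ∘ₗ z)

section
variable (z : V →ₗ[K] V ⊗[K] A)

@[simp] theorem foldA_one : foldA z 1 = 1 ⊗ₜ 1 := by simp [foldA]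
@[simp] theorem foldA_cons (x : V) (w : QSh K V) :
    foldA z (cons x w) = consA K V A (z x) (foldA z w) := by simp [foldA]

theorem foldA_mul (hz : ∀ x y, z (x * y) = z x * z y) (u v : QSh K V) :
    foldA z (u * v) = foldA z u * foldA z v := by
  induction u using ind generalizing v with
  | hn => rw [foldA_one, one_mul, ← Algebra.TensorProduct.one_def, one_mul]
  | hc x u ihu =>
    induction v using ind with
    | hn => rw [foldA_one, mul_one, ← Algebra.TensorProduct.one_def, mul_one]
    | hc y v ihv =>
      rw [cons_mul_cons, map_add, map_add, foldA_cons, foldA_cons, foldA_cons, ihu, ihu, ihv,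
        foldA_cons, foldA_cons, consA_mul, hz]
    | ha u v hu hv => simp only [hu, hv, mul_add, map_add]
    | hs r u hu => simp only [hu, mul_smul_comm, map_smul]
  | ha a b hu hv => simp only [hu, hv, add_mul, map_add]
  | hs r u hu => simp only [hu, smul_mul_assoc, map_smul]

variable (K V A) in
/-- `t ↦ 1 ⊗ t`. -/
noncomputable def inj2 : QSh K V ⊗[K] A →ₗ[K] (QSh K V ⊗[K] QSh K V) ⊗[K] A :=
  (TensorProduct.mk K (QSh K V) (QSh K V) 1).rTensor A

@[simp] theorem inj2_tmul (u : QSh K V) (a : A) : inj2 K V A (u ⊗ₜ a) = (1 ⊗ₜ u) ⊗ₜ a := rfl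

variable (K V A) in
/-- `(v ⊗ a, w ⊗ w' ⊗ b) ↦ vw ⊗ w' ⊗ ab`. -/
noncomputable def cons2 : V ⊗[K] A →ₗ[K] (QSh K V ⊗[K] QSh K V) ⊗[K] A →ₗ[K]
    (QSh K V ⊗[K] QSh K V) ⊗[K] A :=
  TensorProduct.map₂ (LinearMap.rTensorHom (QSh K V) ∘ₗ cons) (LinearMap.mul K A)

@[simp] theorem cons2_tmul (x : V) (a : A) (t : QSh K V ⊗[K] QSh K V) (b : A) :
    cons2 K V A (x ⊗ₜ a) (t ⊗ₜ b) = ((cons x).rTensor _ t) ⊗ₜ (a * b) := by simp [cons2]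

theorem deconc_consA (ζ : V ⊗[K] A) (t : QSh K V ⊗[K] A) :
    (deconc K V).rTensor A (consA K V A ζ t) =
      inj2 K V A (consA K V A ζ t) + cons2 K V A ζ ((deconc K V).rTensor A t) := by
  induction t with
  | zero => simp
  | add a b ha hb => simp only [map_add, ha, hb]; abel
  | tmul u c =>
  induction ζ with
  | zero => simp
  | add a b ha hb => simp only [map_add, ha, hb, LinearMap.add_apply]; abel
  | tmul x a => simp [deconc_cons, TensorProduct.add_tmul]

theorem m1324_consA (ζ : V ⊗[K] A) (s t : QSh K V ⊗[K] A) :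
    m1324 K (QSh K V) A (consA K V A ζ s ⊗ₜ t) =
      cons2 K V A ζ (m1324 K (QSh K V) A (s ⊗ₜ t)) := by
  induction s with
  | zero => simp
  | add a b ha hb => simp only [map_add, ha, hb, TensorProduct.add_tmul]
  | tmul u c =>
  induction t with
  | zero => simp
  | add a b ha hb => simp only [map_add, ha, hb, TensorProduct.tmul_add]
  | tmul v d =>
  induction ζ with
  | zero => simp
  | add a b ha hb => simp only [map_add, ha, hb, LinearMap.add_apply, TensorProduct.add_tmul]
  | tmul x a => simp [mul_assoc]

theorem m1324_one (t : QSh K V ⊗[K] A) :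
    m1324 K (QSh K V) A ((1 ⊗ₜ 1) ⊗ₜ t) = inj2 K V A t := by
  induction t with
  | zero => simp
  | add a b ha hb => simp only [map_add, ha, hb, TensorProduct.tmul_add]
  | tmul v d => simp

theorem foldA_deconc (w : QSh K V) : (deconc K V).rTensor A (foldA z w) =
    m1324 K (QSh K V) A (TensorProduct.map (foldA z) (foldA z) (deconc K V w)) := by
  have aux : ∀ x, ∀ t : QSh K V ⊗[K] QSh K V,
      m1324 K (QSh K V) A (TensorProduct.map (foldA z) (foldA z) ((cons x).rTensor _ t)) =
      cons2 K V A (z x) (m1324 K (QSh K V) A (TensorProduct.map (foldA z) (foldA z) t)) := by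
    intro x t
    induction t with
    | zero => simp
    | add a b ha hb => simp only [map_add, ha, hb]
    | tmul u v => simp [m1324_consA]
  induction w using ind with
  | hn => simp
  | hc x w ih =>
    rw [foldA_cons, deconc_consA, ih, deconc_cons, map_add, map_add, aux, TensorProduct.map_tmul,
      foldA_one, m1324_one, foldA_cons]
  | ha a b ha hb => simp only [map_add, ha, hb]
  | hs r u hu => simp only [map_smul, hu]

theorem counitL_consA (ζ : V ⊗[K] A) (t : QSh K V ⊗[K] A) :
    (counitL K V).rTensor A (consA K V A ζ t) = 0 := by
  induction t with
  | zero => simp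
  | add a b ha hb => simp only [map_add, ha, hb, add_zero]
  | tmul u c =>
  induction ζ with
  | zero => simp
  | add a b ha hb => simp only [map_add, ha, hb, LinearMap.add_apply, add_zero]
  | tmul x a => simp

theorem foldA_counitL (w : QSh K V) :
    (counitL K V).rTensor A (foldA z w) = counitL K V w ⊗ₜ 1 := by
  induction w using ind with
  | hn => simp
  | hc x w ih => simp [counitL_consA]
  | ha a b ha hb => simp only [map_add, ha, hb, TensorProduct.add_tmul]
  | hs r u hu => simp only [map_smul, hu, TensorProduct.smul_tmul']

theorem lTensor_consA {A' : Type*} [CommRing A'] [Algebra K A'] (f : A →ₐ[K] A') (ζ : V ⊗[K] A)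
    (t : QSh K V ⊗[K] A) : f.toLinearMap.lTensor _ (consA K V A ζ t) =
      consA K V A' (f.toLinearMap.lTensor _ ζ) (f.toLinearMap.lTensor _ t) := by
  induction t with
  | zero => simp
  | add a b ha hb => simp only [map_add, ha, hb]
  | tmul u c =>
  induction ζ with
  | zero => simp
  | add a b ha hb => simp only [map_add, ha, hb, LinearMap.add_apply]
  | tmul x a => simp

theorem rid_consA (ζ : V ⊗[K] K) (t : QSh K V ⊗[K] K) : TensorProduct.rid K _ (consA K V K ζ t) =
      cons (TensorProduct.rid K _ ζ) (TensorProduct.rid K _ t) := by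
  induction t with
  | zero => simp
  | add a b ha hb => simp only [map_add, ha, hb]
  | tmul u c =>
  induction ζ with
  | zero => simp
  | add a b ha hb => simp only [map_add, ha, hb, LinearMap.add_apply]
  | tmul x a =>
    simp only [consA_tmul, TensorProduct.rid_tmul, map_smul, LinearMap.smul_apply]
    rw [mul_smul, smul_comm]

theorem assoc_consA (ζ : V ⊗[K] A) (t : QSh K V ⊗[K] A) (a b : A) :
    TensorProduct.assoc K _ _ _ (consA K V A ζ t ⊗ₜ[K] (a * b)) =
      consA K V (A ⊗[K] A) (TensorProduct.assoc K _ _ _ (ζ ⊗ₜ a))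
        (TensorProduct.assoc K _ _ _ (t ⊗ₜ b)) := by
  induction t with
  | zero => simp
  | add a b ha hb => simp only [map_add, ha, hb, TensorProduct.add_tmul]
  | tmul u c =>
  induction ζ with
  | zero => simp
  | add a b ha hb => simp only [map_add, ha, hb, LinearMap.add_apply, TensorProduct.add_tmul]
  | tmul x a => simp

theorem foldA_consA (ζ : V ⊗[K] A) (t : QSh K V ⊗[K] A) :
    TensorProduct.assoc K _ _ _ ((foldA z).rTensor A (consA K V A ζ t)) =
      consA K V (A ⊗[K] A) (TensorProduct.assoc K _ _ _ (z.rTensor A ζ))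
        (TensorProduct.assoc K _ _ _ ((foldA z).rTensor A t)) := by
  induction t with
  | zero => simp
  | add a b ha hb => simp only [map_add, ha, hb]
  | tmul u c =>
  induction ζ with
  | zero => simp
  | add a b ha hb => simp only [map_add, ha, hb, LinearMap.add_apply]
  | tmul x a => simp [assoc_consA]

theorem foldA_coassoc (Δ : A →ₐ[K] A ⊗[K] A)
    (h : ∀ x, TensorProduct.assoc K _ _ _ (z.rTensor A (z x)) = Δ.toLinearMap.lTensor _ (z x))
    (w : QSh K V) : TensorProduct.assoc K _ _ _ ((foldA z).rTensor A (foldA z w)) =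
      Δ.toLinearMap.lTensor _ (foldA z w) := by
  induction w using ind with
  | hn => simp [Algebra.TensorProduct.one_def]
  | hc x w ih => rw [foldA_cons, foldA_consA, ih, h, lTensor_consA]
  | ha a b ha hb => simp only [map_add, ha, hb]
  | hs r u hu => simp only [map_smul, hu]

theorem foldA_counit (ε : A →ₐ[K] K)
    (h : ∀ x, TensorProduct.rid K _ (ε.toLinearMap.lTensor _ (z x)) = x)
    (w : QSh K V) : TensorProduct.rid K _ (ε.toLinearMap.lTensor _ (foldA z w)) = w := by
  induction w using ind with
  | hn => simp
  | hc x w ih => rw [foldA_cons, lTensor_consA, rid_consA, ih, h]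
  | ha a b ha hb => simp only [map_add, ha, hb]
  | hs r u hu => simp only [map_smul, hu]

end

variable [NonUnitalBialgebra K V]

variable (K V) in
/-- `v ↦ v' ⊗ v'' ∈ V ⊗ uV`. -/
noncomputable def comulU : V →ₗ[K] V ⊗[K] UExt K V :=
  (UExt.inr K V).lTensor V ∘ₗ Coalgebra.comul

variable (K V) in
/-- The coaction `ρ(v₁ … vₙ) = v₁' … vₙ' ⊗ v₁'' · … · vₙ''`, defined by `ρ(1) = 1 ⊗ 1` and
`ρ(xw) = (x' ⊗ x'')ρ(w)`. -/
noncomputable def coactL : QSh K V →ₗ[K] QSh K V ⊗[K] UExt K V := foldA (comulU K V)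

theorem lTensor_mul_aux (j : V →ₗ[K] A) (hj : ∀ x y, j (x * y) = j x * j y) (s t : V ⊗[K] V) :
    j.lTensor V (s * t) = j.lTensor V s * j.lTensor V t := by
  induction s with
  | zero => simp
  | add a b ha hb => simp only [map_add, add_mul, ha, hb]
  | tmul u c =>
  induction t with
  | zero => simp
  | add a b ha hb => simp only [map_add, mul_add, ha, hb]
  | tmul v d => simp [hj]

theorem comulU_mul (x y : V) : comulU K V (x * y) = comulU K V x * comulU K V y := by
  simp only [comulU, LinearMap.comp_apply, NonUnitalBialgebra.comul_mul']
  exact lTensor_mul_aux (UExt.inr K V) UExt.inr_mul _ _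

theorem comulU_coassoc (x : V) :
    TensorProduct.assoc K _ _ _ ((comulU K V).rTensor _ (comulU K V x)) =
      (Bialgebra.comulAlgHom K (UExt K V)).toLinearMap.lTensor _ (comulU K V x) := by
  have h := congrArg ((TensorProduct.map (UExt.inr K V)
    (UExt.inr K V)).lTensor V) (Coalgebra.coassoc_apply (R := K) x)
  have aux : ∀ t : V ⊗[K] V, TensorProduct.assoc K _ _ _ ((comulU K V).rTensor _
      ((UExt.inr K V).lTensor V t)) =
      (TensorProduct.map (UExt.inr K V) (UExt.inr K V)).lTensor V
        (TensorProduct.assoc K _ _ _ ((Coalgebra.comul (R := K) (A := V)).rTensor _ t)) := by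
    intro t
    induction t with
    | zero => simp
    | add a b ha hb => simp only [map_add, ha, hb]
    | tmul u c =>
      simp only [LinearMap.lTensor_tmul, LinearMap.rTensor_tmul, comulU, LinearMap.comp_apply]
      induction Coalgebra.comul (R := K) u with
      | zero => simp
      | add a b ha hb => simp only [map_add, ha, hb, TensorProduct.add_tmul]
      | tmul u c => simp
  have aux' : ∀ t : V ⊗[K] V, (Bialgebra.comulAlgHom K (UExt K V)).toLinearMap.lTensor _
      ((UExt.inr K V).lTensor V t) =
      (TensorProduct.map (UExt.inr K V) (UExt.inr K V)).lTensor V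
        ((Coalgebra.comul (R := K) (A := V)).lTensor _ t) := by
    intro t
    induction t with
    | zero => simp
    | add a b ha hb => simp only [map_add, ha, hb]
    | tmul u c => simp
  rw [comulU, LinearMap.comp_apply, ← comulU, aux, aux', h]

theorem comulU_counit (x : V) :
    TensorProduct.rid K _ ((Bialgebra.counitAlgHom K (UExt K V)).toLinearMap.lTensor _
      (comulU K V x)) = x := by
  have aux' : ∀ t : V ⊗[K] V, (Bialgebra.counitAlgHom K (UExt K V)).toLinearMap.lTensor _
      ((UExt.inr K V).lTensor V t) =
        (Coalgebra.counit (R := K) (A := V)).lTensor _ t := by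
    intro t
    induction t with
    | zero => simp
    | add a b ha hb => simp only [map_add, ha, hb]
    | tmul u c => simp
  rw [comulU, LinearMap.comp_apply, aux', Coalgebra.lTensor_counit_comul]
  simp

variable (K V) in
/-- `ρ` as an algebra morphism. -/
noncomputable def coact : QSh K V →ₐ[K] QSh K V ⊗[K] UExt K V :=
  AlgHom.ofLinearMap (coactL K V) (foldA_one _) (foldA_mul _ comulU_mul)

theorem consA_comulU_mem (x : V) (t : QSh K V ⊗[K] UExt K V) :
    consA K V _ (comulU K V x) t ∈
      LinearMap.range ((UExt.inr K V).lTensor (QSh K V)) := by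
  rw [comulU, LinearMap.comp_apply]
  induction t with
  | zero => simp
  | add a b ha hb => rw [map_add]; exact add_mem ha hb
  | tmul u c =>
  induction Coalgebra.comul (R := K) x with
  | zero => simp
  | add a b ha hb => rw [map_add, map_add, LinearMap.add_apply]; exact add_mem ha hb
  | tmul y a =>
    exact ⟨cons y u ⊗ₜ _, by
      rw [LinearMap.lTensor_tmul, LinearMap.lTensor_tmul, consA_tmul, UExt.inr_mul_eq]⟩

theorem coactL_mem (w : QSh K V) (hw : counitL K V w = 0) : coactL K V w ∈
      LinearMap.range ((UExt.inr K V).lTensor (QSh K V)) := by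
  have key : ∀ w, coactL K V w - counitL K V w • (1 ⊗ₜ 1) ∈
      LinearMap.range ((UExt.inr K V).lTensor (QSh K V)) := by
    intro w
    clear hw
    induction w using ind with
    | hn => simp [coactL]
    | hc x w ih => simpa [coactL] using consA_comulU_mem x _
    | ha a b ha hb =>
      rw [map_add, map_add, add_smul, add_sub_add_comm]
      exact add_mem ha hb
    | hs r u hu =>
      rw [map_smul, map_smul, smul_assoc, ← smul_sub]
      exact Submodule.smul_mem _ r hu
  simpa [hw] using key w

end Coaction

end QSh

namespace QSh

section SecondCoproduct

variable {K V : Type*} [CommRing K] [NonUnitalCommRing V] [Module K V]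
  [IsScalarTower K V V] [SMulCommClass K V V] [NonUnitalBialgebra K V]

section
variable {R R' : Type*} [AddCommGroup R] [Module K R] [AddCommGroup R'] [Module K R']

variable (K V R) in
/-- `(x, c ⊗ p ⊗ r) ↦ x''c ⊗ x' · p ⊗ r`: adds the letter `x` in front of the first block of a word,
where `c` is the word of the `v''` and `p` the product of the `v'` for `v` in this block. -/
noncomputable def blk : V →ₗ[K] Module.End K (QSh K V ⊗[K] (UExt K V ⊗[K] R)) :=
  TensorProduct.map₂ cons (LinearMap.rTensorHom R ∘ₗ LinearMap.mul K (UExt K V) ∘ₗ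
      UExt.inr K V) ∘ₗ
    (TensorProduct.comm K V V).toLinearMap ∘ₗ Coalgebra.comul

variable (K V R) in
/-- `r ↦ 1 ⊗ 1 ⊗ r`: opens a new, empty block. -/
noncomputable def newBlk : R →ₗ[K] QSh K V ⊗[K] (UExt K V ⊗[K] R) :=
  TensorProduct.mk K _ _ 1 ∘ₗ TensorProduct.mk K _ _ 1

/-- `c ⊗ (λ + p) ⊗ r ↦ g(p ⊗ c)(r)`, for `λ ∈ K` and `p ∈ V`. -/
noncomputable def closeWith (g : V ⊗[K] QSh K V →ₗ[K] Module.End K R) :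
    QSh K V ⊗[K] (UExt K V ⊗[K] R) →ₗ[K] R :=
  TensorProduct.lift (g ∘ₗ (UExt.snd K V).rTensor (QSh K V) ∘ₗ
      (TensorProduct.comm K (QSh K V) (UExt K V)).toLinearMap) ∘ₗ
    (TensorProduct.assoc K (QSh K V) (UExt K V) R).symm.toLinearMap

@[simp] theorem newBlk_apply (r : R) : newBlk K V R r = 1 ⊗ₜ (1 ⊗ₜ r) := rfl

@[simp] theorem closeWith_tmul (g : V ⊗[K] QSh K V →ₗ[K] Module.End K R) (c : QSh K V)
    (p : UExt K V) (r : R) : closeWith g (c ⊗ₜ (p ⊗ₜ r)) = g (UExt.snd K V p ⊗ₜ c) r := by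
  simp [closeWith]

@[simp] theorem closeWith_newBlk (g : V ⊗[K] QSh K V →ₗ[K] Module.End K R) (r : R) :
    closeWith g (newBlk K V R r) = 0 := by
  simp

/-- `blk` for a given tensor `z ∈ V ⊗ V` in place of `δ_V(x)`. -/
noncomputable def blkz : V ⊗[K] V →ₗ[K] Module.End K (QSh K V ⊗[K] (UExt K V ⊗[K] R)) :=
  TensorProduct.map₂ cons (LinearMap.rTensorHom R ∘ₗ LinearMap.mul K (UExt K V) ∘ₗ
      UExt.inr K V) ∘ₗ (TensorProduct.comm K V V).toLinearMap

theorem blk_apply (x : V) : blk K V R x = blkz (Coalgebra.comul (R := K) x) := rfl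

@[simp] theorem blkz_tmul (a b : V) (c : QSh K V) (p : UExt K V) (r : R) :
    blkz (a ⊗ₜ b) (c ⊗ₜ (p ⊗ₜ r)) = cons b c ⊗ₜ ((UExt.inr K V a * p) ⊗ₜ r) := by
  simp [blkz]

/-- Induction on `Q ⊗ (U ⊗ R)`. -/
theorem ind3 {p : QSh K V ⊗[K] (UExt K V ⊗[K] R) → Prop} (h0 : p 0)
    (ha : ∀ a b, p a → p b → p (a + b)) (ht : ∀ c u r, p (c ⊗ₜ (u ⊗ₜ r))) (d) : p d := by
  induction d with
  | zero => exact h0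
  | add a b iha ihb => exact ha _ _ iha ihb
  | tmul c e =>
    induction e with
    | zero => simpa using h0
    | add a b iha ihb => rw [TensorProduct.tmul_add]; exact ha _ _ iha ihb
    | tmul u r => exact ht _ _ _

theorem blk_lTensor (f : R →ₗ[K] R') (x : V) (d : QSh K V ⊗[K] (UExt K V ⊗[K] R)) :
    (f.lTensor _).lTensor _ (blk K V R x d) = blk K V R' x ((f.lTensor _).lTensor _ d) := by
  rw [blk_apply, blk_apply]
  induction d using ind3 with
  | h0 => simp
  | ha a b ha hb => simp only [map_add, ha, hb]
  | ht c u r =>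
    induction Coalgebra.comul (R := K) x with
    | zero => simp
    | add a b ha hb => simp only [map_add, LinearMap.add_apply, ha, hb]
    | tmul a b => simp

theorem newBlk_lTensor (f : R →ₗ[K] R') (r : R) :
    (f.lTensor _).lTensor _ (newBlk K V R r) = newBlk K V R' (f r) := by
  simp

end

section
variable {R : Type*} [CommRing R] [Algebra K R] (g : V ⊗[K] QSh K V →ₗ[K] Module.End K R)

/-- `w ↦ ∑ a'' ⊗ |a'| ⊗ F(b)`, the sum over all `a`, `b` with `w = ab`, where `|a|` is the product
of the letters of `a` in `uV`, and `F` is `blkFold g` as below. -/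
noncomputable def firstBlkG : QSh K V →ₗ[K] QSh K V ⊗[K] (UExt K V ⊗[K] R) :=
  recLin (newBlk K V R 1) 0
    ((blk K V R).compr₂ (newBlk K V R ∘ₗ closeWith g + LinearMap.id))

/-- `F(w) = ∑ g(|a'| ⊗ a'')(F(b))`, the sum over all `a ≠ 1`, `b` with `w = ab`, and `F(1) = 1`. -/
noncomputable def blkFold : QSh K V →ₗ[K] R :=
  (counitL K V).smulRight 1 + closeWith g ∘ₗ firstBlkG g

@[simp] theorem firstBlkG_one : firstBlkG g 1 = newBlk K V R 1 := by simp [firstBlkG]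

@[simp] theorem blkFold_one : blkFold g 1 = 1 := by simp [blkFold]

theorem firstBlkG_cons_aux (x : V) (w : QSh K V) : firstBlkG g (cons x w) =
    newBlk K V R (closeWith g (blk K V R x (firstBlkG g w))) + blk K V R x (firstBlkG g w) := by
  rw [firstBlkG, recLin_cons, ← firstBlkG]
  simp

theorem blkFold_cons (x : V) (w : QSh K V) : blkFold g (cons x w) =
    closeWith g (blk K V R x (firstBlkG g w)) := by
  rw [blkFold, LinearMap.add_apply, LinearMap.comp_apply, firstBlkG_cons_aux, map_add]
  simp

theorem firstBlkG_cons (x : V) (w : QSh K V) : firstBlkG g (cons x w) =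
    newBlk K V R (blkFold g (cons x w)) + blk K V R x (firstBlkG g w) := by
  rw [firstBlkG_cons_aux, blkFold_cons]

end

section Mul

variable {R : Type*} [CommRing R] [Algebra K R]

theorem newBlk_mul (r s : R) : newBlk K V R (r * s) = newBlk K V R r * newBlk K V R s := by
  simp

theorem blk_mul_newBlk (x : V) (d : QSh K V ⊗[K] (UExt K V ⊗[K] R)) (r : R) :
    blk K V R x (d * newBlk K V R r) = blk K V R x d * newBlk K V R r := by
  rw [blk_apply]
  induction d using ind3 with
  | h0 => simp
  | ha a b ha hb => simp only [map_add, add_mul, ha, hb]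
  | ht c u s =>
    induction Coalgebra.comul (R := K) x with
    | zero => simp
    | add a b ha hb => simp only [map_add, LinearMap.add_apply, add_mul, ha, hb]
    | tmul a b => simp

/-- `z ↦ z'' ⊗ z' ⊗ 1`. -/
noncomputable def addLetter (R : Type*) [CommRing R] [Algebra K R] :
    V ⊗[K] V →ₗ[K] V ⊗[K] (UExt K V ⊗[K] R) :=
  ((TensorProduct.mk K _ R).flip 1 ∘ₗ UExt.inr K V).lTensor V ∘ₗ
    (TensorProduct.comm K V V).toLinearMap

theorem blkz_eq (z : V ⊗[K] V) (d : QSh K V ⊗[K] (UExt K V ⊗[K] R)) :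
    blkz z d = consA K V _ (addLetter R z) d := by
  induction d using ind3 with
  | h0 => simp
  | ha a b ha hb => simp only [map_add, ha, hb]
  | ht c u s =>
    induction z with
    | zero => simp
    | add a b ha hb => simp only [map_add, LinearMap.add_apply, ha, hb]
    | tmul a b => simp [addLetter]

theorem blk_mul_blk (x y : V) (d e : QSh K V ⊗[K] (UExt K V ⊗[K] R)) :
    blk K V R x d * blk K V R y e = blk K V R x (d * blk K V R y e) +
      blk K V R y (blk K V R x d * e) + blk K V R (x * y) (d * e) := by
  have h : ∀ z z' : V ⊗[K] V, addLetter R (z * z') = addLetter R z * addLetter R z' := by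
    intro z z'
    have h1 : TensorProduct.comm K V V (z * z') =
        TensorProduct.comm K V V z * TensorProduct.comm K V V z' := by
      induction z with
      | zero => simp
      | add a b ha hb => simp only [map_add, add_mul, ha, hb]
      | tmul u c =>
      induction z' with
      | zero => simp
      | add a b ha hb => simp only [map_add, mul_add, ha, hb]
      | tmul v d => simp
    simp only [addLetter, LinearMap.comp_apply, LinearEquiv.coe_coe, h1]
    exact lTensor_mul_aux _ (by intro a b; simp) _ _
  simp only [blk_apply, blkz_eq, NonUnitalBialgebra.comul_mul', h]
  exact consA_mul _ _ _ _

end Mul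

variable (K V) in
/-- The inclusion of `QSh(V) ⊗ (V ⊗ R)`. -/
noncomputable def jV (R : Type*) [CommRing R] [Algebra K R] : QSh K V ⊗[K] (V ⊗[K] R) →ₗ[K]
    QSh K V ⊗[K] (UExt K V ⊗[K] R) :=
  ((UExt.inr K V).rTensor R).lTensor (QSh K V)

theorem blk_mem (R : Type*) [CommRing R] [Algebra K R] (x : V)
    (d : QSh K V ⊗[K] (UExt K V ⊗[K] R)) :
    ∃ d', blk K V R x d = jV K V R d' := by
  suffices h : blk K V R x d ∈ LinearMap.range (jV K V R) by
    obtain ⟨d', h⟩ := h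
    exact ⟨d', h.symm⟩
  rw [blk_apply]
  induction d using ind3 with
  | h0 => simp
  | ha a b ha hb => rw [map_add]; exact add_mem ha hb
  | ht c u s =>
    induction Coalgebra.comul (R := K) x with
    | zero => simp
    | add a b ha hb => rw [map_add, LinearMap.add_apply]; exact add_mem ha hb
    | tmul a b =>
      exact ⟨cons b c ⊗ₜ (_ ⊗ₜ s), by
        rw [jV, LinearMap.lTensor_tmul, LinearMap.rTensor_tmul, blkz_tmul, UExt.inr_mul_eq]⟩

section
variable {R : Type*} [CommRing R] [Algebra K R] (g : V ⊗[K] QSh K V →ₗ[K] Module.End K R)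

theorem closeWith_mul_aux
    (hg : ∀ z z' s t, g z s * g z' t = g z (s * g z' t) + g z' (g z s * t) + g (z * z') (s * t))
    (d e : QSh K V ⊗[K] (V ⊗[K] R)) :
    closeWith g (jV K V R d) * closeWith g (jV K V R e) =
      closeWith g (jV K V R d * newBlk K V R (closeWith g (jV K V R e))) +
      closeWith g (jV K V R e * newBlk K V R (closeWith g (jV K V R d))) +
      closeWith g (jV K V R d * jV K V R e) := by
  induction d with
  | zero => simp
  | add a b ha hb => simp only [map_add, add_mul, mul_add, ha, hb]; abel
  | tmul c d =>
  induction d with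
  | zero => simp
  | add a b ha hb => simp only [map_add, add_mul, mul_add, ha, hb, TensorProduct.tmul_add]; abel
  | tmul p r =>
  induction e with
  | zero => simp
  | add a b ha hb => simp only [map_add, add_mul, mul_add, ha, hb]; abel
  | tmul c' e =>
  induction e with
  | zero => simp
  | add a b ha hb => simp only [map_add, add_mul, mul_add, ha, hb, TensorProduct.tmul_add]; abel
  | tmul p' r' =>
    simp only [jV, LinearMap.lTensor_tmul, LinearMap.rTensor_tmul,
      closeWith_tmul, UExt.snd_inr, newBlk_apply,
      Algebra.TensorProduct.tmul_mul_tmul, mul_one, ← UExt.inr_mul, hg, mul_comm r']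

theorem closeWith_mul
    (hg : ∀ z z' s t, g z s * g z' t = g z (s * g z' t) + g z' (g z s * t) + g (z * z') (s * t))
    (x y : V) (d e : QSh K V ⊗[K] (UExt K V ⊗[K] R)) :
    closeWith g (blk K V R x d) * closeWith g (blk K V R y e) =
      closeWith g (blk K V R x d * newBlk K V R (closeWith g (blk K V R y e))) +
      closeWith g (blk K V R y e * newBlk K V R (closeWith g (blk K V R x d))) +
      closeWith g (blk K V R x d * blk K V R y e) := by
  obtain ⟨d', hd⟩ := blk_mem _ x d
  obtain ⟨e', he⟩ := blk_mem _ y e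
  rw [hd, he]
  exact closeWith_mul_aux g hg d' e'

theorem blkFold_mul_aux
    (hg : ∀ z z' s t, g z s * g z' t = g z (s * g z' t) + g z' (g z s * t) + g (z * z') (s * t))
    (u v : QSh K V) :
    firstBlkG g (u * v) = firstBlkG g u * firstBlkG g v ∧
      blkFold g (u * v) = blkFold g u * blkFold g v := by
  have one : newBlk K V R 1 = 1 := rfl
  induction u using ind generalizing v with
  | hn => simp [one]
  | hc x u ihu =>
    induction v using ind with
    | hn => simp [one]
    | hc y v ihv =>
      have key : blkFold g (cons x u * cons y v) =
          blkFold g (cons x u) * blkFold g (cons y v) := by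
        rw [cons_mul_cons, map_add, map_add, blkFold_cons, blkFold_cons, blkFold_cons, (ihu _).1,
          (ihu _).1, ihv.1, blkFold_cons g x u, blkFold_cons g y v, closeWith_mul g hg, blk_mul_blk,
          firstBlkG_cons, firstBlkG_cons, ← blkFold_cons, ← blkFold_cons]
        rw [mul_comm (newBlk K V R (blkFold g (cons x u)) + _) (firstBlkG g v)]
        simp only [mul_add, map_add, blk_mul_newBlk]
        rw [mul_comm (blk K V R x (firstBlkG g u)) (firstBlkG g v)]
        abel
      refine ⟨?_, key⟩
      rw [firstBlkG_cons g x u, firstBlkG_cons g y v]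
      rw [cons_mul_cons] at key ⊢
      rw [map_add, map_add, firstBlkG_cons, firstBlkG_cons, firstBlkG_cons, (ihu _).1,
          (ihu _).1, ihv.1]
      rw [map_add, map_add] at key
      have e : (newBlk K V R (blkFold g (cons x u)) + blk K V R x (firstBlkG g u)) *
          (newBlk K V R (blkFold g (cons y v)) + blk K V R y (firstBlkG g v)) =
          newBlk K V R (blkFold g (cons x u) * blkFold g (cons y v)) +
          blk K V R x (firstBlkG g u) * newBlk K V R (blkFold g (cons y v)) +
          blk K V R y (firstBlkG g v) * newBlk K V R (blkFold g (cons x u)) +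
          blk K V R x (firstBlkG g u) * blk K V R y (firstBlkG g v) := by
        rw [newBlk_mul]; ring
      rw [e, ← key, blk_mul_blk, firstBlkG_cons, firstBlkG_cons]
      rw [mul_comm (newBlk K V R (blkFold g (cons x u)) + _) (firstBlkG g v)]
      simp only [mul_add, map_add, blk_mul_newBlk]
      rw [mul_comm (blk K V R x (firstBlkG g u)) (firstBlkG g v)]
      abel
    | ha u v hu hv => simp only [hu, hv, mul_add, map_add, and_self]
    | hs r u hu => simp only [hu, mul_smul_comm, map_smul, and_self]
  | ha a b hu hv => simp only [hu, hv, add_mul, map_add, and_self]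
  | hs r u hu => simp only [hu, smul_mul_assoc, map_smul, and_self]

end

variable (K V) in
/-- The second coproduct `δ(w) = ∑ |w₁'| … |w_k'| ⊗ (w₁'' ⧢ … ⧢ w_k'')`, the sum over all
decompositions `w = w₁ … w_k` into nonempty words, as
`δ(w) = ∑ (|a'| ⊗ a'')δ(b)`, the sum over all `a ≠ 1`, `b` with `w = ab`, and `δ(1) = 1 ⊗ 1`. -/
noncomputable def deltaL : QSh K V →ₗ[K] QSh K V ⊗[K] QSh K V := blkFold (consA K V (QSh K V))

theorem deltaL_mul (u v : QSh K V) : deltaL K V (u * v) = deltaL K V u * deltaL K V v :=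
  (blkFold_mul_aux _ consA_mul u v).2

end SecondCoproduct
end QSh

namespace QSh

section CounitDelta

variable {K V : Type*} [CommRing K] [NonUnitalCommRing V] [Module K V]
  [IsScalarTower K V V] [SMulCommClass K V V] [NonUnitalBialgebra K V]

variable (K V) in
/-- The counit `ε_δ`: `ε_δ(1) = 1`, `ε_δ(v) = ε_V(v)` for a letter `v`, and `ε_δ` vanishes on the
words of length at least 2. -/
noncomputable def epsDeltaL : QSh K V →ₗ[K] K :=
  recLin 1 ((LinearMap.mul K K).compl₁₂ (Coalgebra.counit (R := K) (A := V)) (counitL K V)) 0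

@[simp] theorem epsDeltaL_one : epsDeltaL K V 1 = 1 := by simp [epsDeltaL]
@[simp] theorem epsDeltaL_cons (x : V) (w : QSh K V) : epsDeltaL K V (cons x w) =
    Coalgebra.counit (R := K) x * counitL K V w := by simp [epsDeltaL]

theorem epsDeltaL_mul (u v : QSh K V) :
    epsDeltaL K V (u * v) = epsDeltaL K V u * epsDeltaL K V v := by
  induction u using ind generalizing v with
  | hn => simp
  | hc x u ihu =>
    induction v using ind with
    | hn => simp
    | hc y v ihv =>
      simp only [cons_mul_cons, map_add, epsDeltaL_cons, counitL_mul, counitL_cons,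
        NonUnitalBialgebra.counit_mul']
      ring
    | ha u v hu hv => simp only [hu, hv, mul_add, map_add]
    | hs r u hu => simp only [hu, mul_smul_comm, map_smul]
  | ha a b hu hv => simp only [hu, hv, add_mul, map_add]
  | hs r u hu => simp only [hu, smul_mul_assoc, map_smul]

theorem deltaL_one : deltaL K V 1 = 1 ⊗ₜ 1 := blkFold_one _

theorem counitL_closeWith (d) : (counitL K V).rTensor (QSh K V)
    (closeWith (consA K V (QSh K V)) d) = 0 := by
  induction d using ind3 with
  | h0 => simp
  | ha a b ha hb => rw [map_add, map_add, ha, hb, add_zero]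
  | ht c u r => rw [closeWith_tmul, counitL_consA]

theorem counitL_deltaL (w : QSh K V) :
    (counitL K V).rTensor (QSh K V) (deltaL K V w) = counitL K V w ⊗ₜ 1 := by
  induction w using ind with
  | hn => simp [deltaL_one]
  | hc x w ih => rw [deltaL, blkFold_cons, counitL_closeWith, counitL_cons, TensorProduct.zero_tmul]
  | ha a b ha hb => simp only [map_add, ha, hb, TensorProduct.add_tmul]
  | hs r u hu => simp only [map_smul, hu, TensorProduct.smul_tmul']

/-! Right counit -/

variable (K V) in
/-- `firstBlkG` for the second coproduct `δ`. -/
noncomputable abbrev firstBlk : QSh K V →ₗ[K]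
    QSh K V ⊗[K] (UExt K V ⊗[K] (QSh K V ⊗[K] QSh K V)) := firstBlkG (consA K V (QSh K V))

variable (K V) in
/-- `u ⊗ (s ⊗ t) ↦ ε_δ(t) (snd u) s`. -/
noncomputable def rk : UExt K V ⊗[K] (QSh K V ⊗[K] QSh K V) →ₗ[K] QSh K V :=
  TensorProduct.lift ((cons ∘ₗ UExt.snd K V).compl₂
    ((TensorProduct.rid K (QSh K V)).toLinearMap ∘ₗ (epsDeltaL K V).lTensor (QSh K V)))

@[simp] theorem rk_tmul (u : UExt K V) (t : QSh K V ⊗[K] QSh K V) : rk K V (u ⊗ₜ t) =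
    cons (UExt.snd K V u) (TensorProduct.rid K _ ((epsDeltaL K V).lTensor _ t)) := by
  simp [rk]

theorem epsDeltaL_closeWith (d) : TensorProduct.rid K _ ((epsDeltaL K V).lTensor _
    (closeWith (consA K V (QSh K V)) d)) =
      rk K V (TensorProduct.lid K _ ((epsDeltaL K V).rTensor _ d)) := by
  induction d using ind3 with
  | h0 => simp
  | ha a b ha hb => simp only [map_add, ha, hb]
  | ht c u r =>
    induction r with
    | zero => simp
    | add a b ha hb => simp only [map_add, TensorProduct.tmul_add, ha, hb]
    | tmul s t => simp [epsDeltaL_mul, mul_smul]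

theorem epsDeltaL_blk {R : Type*} [CommRing R] [Algebra K R] (x : V)
    (d : QSh K V ⊗[K] (UExt K V ⊗[K] R)) :
    TensorProduct.lid K _ ((epsDeltaL K V).rTensor _ (blk K V R x d)) =
      (LinearMap.mulLeft K (UExt.inr K V x)).rTensor R
        (TensorProduct.lid K _ ((counitL K V).rTensor _ d)) := by
  have hx := Coalgebra.lTensor_counit_comul (R := K) x
  have hx' : x = TensorProduct.rid K V ((Coalgebra.counit (R := K) (A := V)).lTensor V
    (Coalgebra.comul (R := K) x)) := by rw [hx]; simp
  nth_rw 2 [hx']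
  rw [blk_apply]
  induction d using ind3 with
  | h0 => simp
  | ha a b ha hb => simp only [map_add, ha, hb]
  | ht c u r =>
    induction Coalgebra.comul (R := K) x with
    | zero => simp
    | add a b ha hb => simp only [map_add, LinearMap.add_apply, ha, hb, LinearMap.rTensor_tmul,
        TensorProduct.lid_tmul, map_smul, LinearMap.mulLeft_apply, add_mul, TensorProduct.add_tmul, smul_add]
    | tmul a b =>
      simp only [blkz_tmul, LinearMap.rTensor_tmul, TensorProduct.lid_tmul, epsDeltaL_cons,
        LinearMap.lTensor_tmul, TensorProduct.rid_tmul, map_smul, LinearMap.mulLeft_apply,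
        smul_mul_assoc, TensorProduct.smul_tmul', mul_smul]
      rw [smul_comm]

theorem counitL_firstBlkG {R : Type*} [CommRing R] [Algebra K R]
    (g : V ⊗[K] QSh K V →ₗ[K] Module.End K R) (w : QSh K V) :
    TensorProduct.lid K _ ((counitL K V).rTensor _ (firstBlkG g w)) = 1 ⊗ₜ blkFold g w := by
  have aux : ∀ x d, (counitL K V).rTensor _ (blk K V R x d) = 0 := by
    intro x d
    rw [blk_apply, blkz_eq, counitL_consA]
  induction w using ind with
  | hn => simp
  | hc x w ih => rw [firstBlkG_cons, map_add, aux]; simp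
  | ha a b ha hb => simp only [map_add, ha, hb, TensorProduct.tmul_add]
  | hs r u hu => simp only [map_smul, hu, TensorProduct.tmul_smul]

theorem lTensor_epsDeltaL_deltaL (w : QSh K V) :
    TensorProduct.rid K _ ((epsDeltaL K V).lTensor _ (deltaL K V w)) = w := by
  induction w using ind with
  | hn => simp [deltaL_one]
  | hc x w ih =>
    rw [deltaL, blkFold_cons, epsDeltaL_closeWith, epsDeltaL_blk, counitL_firstBlkG]
    rw [LinearMap.rTensor_tmul, rk_tmul, LinearMap.mulLeft_apply, mul_one, UExt.snd_inr, ← deltaL, ih]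
  | ha a b ha hb => simp only [map_add, ha, hb]
  | hs r u hu => simp only [map_smul, hu]

/-! First cointeraction axiom -/

variable (K V) in
/-- `(c ⊗ p ⊗ r) ⊗ r' ↦ c ⊗ p ⊗ m1324(r ⊗ r')`. -/
noncomputable def mBlk (A : Type*) [CommRing A] [Algebra K A] :
    (QSh K V ⊗[K] (UExt K V ⊗[K] (QSh K V ⊗[K] A))) ⊗[K] (QSh K V ⊗[K] A) →ₗ[K]
      QSh K V ⊗[K] (UExt K V ⊗[K] ((QSh K V ⊗[K] QSh K V) ⊗[K] A)) :=
  (((m1324 K (QSh K V) A).lTensor (UExt K V) ∘ₗ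
      (TensorProduct.assoc K (UExt K V) _ _).toLinearMap).lTensor (QSh K V)) ∘ₗ
    (TensorProduct.assoc K (QSh K V) _ _).toLinearMap

section
variable {A : Type*} [CommRing A] [Algebra K A]

@[simp] theorem mBlk_tmul (c : QSh K V) (p : UExt K V) (r r' : QSh K V ⊗[K] A) :
    mBlk K V A ((c ⊗ₜ (p ⊗ₜ r)) ⊗ₜ r') = c ⊗ₜ (p ⊗ₜ m1324 K _ A (r ⊗ₜ r')) := by simp [mBlk]

theorem mBlk_blk (x : V) (d : QSh K V ⊗[K] (UExt K V ⊗[K] (QSh K V ⊗[K] A)))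
    (r : QSh K V ⊗[K] A) : mBlk K V A (blk K V _ x d ⊗ₜ r) = blk K V _ x (mBlk K V A (d ⊗ₜ r)) := by
  rw [blk_apply, blk_apply]
  induction d using ind3 with
  | h0 => simp
  | ha a b ha hb => simp only [map_add, TensorProduct.add_tmul, ha, hb]
  | ht c u s =>
    induction Coalgebra.comul (R := K) x with
    | zero => simp
    | add a b ha hb => simp only [map_add, LinearMap.add_apply, TensorProduct.add_tmul, ha, hb]
    | tmul a b => simp

theorem closeWith_mBlk (d : QSh K V ⊗[K] (UExt K V ⊗[K] (QSh K V ⊗[K] QSh K V)))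
    (r : QSh K V ⊗[K] QSh K V) :
    m1324 K _ _ (closeWith (consA K V (QSh K V)) d ⊗ₜ r) =
      closeWith (cons2 K V (QSh K V)) (mBlk K V _ (d ⊗ₜ r)) := by
  induction d using ind3 with
  | h0 => simp
  | ha a b ha hb => simp only [map_add, TensorProduct.add_tmul, ha, hb]
  | ht c u s => rw [closeWith_tmul, m1324_consA, mBlk_tmul, closeWith_tmul]

end

theorem deconc_closeWith (d : QSh K V ⊗[K] (UExt K V ⊗[K] (QSh K V ⊗[K] QSh K V))) :
    (deconc K V).rTensor _ (closeWith (consA K V (QSh K V)) d) =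
      inj2 K V _ (closeWith (consA K V (QSh K V)) d) +
      closeWith (cons2 K V (QSh K V)) ((((deconc K V).rTensor _).lTensor _).lTensor _ d) := by
  induction d using ind3 with
  | h0 => simp
  | ha a b ha hb => simp only [map_add, ha, hb]; abel
  | ht c u s =>
    rw [closeWith_tmul, deconc_consA, LinearMap.lTensor_tmul, LinearMap.lTensor_tmul,
      closeWith_tmul]

variable (K V) in
/-- `u ⊗ v ↦ mBlk(firstBlk u ⊗ δ(v))`. -/
noncomputable def psiE : QSh K V ⊗[K] QSh K V →ₗ[K]
    QSh K V ⊗[K] (UExt K V ⊗[K] ((QSh K V ⊗[K] QSh K V) ⊗[K] QSh K V)) :=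
  mBlk K V (QSh K V) ∘ₗ TensorProduct.map (firstBlk K V) (deltaL K V)

theorem psiE_tmul (u v : QSh K V) :
    psiE K V (u ⊗ₜ v) = mBlk K V (QSh K V) (firstBlk K V u ⊗ₜ deltaL K V v) := rfl

variable (K V) in
/-- `u ⊗ v ↦ m1324(δ(u) ⊗ δ(v))`. -/
noncomputable def deltaE : QSh K V ⊗[K] QSh K V →ₗ[K] (QSh K V ⊗[K] QSh K V) ⊗[K] QSh K V :=
  m1324 K (QSh K V) (QSh K V) ∘ₗ TensorProduct.map (deltaL K V) (deltaL K V)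

theorem deltaE_tmul (u v : QSh K V) :
    deltaE K V (u ⊗ₜ v) = m1324 K _ _ (deltaL K V u ⊗ₜ deltaL K V v) := rfl

theorem deltaE_rTensor (x : V) (t : QSh K V ⊗[K] QSh K V) :
    deltaE K V ((cons x).rTensor _ t) = closeWith (cons2 K V (QSh K V)) (blk K V _ x (psiE K V t)) := by
  induction t with
  | zero => simp
  | add a b ha hb => simp only [map_add, ha, hb]
  | tmul u v =>
    rw [LinearMap.rTensor_tmul, deltaE_tmul, deltaL, blkFold_cons, ← deltaL, closeWith_mBlk, mBlk_blk,
      psiE_tmul]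

theorem psiE_rTensor (x : V) (t : QSh K V ⊗[K] QSh K V) :
    psiE K V ((cons x).rTensor _ t) = newBlk K V _ (deltaE K V ((cons x).rTensor _ t)) +
      blk K V _ x (psiE K V t) := by
  induction t with
  | zero => simp
  | add a b ha hb =>
    rw [map_add, map_add, ha, hb, map_add, map_add, map_add, map_add]; abel
  | tmul u v =>
    rw [LinearMap.rTensor_tmul, psiE_tmul, firstBlkG_cons, TensorProduct.add_tmul, map_add, mBlk_blk,
      psiE_tmul, deltaE_tmul, newBlk_apply, mBlk_tmul, newBlk_apply, deltaL]

theorem deltaE_deconc_cons (x : V) (w : QSh K V) :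
    deltaE K V (deconc K V (cons x w)) = inj2 K V _ (deltaL K V (cons x w)) +
      closeWith (cons2 K V (QSh K V)) (blk K V _ x (psiE K V (deconc K V w))) := by
  rw [deconc_cons, map_add, deltaE_rTensor, deltaE_tmul, deltaL_one, m1324_one]

theorem deconc_deltaL_aux (w : QSh K V) :
    (((deconc K V).rTensor _).lTensor _).lTensor _ (firstBlk K V w) = psiE K V (deconc K V w) ∧
    (deconc K V).rTensor _ (deltaL K V w) = deltaE K V (deconc K V w) := by
  induction w using ind with
  | hn =>
    rw [firstBlkG_one, deltaL_one, deconc_one, psiE_tmul, deltaE_tmul, deltaL_one, firstBlkG_one]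
    simp [Algebra.TensorProduct.one_def]
  | hc x w ih =>
    have key : (deconc K V).rTensor _ (deltaL K V (cons x w)) =
        deltaE K V (deconc K V (cons x w)) := by
      rw [deltaE_deconc_cons, deltaL, blkFold_cons, deconc_closeWith, blk_lTensor, ih.1]
    refine ⟨?_, key⟩
    have h1 : psiE K V (1 ⊗ₜ cons x w) = newBlk K V _ (deltaE K V (1 ⊗ₜ cons x w)) := by
      rw [psiE_tmul, firstBlkG_one, newBlk_apply, mBlk_tmul, Algebra.TensorProduct.one_def,
        m1324_one, deltaE_tmul, deltaL_one, m1324_one, newBlk_apply]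
    rw [firstBlkG_cons, map_add, newBlk_lTensor, blk_lTensor, ih.1, ← deltaL, key,
      deconc_cons, map_add (psiE K V), psiE_rTensor, map_add (deltaE K V), map_add (newBlk K V _),
      h1, add_assoc]
  | ha a b ha hb => simp only [map_add, ha, hb, and_self]
  | hs r u hu => simp only [map_smul, hu, and_self]

theorem deconc_deltaL (w : QSh K V) : (deconc K V).rTensor _ (deltaL K V w) =
    m1324 K _ _ (TensorProduct.map (deltaL K V) (deltaL K V) (deconc K V w)) :=
  (deconc_deltaL_aux w).2

end CounitDelta
end QSh

namespace QSh

section Uniq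

variable {K V : Type*} [CommRing K] [NonUnitalCommRing V] [Module K V]
  [IsScalarTower K V V] [SMulCommClass K V V]

variable (K V) in
/-- The projection onto the letters. -/
noncomputable def pr : QSh K V →ₗ[K] V :=
  recLin 0 (LinearMap.lsmul K V ∘ₗ counitL K V).flip 0

@[simp] theorem pr_one : pr K V 1 = 0 := by simp [pr]
@[simp] theorem pr_cons (x : V) (w : QSh K V) : pr K V (cons x w) = counitL K V w • x := by
  simp [pr]

section
variable {A : Type*} [CommRing A] [Algebra K A]

variable (K V A) in
/-- `(s, t) ↦ consA (pr s) t`. -/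
noncomputable def prA : (QSh K V ⊗[K] QSh K V) ⊗[K] A →ₗ[K] QSh K V ⊗[K] A :=
  (TensorProduct.lift (cons ∘ₗ pr K V)).rTensor A

theorem cons_pr_deconc (w : QSh K V) : TensorProduct.lift (cons ∘ₗ pr K V) (deconc K V w) =
    w - counitL K V w • 1 := by
  have aux : ∀ x, ∀ t : QSh K V ⊗[K] QSh K V, TensorProduct.lift (cons ∘ₗ pr K V)
      ((cons x).rTensor _ t) = cons x (TensorProduct.lid K _ ((counitL K V).rTensor _ t)) := by
    intro x t
    induction t with
    | zero => simp
    | add a b ha hb => simp only [map_add, ha, hb]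
    | tmul u v => simp
  induction w using ind with
  | hn => simp
  | hc x w ih =>
    have h := Coalgebra.rTensor_counit_comul (R := K) w
    rw [comul_eq, counit_eq] at h
    rw [deconc_cons, map_add, aux, h]
    simp
  | ha a b ha hb => simp only [map_add, ha, hb, add_smul]; abel
  | hs r u hu => simp only [map_smul, hu, smul_sub, smul_smul, smul_eq_mul]

theorem prA_m1324 (s t : QSh K V ⊗[K] A) : prA K V A (m1324 K _ A (s ⊗ₜ t)) =
    consA K V A ((pr K V).rTensor A s) t := by
  induction s with
  | zero => simp
  | add a b ha hb => simp only [map_add, ha, hb, TensorProduct.add_tmul, LinearMap.add_apply]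
  | tmul u c =>
  induction t with
  | zero => simp
  | add a b ha hb => simp only [map_add, ha, hb, TensorProduct.tmul_add]
  | tmul v d => simp [prA]

theorem prA_deconc (s : QSh K V ⊗[K] A) : prA K V A ((deconc K V).rTensor A s) =
    s - 1 ⊗ₜ (TensorProduct.lid K A ((counitL K V).rTensor A s)) := by
  induction s with
  | zero => simp
  | add a b ha hb => simp only [map_add, ha, hb, TensorProduct.tmul_add]; abel
  | tmul u c => simp [prA, cons_pr_deconc, TensorProduct.sub_tmul, TensorProduct.smul_tmul]

/-- A comultiplicative linear map `F : QSh(V) → QSh(V) ⊗ A` is determined by its projection to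
`V ⊗ A`. -/
theorem comul_uniq (F G : QSh K V →ₗ[K] QSh K V ⊗[K] A)
    (hF : ∀ w, (deconc K V).rTensor A (F w) =
      m1324 K _ A (TensorProduct.map F F (deconc K V w)))
    (hG : ∀ w, (deconc K V).rTensor A (G w) =
      m1324 K _ A (TensorProduct.map G G (deconc K V w)))
    (hF0 : ∀ w, (counitL K V).rTensor A (F w) = counitL K V w ⊗ₜ 1)
    (hG0 : ∀ w, (counitL K V).rTensor A (G w) = counitL K V w ⊗ₜ 1)
    (hF1 : F 1 = 1 ⊗ₜ 1) (hG1 : G 1 = 1 ⊗ₜ 1)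
    (h : ∀ w, (pr K V).rTensor A (F w) = (pr K V).rTensor A (G w)) : F = G := by
  have key : ∀ (F : QSh K V →ₗ[K] QSh K V ⊗[K] A), (∀ w, (deconc K V).rTensor A (F w) =
      m1324 K _ A (TensorProduct.map F F (deconc K V w))) →
      (∀ w, (counitL K V).rTensor A (F w) = counitL K V w ⊗ₜ 1) → F 1 = 1 ⊗ₜ 1 →
      ∀ x w, F (cons x w) = TensorProduct.lift (consA K V A ∘ₗ (pr K V).rTensor A ∘ₗ F)
        ((cons x).rTensor _ (F.lTensor _ (deconc K V w))) := by
    intro F hF hF0 hF1 x w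
    have h1 := prA_deconc (F (cons x w))
    rw [hF0, counitL_cons, TensorProduct.zero_tmul, map_zero, TensorProduct.tmul_zero, sub_zero,
      hF, deconc_cons, map_add, map_add, map_add, TensorProduct.map_tmul, prA_m1324, hF1] at h1
    rw [← h1]
    simp only [LinearMap.rTensor_tmul, pr_one, TensorProduct.zero_tmul, map_zero,
      LinearMap.zero_apply, zero_add]
    induction deconc K V w with
    | zero => simp
    | add a b ha hb => simp only [map_add, ha, hb]
    | tmul u v => simp [prA_m1324]
  have hS : ∀ w, F.lTensor (QSh K V) (deconc K V w) = G.lTensor (QSh K V) (deconc K V w) := by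
    intro w
    induction w using ind with
    | hn => simp [hF1, hG1]
    | hc x w ih =>
      have e : (pr K V).rTensor A ∘ₗ F = (pr K V).rTensor A ∘ₗ G := LinearMap.ext h
      rw [deconc_cons, map_add, map_add, lTensor_rTensor', lTensor_rTensor', ih,
        LinearMap.lTensor_tmul, LinearMap.lTensor_tmul, key F hF hF0 hF1, key G hG hG0 hG1, ih, e]
    | ha a b ha hb => simp only [map_add, ha, hb]
    | hs r u hu => simp only [map_smul, hu]
  refine ext_lin (by rw [hF1, hG1]) (fun x w _ => ?_)
  have e : (pr K V).rTensor A ∘ₗ F = (pr K V).rTensor A ∘ₗ G := LinearMap.ext h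
  rw [key F hF hF0 hF1, key G hG hG0 hG1, hS, e]

end

end Uniq

section Cocomm

variable {K V : Type*} [CommRing K] [NonUnitalCommRing V] [Module K V]
  [IsScalarTower K V V] [SMulCommClass K V V] [NonUnitalBialgebra K V]

/-! The letter projection of `δ` -/

variable (K V) in
/-- `u ⊗ w ↦ snd u ⊗ w`, after a swap. -/
noncomputable def sndComm (M : Type*) [AddCommGroup M] [Module K M] :
    M ⊗[K] UExt K V →ₗ[K] V ⊗[K] M :=
  (UExt.snd K V).rTensor M ∘ₗ (TensorProduct.comm K M (UExt K V)).toLinearMap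

@[simp] theorem sndComm_tmul {M : Type*} [AddCommGroup M] [Module K M] (m : M) (u : UExt K V) :
    sndComm K V M (m ⊗ₜ u) = UExt.snd K V u ⊗ₜ m := rfl

variable (K V) in
/-- `s ⊗ t ↦ ε(s) t`. -/
noncomputable def epsL : QSh K V ⊗[K] QSh K V →ₗ[K] QSh K V :=
  (TensorProduct.lid K (QSh K V)).toLinearMap ∘ₗ (counitL K V).rTensor _

@[simp] theorem epsL_tmul (s t : QSh K V) : epsL K V (s ⊗ₜ t) = counitL K V s • t := by
  simp [epsL]

theorem epsL_deltaL (w : QSh K V) : epsL K V (deltaL K V w) = counitL K V w • 1 := by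
  rw [epsL, LinearMap.comp_apply, counitL_deltaL]; simp

variable (K V) in
/-- `c ⊗ p ⊗ q ↦ snd p ⊗ (c ⧢ q)`. -/
noncomputable def kBlk : QSh K V ⊗[K] (UExt K V ⊗[K] QSh K V) →ₗ[K] V ⊗[K] QSh K V :=
  TensorProduct.map (UExt.snd K V) (LinearMap.mul' K (QSh K V)) ∘ₗ
    (TensorProduct.leftComm K (QSh K V) (UExt K V) (QSh K V)).toLinearMap

@[simp] theorem kBlk_tmul (c : QSh K V) (p : UExt K V) (q : QSh K V) :
    kBlk K V (c ⊗ₜ (p ⊗ₜ q)) = UExt.snd K V p ⊗ₜ (c * q) := by simp [kBlk]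

theorem pr_closeWith (d) : (pr K V).rTensor _ (closeWith (consA K V (QSh K V)) d) =
    kBlk K V (((epsL K V).lTensor _).lTensor _ d) := by
  induction d using ind3 with
  | h0 => simp
  | ha a b ha hb => simp only [map_add, ha, hb]
  | ht c p r =>
    rw [closeWith_tmul, LinearMap.lTensor_tmul, LinearMap.lTensor_tmul, kBlk_tmul]
    induction r with
    | zero => simp
    | add a b ha hb => simp only [map_add, ha, hb, mul_add, TensorProduct.tmul_add]
    | tmul s t => simp [TensorProduct.smul_tmul]

variable (K V) in
/-- `c ⊗ u ↦ c ⊗ u ⊗ 1`. -/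
noncomputable def jBlk : QSh K V ⊗[K] UExt K V →ₗ[K] QSh K V ⊗[K] (UExt K V ⊗[K] QSh K V) :=
  ((TensorProduct.mk K (UExt K V) (QSh K V)).flip 1).lTensor (QSh K V)

@[simp] theorem jBlk_tmul (c : QSh K V) (p : UExt K V) :
    jBlk K V (c ⊗ₜ p) = c ⊗ₜ (p ⊗ₜ 1) := by simp [jBlk]

theorem kBlk_jBlk (t) : kBlk K V (jBlk K V t) = sndComm K V _ t := by
  induction t with
  | zero => simp
  | add a b ha hb => simp only [map_add, ha, hb]
  | tmul u v => simp

variable [Coalgebra.IsCocomm K V]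

theorem jBlk_consA (x : V) (t : QSh K V ⊗[K] UExt K V) :
    jBlk K V (consA K V _ (comulU K V x) t) = blk K V _ x (jBlk K V t) := by
  rw [blk_apply, comulU, LinearMap.comp_apply]
  nth_rw 2 [← Coalgebra.comm_comul K x]
  induction t with
  | zero => simp
  | add a b ha hb => simp only [map_add, ha, hb]
  | tmul u v =>
    induction Coalgebra.comul (R := K) x with
    | zero => simp
    | add a b ha hb => simp only [map_add, LinearMap.add_apply, ha, hb]
    | tmul a b => simp

theorem epsL_firstBlk (w : QSh K V) :
    ((epsL K V).lTensor _).lTensor _ (firstBlk K V w) = jBlk K V (coactL K V w) := by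
  induction w using ind with
  | hn => simp [coactL, Algebra.TensorProduct.one_def]
  | hc x w ih =>
    rw [firstBlkG_cons, map_add, newBlk_lTensor, blk_lTensor, ih, ← deltaL, epsL_deltaL,
      counitL_cons, zero_smul, map_zero, zero_add, coactL, foldA_cons, jBlk_consA]
  | ha a b ha hb => simp only [map_add, ha, hb]
  | hs r u hu => simp only [map_smul, hu]

theorem pr_deltaL (w : QSh K V) :
    (pr K V).rTensor _ (deltaL K V w) = sndComm K V _ (coactL K V w) := by
  induction w using ind with
  | hn => simp [coactL, deltaL_one]
  | hc x w ih =>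
    rw [deltaL, blkFold_cons, pr_closeWith, blk_lTensor, epsL_firstBlk, ← jBlk_consA, kBlk_jBlk,
      coactL, foldA_cons]
  | ha a b ha hb => simp only [map_add, ha, hb]
  | hs r u hu => simp only [map_smul, hu]

/-! Left counit -/

theorem epsDeltaL_eq (w : QSh K V) : epsDeltaL K V w =
    Coalgebra.counit (R := K) (pr K V w) + counitL K V w := by
  induction w using ind with
  | hn => simp
  | hc x w ih => simp [mul_comm]
  | ha a b ha hb => simp only [map_add, ha, hb]; abel
  | hs r u hu => simp only [map_smul, hu, smul_add]

theorem rTensor_epsDeltaL_deltaL (w : QSh K V) :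
    TensorProduct.lid K _ ((epsDeltaL K V).rTensor _ (deltaL K V w)) = w := by
  have e : epsDeltaL K V = Coalgebra.counit (R := K) (A := V) ∘ₗ pr K V + counitL K V := by
    ext w; exact epsDeltaL_eq w
  have h1 : ∀ t : QSh K V ⊗[K] V, TensorProduct.lid K _
      ((Coalgebra.counit (R := K) (A := V)).rTensor _
        (sndComm K V _ ((UExt.inr K V).lTensor _ t))) =
      TensorProduct.rid K _ ((Bialgebra.counitAlgHom K (UExt K V)).toLinearMap.lTensor _
        ((UExt.inr K V).lTensor _ t)) := by
    intro t
    induction t with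
    | zero => simp
    | add a b ha hb => simp only [map_add, ha, hb]
    | tmul u v => simp
  have h2 := foldA_counit (comulU K V) (Bialgebra.counitAlgHom K (UExt K V)) comulU_counit
  induction w using ind with
  | hn => simp [deltaL_one]
  | hc x w ih =>
    rw [e, LinearMap.rTensor_add, LinearMap.add_apply, LinearMap.rTensor_comp,
      LinearMap.comp_apply, pr_deltaL, counitL_deltaL]
    obtain ⟨t, ht⟩ := coactL_mem (cons x w) (counitL_cons x w)
    have h3 := h2 (cons x w)
    rw [← coactL, ← ht, ← h1 t] at h3
    rw [counitL_cons, TensorProduct.zero_tmul, add_zero, ← ht, h3]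
  | ha a b ha hb => simp only [map_add, ha, hb]
  | hs r u hu => simp only [map_smul, hu]

end Cocomm
end QSh

namespace QSh

section Compat

variable {K V : Type*} [CommRing K] [NonUnitalCommRing V] [Module K V]
  [IsScalarTower K V V] [SMulCommClass K V V] [NonUnitalBialgebra K V]

section
variable (R : Type*) {R' : Type*} [CommRing R] [Algebra K R] [CommRing R'] [Algebra K R']

variable (K V) in
/-- `p ↦ p' ⊗ 1 ⊗ p''`. -/
noncomputable def theta : UExt K V →ₐ[K] UExt K V ⊗[K] (R ⊗[K] UExt K V) :=
  (Algebra.TensorProduct.map (AlgHom.id K (UExt K V)) Algebra.TensorProduct.includeRight).comp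
    (Bialgebra.comulAlgHom K (UExt K V))

theorem theta_inr (v : V) : theta K V R (UExt.inr K V v) =
    TensorProduct.map (UExt.inr K V)
      (TensorProduct.mk K R (UExt K V) 1 ∘ₗ UExt.inr K V) (Coalgebra.comul (R := K) v) := by
  rw [theta, AlgHom.comp_apply, Bialgebra.comulAlgHom_apply, UExt.comul_inr]
  induction Coalgebra.comul (R := K) v with
  | zero => simp
  | add a b ha hb => simp only [map_add, ha, hb]
  | tmul a b => simp

variable {R}

/-- `c ⊗ p ⊗ r ↦ c ⊗ p' ⊗ p''τ(r)`. -/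
noncomputable def tBlk (τ : R →ₗ[K] R ⊗[K] UExt K V) : UExt K V ⊗[K] R →ₗ[K]
    UExt K V ⊗[K] (R ⊗[K] UExt K V) :=
  TensorProduct.lift ((LinearMap.mul K _).compl₁₂ (theta K V R).toLinearMap
    (TensorProduct.mk K (UExt K V) (R ⊗[K] UExt K V) 1 ∘ₗ τ))

@[simp] theorem tBlk_tmul (τ : R →ₗ[K] R ⊗[K] UExt K V) (p : UExt K V) (r : R) :
    tBlk τ (p ⊗ₜ r) = theta K V R p * (1 ⊗ₜ τ r) := by simp [tBlk]

variable (R) in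
/-- `(a₁ ⊗ a₂) ⊗ b ↦ a₂ ⊗ a₁ ⊗ 1 ⊗ b`. -/
noncomputable def add3 : (V ⊗[K] V) ⊗[K] V →ₗ[K] V ⊗[K] (UExt K V ⊗[K] (R ⊗[K] UExt K V)) :=
  (TensorProduct.map (UExt.inr K V)
      (TensorProduct.mk K R (UExt K V) 1 ∘ₗ UExt.inr K V)).lTensor V ∘ₗ
    (TensorProduct.leftComm K V V V).toLinearMap ∘ₗ (TensorProduct.assoc K V V V).toLinearMap

@[simp] theorem add3_tmul (a b c : V) : add3 (K := K) R ((a ⊗ₜ b) ⊗ₜ c) =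
    b ⊗ₜ (UExt.inr K V a ⊗ₜ (1 ⊗ₜ UExt.inr K V c)) := by simp [add3]

variable (K V R) in
/-- `c ⊗ (p ⊗ r) ⊗ u ↦ c ⊗ (p ⊗ (r ⊗ u))`. -/
noncomputable def sBlk : (QSh K V ⊗[K] (UExt K V ⊗[K] R)) ⊗[K] UExt K V →ₗ[K]
    QSh K V ⊗[K] (UExt K V ⊗[K] (R ⊗[K] UExt K V)) :=
  (TensorProduct.assoc K (UExt K V) R (UExt K V)).toLinearMap.lTensor (QSh K V) ∘ₗ
    (TensorProduct.assoc K (QSh K V) (UExt K V ⊗[K] R) (UExt K V)).toLinearMap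

@[simp] theorem sBlk_tmul (c : QSh K V) (p u : UExt K V) (r : R) :
    sBlk K V R ((c ⊗ₜ (p ⊗ₜ r)) ⊗ₜ u) = c ⊗ₜ (p ⊗ₜ (r ⊗ₜ u)) := by simp [sBlk]

theorem sBlk_blk (a b : V) (d : QSh K V ⊗[K] (UExt K V ⊗[K] R)) (u : UExt K V) :
    sBlk K V R (blk K V R a d ⊗ₜ (UExt.inr K V b * u)) =
      consA K V _ (add3 R (Coalgebra.comul (R := K) a ⊗ₜ b)) (sBlk K V R (d ⊗ₜ u)) := by
  rw [blk_apply]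
  induction d using ind3 with
  | h0 => simp
  | ha a b ha hb => simp only [map_add, TensorProduct.add_tmul, ha, hb]
  | ht c p r =>
    induction Coalgebra.comul (R := K) a with
    | zero => simp
    | add a b ha hb => simp only [map_add, LinearMap.add_apply, TensorProduct.add_tmul, ha, hb]
    | tmul a b => simp

variable (g : V ⊗[K] QSh K V →ₗ[K] Module.End K R)

/-- `g ⊗ id`. -/
noncomputable def gU : V ⊗[K] QSh K V →ₗ[K] Module.End K (R ⊗[K] UExt K V) :=
  LinearMap.rTensorHom (UExt K V) ∘ₗ g

@[simp] theorem gU_tmul (z : V ⊗[K] QSh K V) (r : R) (u : UExt K V) :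
    gU g z (r ⊗ₜ u) = g z r ⊗ₜ u := rfl

theorem closeWith_sBlk (d : QSh K V ⊗[K] (UExt K V ⊗[K] R)) (u : UExt K V) :
    closeWith (gU g) (sBlk K V R (d ⊗ₜ u)) = closeWith g d ⊗ₜ u := by
  induction d using ind3 with
  | h0 => simp
  | ha a b ha hb => simp only [map_add, TensorProduct.add_tmul, ha, hb]
  | ht c p r => rw [sBlk_tmul, closeWith_tmul, closeWith_tmul, gU_tmul]

/-- `w ⊗ u ↦ firstBlkG(w) ⊗ u`. -/
noncomputable def psiF : QSh K V ⊗[K] UExt K V →ₗ[K]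
    QSh K V ⊗[K] (UExt K V ⊗[K] (R ⊗[K] UExt K V)) :=
  sBlk K V R ∘ₗ (firstBlkG g).rTensor (UExt K V)

theorem psiF_tmul (w : QSh K V) (u : UExt K V) :
    psiF g (w ⊗ₜ u) = sBlk K V R (firstBlkG g w ⊗ₜ u) := rfl

theorem psiF_consA (x : V) (t : QSh K V ⊗[K] UExt K V) :
    psiF g (consA K V _ (comulU K V x) t) =
      newBlk K V _ ((blkFold g).rTensor _ (consA K V _ (comulU K V x) t)) +
        consA K V _ (add3 R ((Coalgebra.comul (R := K) (A := V)).rTensor V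
          (Coalgebra.comul (R := K) x))) (psiF g t) := by
  rw [comulU, LinearMap.comp_apply]
  induction t with
  | zero => simp
  | add a b ha hb =>
    rw [map_add, map_add, map_add, map_add, map_add, map_add, ha, hb]; abel
  | tmul w u =>
    induction Coalgebra.comul (R := K) x with
    | zero => simp
    | add a b ha hb =>
      simp only [map_add, LinearMap.add_apply] at ha hb ⊢
      rw [ha, hb]; abel
    | tmul a b =>
      rw [LinearMap.lTensor_tmul, consA_tmul, psiF_tmul, firstBlkG_cons, TensorProduct.add_tmul,
        map_add, sBlk_blk, LinearMap.rTensor_tmul, LinearMap.rTensor_tmul, psiF_tmul, newBlk_apply,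
        sBlk_tmul, newBlk_apply]

theorem closeWith_psiF (t : QSh K V ⊗[K] UExt K V) (ht : (counitL K V).rTensor (UExt K V) t = 0) :
    closeWith (gU g) (psiF g t) = (blkFold g).rTensor _ t := by
  have key : closeWith (gU g) (psiF g t) + (LinearMap.toSpanSingleton K R 1).rTensor _
      ((counitL K V).rTensor (UExt K V) t) = (blkFold g).rTensor _ t := by
    clear ht
    induction t with
    | zero => simp
    | add a b ha hb => rw [map_add, map_add, map_add, map_add, map_add, ← ha, ← hb]; abel
    | tmul w u =>
      rw [psiF_tmul, closeWith_sBlk, LinearMap.rTensor_tmul, LinearMap.rTensor_tmul,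
        LinearMap.rTensor_tmul, ← TensorProduct.add_tmul, blkFold, LinearMap.add_apply, add_comm]
      rfl
  rw [← key, ht, map_zero, add_zero]

theorem tBlk_blk [Coalgebra.IsCocomm K V] (τ : R →ₗ[K] R ⊗[K] UExt K V) (x : V)
    (d : QSh K V ⊗[K] (UExt K V ⊗[K] R)) : (tBlk τ).lTensor _ (blk K V R x d) =
      consA K V _ (add3 R ((Coalgebra.comul (R := K) (A := V)).rTensor V
          (Coalgebra.comul (R := K) x))) ((tBlk τ).lTensor _ d) := by
  have h1 : (Coalgebra.comul (R := K) (A := V)).rTensor V (Coalgebra.comul (R := K) x) =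
      TensorProduct.rightComm K V V V ((Coalgebra.comul (R := K) (A := V)).rTensor V
        (Coalgebra.comul (R := K) x)) := by
    apply (TensorProduct.assoc K V V V).injective
    have h2 : ∀ y, TensorProduct.assoc K V V V (TensorProduct.rightComm K V V V y) =
        (TensorProduct.comm K V V).toLinearMap.lTensor V (TensorProduct.assoc K V V V y) := by
      intro y
      induction y with
      | zero => simp
      | add a b ha hb => simp only [map_add, ha, hb]
      | tmul a c =>
        induction a with
        | zero => simp
        | add a b ha hb => simp only [map_add, TensorProduct.add_tmul, ha, hb]
        | tmul a b => simp
    rw [h2, Coalgebra.coassoc_apply, ← LinearMap.lTensor_comp_apply, Coalgebra.comm_comp_comul]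
  rw [h1, blk_apply]
  induction d using ind3 with
  | h0 => simp
  | ha a b ha hb => simp only [map_add, ha, hb]
  | ht c p r =>
    induction Coalgebra.comul (R := K) x with
    | zero => simp
    | add a b ha hb => simp only [map_add, LinearMap.add_apply, ha, hb]
    | tmul a b =>
      rw [blkz_tmul, LinearMap.lTensor_tmul, LinearMap.lTensor_tmul, tBlk_tmul, tBlk_tmul, map_mul,
        theta_inr, LinearMap.rTensor_tmul, mul_assoc]
      induction Coalgebra.comul (R := K) a with
      | zero => simp
      | add a b ha hb =>
        simp only [map_add, add_mul, TensorProduct.add_tmul, TensorProduct.tmul_add,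
          LinearMap.add_apply, ha, hb]
      | tmul a e => simp

end

variable (K V) in
/-- `s ⊗ t ↦ s' ⊗ t ⊗ s''`, with `ρ(s) = s' ⊗ s''`. -/
noncomputable def coactLeft : QSh K V ⊗[K] QSh K V →ₗ[K] (QSh K V ⊗[K] QSh K V) ⊗[K] UExt K V :=
  (TensorProduct.rightComm K (QSh K V) (UExt K V) (QSh K V)).toLinearMap ∘ₗ
    (coactL K V).rTensor (QSh K V)

theorem coactLeft_tmul (s t : QSh K V) : coactLeft K V (s ⊗ₜ t) =
    TensorProduct.rightComm K (QSh K V) (UExt K V) (QSh K V) (coactL K V s ⊗ₜ t) := rfl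

theorem coactLeft_consA (v : V) (c s t : QSh K V) :
    coactLeft K V (consA K V (QSh K V) (v ⊗ₜ c) (s ⊗ₜ t)) =
      closeWith (gU (consA K V (QSh K V)))
        (c ⊗ₜ (theta K V _ (UExt.inr K V v) * (1 ⊗ₜ coactLeft K V (s ⊗ₜ t)))) := by
  rw [consA_tmul, coactLeft_tmul, coactLeft_tmul, coactL, foldA_cons, ← coactL, theta_inr, comulU,
    LinearMap.comp_apply]
  induction Coalgebra.comul (R := K) v with
  | zero => simp
  | add a b ha hb => simp only [map_add, add_mul, LinearMap.add_apply, TensorProduct.add_tmul,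
      TensorProduct.tmul_add, ha, hb]
  | tmul a b =>
    induction coactL K V s with
    | zero => simp
    | add a b ha hb => simp only [map_add, mul_add, TensorProduct.add_tmul,
        TensorProduct.tmul_add, ha, hb]
    | tmul s u => simp [Algebra.TensorProduct.one_def]

theorem coactLeft_closeWith (d : QSh K V ⊗[K] (UExt K V ⊗[K] (QSh K V ⊗[K] QSh K V))) :
    coactLeft K V (closeWith (consA K V (QSh K V)) d) =
      closeWith (gU (consA K V (QSh K V))) ((tBlk (coactLeft K V)).lTensor _ d) := by
  induction d using ind3 with
  | h0 => simp
  | ha a b ha hb => simp only [map_add, ha, hb]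
  | ht c p r =>
    induction r with
    | zero => simp
    | add a b ha hb => simp only [map_add, TensorProduct.tmul_add, ha, hb]
    | tmul s t =>
      rw [LinearMap.lTensor_tmul, tBlk_tmul, closeWith_tmul]
      induction p using UExt.ind with
      | h k v =>
        rw [map_add, map_add, map_smul, map_smul, UExt.snd_one, smul_zero, zero_add, UExt.snd_inr,
          coactLeft_consA, map_one, add_mul, TensorProduct.tmul_add, map_add, smul_mul_assoc, one_mul,
          TensorProduct.tmul_smul, map_smul, closeWith_tmul]
        simp

variable [Coalgebra.IsCocomm K V]

theorem coactL_cons (x : V) (w : QSh K V) :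
    coactL K V (cons x w) = consA K V _ (comulU K V x) (coactL K V w) := foldA_cons _ _ _

theorem tBlk_newBlk (r : QSh K V ⊗[K] QSh K V) :
    (tBlk (coactLeft K V)).lTensor _ (newBlk K V _ r) = newBlk K V _ (coactLeft K V r) := by
  rw [newBlk_apply, LinearMap.lTensor_tmul, tBlk_tmul, map_one, one_mul, newBlk_apply]

theorem coactLeft_one : coactLeft K V (1 ⊗ₜ 1) = (1 ⊗ₜ 1) ⊗ₜ 1 := by
  simp [coactLeft_tmul, coactL]

theorem firstBlk_cons (x : V) (w : QSh K V) : firstBlk K V (cons x w) =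
    newBlk K V _ (deltaL K V (cons x w)) + blk K V _ x (firstBlk K V w) := firstBlkG_cons _ _ _

theorem compat_step (x : V) (w : QSh K V)
    (ih : (tBlk (coactLeft K V)).lTensor _ (firstBlk K V w) =
      psiF (consA K V (QSh K V)) (coactL K V w)) :
    coactLeft K V (deltaL K V (cons x w)) = (deltaL K V).rTensor _ (coactL K V (cons x w)) := by
  have h0 : (counitL K V).rTensor (UExt K V) (coactL K V (cons x w)) = 0 := by
    rw [coactL_cons, counitL_consA]
  have h5 := closeWith_psiF (consA K V (QSh K V)) _ h0
  rw [coactL_cons, psiF_consA, map_add, closeWith_newBlk, zero_add, ← ih, ← tBlk_blk,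
    ← coactLeft_closeWith, ← blkFold_cons, ← coactL_cons] at h5
  exact h5

theorem compat_step' (x : V) (w : QSh K V)
    (ih : (tBlk (coactLeft K V)).lTensor _ (firstBlk K V w) =
      psiF (consA K V (QSh K V)) (coactL K V w)) :
    (tBlk (coactLeft K V)).lTensor _ (firstBlk K V (cons x w)) =
      psiF (consA K V (QSh K V)) (coactL K V (cons x w)) := by
  rw [coactL_cons, psiF_consA, ← coactL_cons, ← ih, ← tBlk_blk, firstBlk_cons, map_add,
    tBlk_newBlk, compat_step x w ih]
  rfl

theorem compat_aux (w : QSh K V) :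
    (tBlk (coactLeft K V)).lTensor _ (firstBlk K V w) =
      psiF (consA K V (QSh K V)) (coactL K V w) := by
  induction w using ind with
  | hn =>
    rw [firstBlkG_one, tBlk_newBlk, coactL, foldA_one, psiF_tmul, firstBlkG_one, newBlk_apply,
      newBlk_apply, sBlk_tmul, Algebra.TensorProduct.one_def, coactLeft_one]
  | hc x w ih => exact compat_step' x w ih
  | ha a b ha hb => simp only [map_add, ha, hb]
  | hs r u hu => simp only [map_smul, hu]

theorem compat (w : QSh K V) :
    coactLeft K V (deltaL K V w) = (deltaL K V).rTensor _ (coactL K V w) := by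
  induction w using ind with
  | hn => rw [deltaL_one, coactLeft_one, coactL, foldA_one, LinearMap.rTensor_tmul, deltaL_one]
  | hc x w ih => exact compat_step x w (compat_aux w)
  | ha a b ha hb => simp only [map_add, ha, hb]
  | hs r u hu => simp only [map_smul, hu]

theorem coact_deltaL (w : QSh K V) : TensorProduct.rightComm K (QSh K V) (UExt K V) (QSh K V)
      ((coactL K V).rTensor _ (deltaL K V w)) = (deltaL K V).rTensor _ (coactL K V w) :=
  compat w

/-! Coassociativity of `δ` -/

variable (K V) in
/-- `(δ ⊗ id) ∘ δ`. -/
noncomputable def dl : QSh K V →ₗ[K] QSh K V ⊗[K] (QSh K V ⊗[K] QSh K V) :=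
  (TensorProduct.assoc K _ _ _).toLinearMap ∘ₗ (deltaL K V).rTensor _ ∘ₗ deltaL K V

variable (K V) in
/-- `(id ⊗ δ) ∘ δ`. -/
noncomputable def dr : QSh K V →ₗ[K] QSh K V ⊗[K] (QSh K V ⊗[K] QSh K V) :=
  (deltaL K V).lTensor _ ∘ₗ deltaL K V

theorem dl_pr (w : QSh K V) : (pr K V).rTensor _ (dl K V w) =
    sndComm K V _ ((deltaL K V).rTensor _ (coactL K V w)) := by
  have h1 : ∀ t : QSh K V ⊗[K] QSh K V, (pr K V).rTensor _ (TensorProduct.assoc K _ _ _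
      ((deltaL K V).rTensor _ t)) = sndComm K V _ (coactLeft K V t) := by
    intro t
    induction t with
    | zero => simp
    | add a b ha hb => simp only [map_add, ha, hb]
    | tmul u v =>
      have h2 := pr_deltaL u
      rw [coactLeft_tmul, LinearMap.rTensor_tmul]
      have h3 : ∀ y : QSh K V ⊗[K] QSh K V, (pr K V).rTensor _
          (TensorProduct.assoc K _ _ _ (y ⊗ₜ[K] v)) =
          TensorProduct.assoc K _ _ _ ((pr K V).rTensor _ y ⊗ₜ[K] v) := by
        intro y
        induction y with
        | zero => simp
        | add a b ha hb => simp only [map_add, TensorProduct.add_tmul, ha, hb]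
        | tmul a b => simp
      rw [h3, h2]
      induction coactL K V u with
      | zero => simp
      | add a b ha hb => simp only [map_add, TensorProduct.add_tmul, ha, hb]
      | tmul a b => simp
  rw [dl, LinearMap.comp_apply, LinearMap.comp_apply, LinearEquiv.coe_coe, h1, compat w]

theorem dr_pr (w : QSh K V) : (pr K V).rTensor _ (dr K V w) =
    sndComm K V _ ((deltaL K V).rTensor _ (coactL K V w)) := by
  rw [dr, LinearMap.comp_apply, ← lTensor_rTensor', pr_deltaL]
  induction coactL K V w with
  | zero => simp
  | add a b ha hb => simp only [map_add, ha, hb]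
  | tmul a b => simp

theorem assoc_m1324 (y z : QSh K V ⊗[K] QSh K V) (b d : QSh K V) :
    (TensorProduct.assoc K (QSh K V ⊗[K] QSh K V) (QSh K V) (QSh K V))
      (m1324 K (QSh K V) (QSh K V) (y ⊗ₜ z) ⊗ₜ (b * d)) =
    m1324 K (QSh K V) (QSh K V ⊗[K] QSh K V)
      (TensorProduct.assoc K _ _ _ (y ⊗ₜ b) ⊗ₜ TensorProduct.assoc K _ _ _ (z ⊗ₜ d)) := by
  induction y with
  | zero => simp
  | add a b ha hb => simp only [map_add, TensorProduct.add_tmul, ha, hb]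
  | tmul a e =>
  induction z with
  | zero => simp
  | add a b ha hb => simp only [map_add, TensorProduct.add_tmul, TensorProduct.tmul_add, ha, hb]
  | tmul a e => simp

theorem dl_comul_aux (t : QSh K V ⊗[K] QSh K V) :
    (deconc K V).rTensor _ (TensorProduct.assoc K _ _ _
      ((deltaL K V).rTensor _ t)) = TensorProduct.assoc K (QSh K V ⊗[K] QSh K V) (QSh K V) (QSh K V)
        ((deltaE K V).rTensor _ ((deconc K V).rTensor _ t)) := by
  induction t with
  | zero => simp
  | add a b ha hb => simp only [map_add, ha, hb]
  | tmul u v =>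
    rw [LinearMap.rTensor_tmul, LinearMap.rTensor_tmul, LinearMap.rTensor_tmul,
      ← (deconc_deltaL_aux u).2]
    induction deltaL K V u with
    | zero => simp
    | add a b ha hb => simp only [map_add, TensorProduct.add_tmul, ha, hb]
    | tmul a b => simp

theorem dl_comul_aux2 (s t : QSh K V ⊗[K] QSh K V) :
    TensorProduct.assoc K (QSh K V ⊗[K] QSh K V) (QSh K V) (QSh K V)
      ((deltaE K V).rTensor _ (m1324 K (QSh K V) (QSh K V) (s ⊗ₜ t))) =
    m1324 K (QSh K V) (QSh K V ⊗[K] QSh K V)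
          (TensorProduct.assoc K _ _ _ ((deltaL K V).rTensor _ s) ⊗ₜ
            TensorProduct.assoc K _ _ _ ((deltaL K V).rTensor _ t)) := by
  induction s with
  | zero => simp only [TensorProduct.zero_tmul, map_zero]
  | add a b ha hb => simp only [map_add, TensorProduct.add_tmul, ha, hb]
  | tmul a b =>
  induction t with
  | zero => simp only [TensorProduct.tmul_zero, map_zero]
  | add a b ha hb => simp only [map_add, TensorProduct.tmul_add, ha, hb]
  | tmul c d =>
    rw [m1324_tmul, LinearMap.rTensor_tmul, LinearMap.rTensor_tmul, LinearMap.rTensor_tmul,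
      deltaE_tmul, assoc_m1324]

theorem dl_comul (w : QSh K V) : (deconc K V).rTensor _ (dl K V w) =
    m1324 K _ _ (TensorProduct.map (dl K V) (dl K V) (deconc K V w)) := by
  have e : ∀ w, dl K V w = TensorProduct.assoc K _ _ _ ((deltaL K V).rTensor _ (deltaL K V w)) :=
    fun w => rfl
  rw [e, dl_comul_aux, deconc_deltaL]
  induction deconc K V w with
  | zero => simp only [map_zero]
  | add a b ha hb => simp only [map_add, ha, hb]
  | tmul a b => rw [TensorProduct.map_tmul, dl_comul_aux2, TensorProduct.map_tmul, e, e]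

theorem dr_comul (w : QSh K V) : (deconc K V).rTensor _ (dr K V w) =
    m1324 K _ _ (TensorProduct.map (dr K V) (dr K V) (deconc K V w)) := by
  have h2 : ∀ s t : QSh K V ⊗[K] QSh K V, (deltaL K V).lTensor _ (m1324 K _ _ (s ⊗ₜ t)) =
      m1324 K _ _ ((deltaL K V).lTensor _ s ⊗ₜ (deltaL K V).lTensor _ t) := by
    intro s t
    induction s with
    | zero => simp
    | add a b ha hb => simp only [map_add, TensorProduct.add_tmul, ha, hb]
    | tmul a b =>
    induction t with
    | zero => simp
    | add a b ha hb => simp only [map_add, TensorProduct.tmul_add, ha, hb]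
    | tmul c d =>
      rw [m1324_tmul, LinearMap.lTensor_tmul, LinearMap.lTensor_tmul, LinearMap.lTensor_tmul,
        m1324_tmul, deltaL_mul]
  rw [dr, LinearMap.comp_apply, ← lTensor_rTensor', deconc_deltaL, ← dr]
  induction deconc K V w with
  | zero => simp
  | add a b ha hb => simp only [map_add, ha, hb]
  | tmul a b => rw [TensorProduct.map_tmul, h2, TensorProduct.map_tmul]; rfl

theorem dl_counit (w : QSh K V) :
    (counitL K V).rTensor _ (dl K V w) = counitL K V w ⊗ₜ 1 := by
  have h1 : ∀ t : QSh K V ⊗[K] QSh K V, (counitL K V).rTensor _ (TensorProduct.assoc K _ _ _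
      ((deltaL K V).rTensor _ t)) =
        (TensorProduct.mk K (QSh K V) (QSh K V) 1).lTensor K ((counitL K V).rTensor _ t) := by
    intro t
    induction t with
    | zero => simp
    | add a b ha hb => simp only [map_add, ha, hb]
    | tmul u v =>
      have h3 : ∀ y : QSh K V ⊗[K] QSh K V, (counitL K V).rTensor _
          (TensorProduct.assoc K _ _ _ (y ⊗ₜ[K] v)) =
          TensorProduct.assoc K _ _ _ ((counitL K V).rTensor _ y ⊗ₜ[K] v) := by
        intro y
        induction y with
        | zero => simp
        | add a b ha hb => simp only [map_add, TensorProduct.add_tmul, ha, hb]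
        | tmul a b => simp
      rw [LinearMap.rTensor_tmul, h3, counitL_deltaL]
      simp
  rw [dl, LinearMap.comp_apply, LinearMap.comp_apply, LinearEquiv.coe_coe, h1, counitL_deltaL]
  simp [Algebra.TensorProduct.one_def]

theorem dr_counit (w : QSh K V) :
    (counitL K V).rTensor _ (dr K V w) = counitL K V w ⊗ₜ 1 := by
  rw [dr, LinearMap.comp_apply, ← lTensor_rTensor', counitL_deltaL, LinearMap.lTensor_tmul,
    deltaL_one, Algebra.TensorProduct.one_def]

theorem dl_eq_dr : dl K V = dr K V := by
  refine comul_uniq _ _ dl_comul dr_comul dl_counit dr_counit ?_ ?_ (fun w => ?_)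
  · simp [dl, deltaL_one, Algebra.TensorProduct.one_def]
  · simp [dr, deltaL_one, Algebra.TensorProduct.one_def]
  · rw [dl_pr, dr_pr]

end Compat
end QSh

/-- A double bialgebra `(B, m, Δ, δ)`: the bialgebra `(B, m, Δ)` is the given one, `(B, m, δ)` is a
second bialgebra with the same product and with counit `ε_δ`, and `(B, m, Δ)` is a bialgebra in the
category of right comodules over `(B, m, δ)`, with the coaction `δ`. -/
class DoubleBialgebra (K B : Type*) [CommRing K] [Ring B] [Bialgebra K B] where
  delta : B →ₐ[K] B ⊗[K] B
  epsDelta : B →ₐ[K] K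
  delta_coassoc : ∀ x, TensorProduct.assoc K B B B (delta.toLinearMap.rTensor B (delta x)) =
    delta.toLinearMap.lTensor B (delta x)
  rTensor_epsDelta : ∀ x, TensorProduct.lid K B (epsDelta.toLinearMap.rTensor B (delta x)) = x
  lTensor_epsDelta : ∀ x, TensorProduct.rid K B (epsDelta.toLinearMap.lTensor B (delta x)) = x
  /-- `(ε_Δ ⊗ Id) ∘ δ(x) = ε_Δ(x) 1`. -/
  counit_delta : ∀ x, TensorProduct.lid K B
    ((Coalgebra.counit (R := K) (A := B)).rTensor B (delta x)) =
      algebraMap K B (Coalgebra.counit x)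
  /-- `(Δ ⊗ Id) ∘ δ = m_{1,3,24} ∘ (δ ⊗ δ) ∘ Δ`. -/
  comul_delta : ∀ x, (Coalgebra.comul (R := K) (A := B)).rTensor B (delta x) =
    m1324 K B B (TensorProduct.map delta.toLinearMap delta.toLinearMap (Coalgebra.comul x))

/-- A bialgebra `(B, m, Δ, ρ)` over the (unitary, commutative) bialgebra `W`: a bialgebra in the
category of right `W`-comodules, with coaction `ρ`. -/
class BialgebraOver (K W B : Type*) [CommRing K] [CommRing W] [Bialgebra K W] [Ring B]
    [Bialgebra K B] where
  /-- `ρ`; that it is an algebra morphism says that the unit and the product of `B` are comodule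
  morphisms. -/
  rho : B →ₐ[K] B ⊗[K] W
  rho_coassoc : ∀ x, TensorProduct.assoc K B W W (rho.toLinearMap.rTensor W (rho x)) =
    (Coalgebra.comul (R := K) (A := W)).lTensor B (rho x)
  rho_counit : ∀ x, TensorProduct.rid K B
    ((Coalgebra.counit (R := K) (A := W)).lTensor B (rho x)) = x
  /-- `(ε_Δ ⊗ Id) ∘ ρ(x) = ε_Δ(x) 1`. -/
  counit_rho : ∀ x, TensorProduct.lid K W
    ((Coalgebra.counit (R := K) (A := B)).rTensor W (rho x)) =
      algebraMap K W (Coalgebra.counit x)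
  /-- `(Δ ⊗ Id) ∘ ρ = m_{1,3,24} ∘ (ρ ⊗ ρ) ∘ Δ`. -/
  comul_rho : ∀ x, (Coalgebra.comul (R := K) (A := B)).rTensor W (rho x) =
    m1324 K B W (TensorProduct.map rho.toLinearMap rho.toLinearMap (Coalgebra.comul x))

/-- A bialgebra over the nonunitary commutative bialgebra `V`: a bialgebra over `uV` such that
`ρ(ker ε_Δ) ⊆ B ⊗ V`. -/
class NonUnitalBialgebraOver (K V B : Type*) [CommRing K] [NonUnitalCommRing V] [Module K V]
    [IsScalarTower K V V] [SMulCommClass K V V] [NonUnitalBialgebra K V] [Ring B] [Bialgebra K B]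
    extends BialgebraOver K (UExt K V) B where
  rho_mem : ∀ x, Coalgebra.counit (R := K) x = 0 →
    rho x ∈ LinearMap.range ((UExt.inr K V).lTensor B)

/-- A double bialgebra `(B, m, Δ, δ, ρ)` over `V`: a double bialgebra and a bialgebra over `V` such
that `(Id ⊗ c) ∘ (ρ ⊗ Id) ∘ δ = (δ ⊗ Id) ∘ ρ`, where `c` is the flip. -/
class DoubleBialgebraOver (K V B : Type*) [CommRing K] [NonUnitalCommRing V] [Module K V]
    [IsScalarTower K V V] [SMulCommClass K V V] [NonUnitalBialgebra K V] [Ring B] [Bialgebra K B]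
    [DoubleBialgebra K B] extends NonUnitalBialgebraOver K V B where
  rho_delta : ∀ x, TensorProduct.rightComm K B (UExt K V) B
      (rho.toLinearMap.rTensor B (DoubleBialgebra.delta (K := K) x)) =
    (DoubleBialgebra.delta (K := K) (B := B)).toLinearMap.rTensor (UExt K V) (rho x)

namespace QSh

variable {K V : Type*} [CommRing K] [NonUnitalCommRing V] [Module K V]
  [IsScalarTower K V V] [SMulCommClass K V V] [NonUnitalBialgebra K V] [Coalgebra.IsCocomm K V]

/-- The double bialgebra `QSh(V) = (T(V), ⧢, Δ, δ)`. -/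
noncomputable instance : DoubleBialgebra K (QSh K V) where
  delta := AlgHom.ofLinearMap (deltaL K V) deltaL_one deltaL_mul
  epsDelta := AlgHom.ofLinearMap (epsDeltaL K V) epsDeltaL_one epsDeltaL_mul
  delta_coassoc := fun x => LinearMap.congr_fun dl_eq_dr x
  rTensor_epsDelta := rTensor_epsDeltaL_deltaL
  lTensor_epsDelta := lTensor_epsDeltaL_deltaL
  counit_delta := fun x => by
    have h := congrArg (TensorProduct.lid K (QSh K V)) (counitL_deltaL x)
    rw [TensorProduct.lid_tmul, ← Algebra.algebraMap_eq_smul_one] at h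
    exact h
  comul_delta := deconc_deltaL

/-- `QSh(V)` as a double bialgebra over `V`, with `ρ(v₁ … vₙ) = v₁' … vₙ' ⊗ v₁'' · … · vₙ''`. -/
noncomputable instance : DoubleBialgebraOver K V (QSh K V) where
  rho := coact K V
  rho_coassoc := foldA_coassoc (comulU K V) (Bialgebra.comulAlgHom K (UExt K V)) comulU_coassoc
  rho_counit := foldA_counit (comulU K V) (Bialgebra.counitAlgHom K (UExt K V)) comulU_counit
  counit_rho := fun x => by
    have h := congrArg (TensorProduct.lid K (UExt K V)) (foldA_counitL (comulU K V) x)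
    rw [TensorProduct.lid_tmul, ← Algebra.algebraMap_eq_smul_one] at h
    exact h
  comul_rho := foldA_deconc (comulU K V)
  rho_mem := coactL_mem
  rho_delta := coact_deltaL

end QSh

section Morphisms

variable (K V : Type*) {B B' : Type*} [CommRing K] [NonUnitalCommRing V] [Module K V]
  [IsScalarTower K V V] [SMulCommClass K V V] [NonUnitalBialgebra K V]
  [Ring B] [Bialgebra K B] [DoubleBialgebra K B] [DoubleBialgebraOver K V B]
  [Ring B'] [Bialgebra K B'] [DoubleBialgebra K B'] [DoubleBialgebraOver K V B']

/-- A morphism of double bialgebras over `V`: a morphism `φ` of the bialgebras `(B, m, Δ)` which is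
compatible with `δ`, `ε_δ` and `ρ`. -/
structure IsDoubleBialgebraOverHom (φ : B →ₐc[K] B') : Prop where
  map_delta : ∀ x, DoubleBialgebra.delta (K := K) (φ x) =
    TensorProduct.map (φ : B →ₗ[K] B') (φ : B →ₗ[K] B') (DoubleBialgebra.delta (K := K) x)
  map_epsDelta : ∀ x, DoubleBialgebra.epsDelta (K := K) (φ x) =
    DoubleBialgebra.epsDelta (K := K) x
  map_rho : ∀ x, BialgebraOver.rho (K := K) (W := UExt K V) (φ x) =
    (φ : B →ₗ[K] B').rTensor (UExt K V) (BialgebraOver.rho (K := K) (W := UExt K V) x)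

end Morphisms

section Reduced

variable (K B : Type*) [CommRing K] [Ring B] [Bialgebra K B]

/-- The reduced coproduct `Δ̃(x) = Δ(x) - x ⊗ 1 - 1 ⊗ x`. -/
noncomputable def reducedComul : B →ₗ[K] B ⊗[K] B :=
  Coalgebra.comul - (TensorProduct.mk K B B).flip 1 - TensorProduct.mk K B B 1

/-- The iterated reduced coproducts, `Δ̃⁽⁰⁾ = Id` and `Δ̃⁽ⁿ⁾ = (Δ̃⁽ⁿ⁻¹⁾ ⊗ Id) ∘ Δ̃`, as maps
to `B^{⊗(n+1)}`. -/
noncomputable def iterReducedComul : (n : ℕ) → B →ₗ[K] ⨂[K]^(n + 1) B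
  | 0 => (PiTensorProduct.subsingletonEquiv (R := K) (s := fun _ => B) (0 : Fin 1)).symm.toLinearMap
  | n + 1 => TensorPower.mulEquiv.toLinearMap ∘ₗ
      TensorProduct.map (iterReducedComul n)
        (PiTensorProduct.subsingletonEquiv (R := K) (s := fun _ => B) (0 : Fin 1)).symm.toLinearMap ∘ₗ
      reducedComul K B

/-- `(B, m, Δ)` is connected: `ker ε_Δ` is the union of the kernels of the `Δ̃⁽ⁿ⁾` on it. -/
def IsConnectedBialgebra : Prop :=
  ∀ x : B, Coalgebra.counit (R := K) x = 0 → ∃ n, iterReducedComul K B n x = 0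

end Reduced

section Formula

variable (K V B : Type*) [CommRing K] [NonUnitalCommRing V] [Module K V]
  [IsScalarTower K V V] [SMulCommClass K V V] [NonUnitalBialgebra K V]
  [Ring B] [Bialgebra K B] [DoubleBialgebra K B] [DoubleBialgebraOver K V B]

/-- The `V`-component of `(ε_δ ⊗ Id) ∘ ρ : B → uV = K ⊕ V`. On `ker ε_Δ`, the map
`(ε_δ ⊗ Id) ∘ ρ` has values in `V`. -/
noncomputable def epsDeltaRho : B →ₗ[K] V :=
  UExt.snd K V ∘ₗ (TensorProduct.lid K (UExt K V)).toLinearMap ∘ₗ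
    (DoubleBialgebra.epsDelta (K := K) (B := B)).toLinearMap.rTensor (UExt K V) ∘ₗ
    (BialgebraOver.rho (K := K) (W := UExt K V) (B := B)).toLinearMap

/-- `((ε_δ ⊗ Id) ∘ ρ)^{⊗(n+1)} ∘ Δ̃⁽ⁿ⁾`, with values in the words of length `n + 1`. -/
noncomputable def wordTerm (n : ℕ) : B →ₗ[K] QSh K V :=
  (QSh.ofTensorAlgebra K V).toLinearMap ∘ₗ TensorPower.toTensorAlgebra ∘ₗ
    PiTensorProduct.map (fun _ => epsDeltaRho K V B) ∘ₗ iterReducedComul K B n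

/-- `(ε_δ ⊗ Id) ∘ ρ` maps `ker ε_Δ` into `V`. -/
theorem inr_epsDeltaRho (x : B) (hx : Coalgebra.counit (R := K) x = 0) :
    UExt.inr K V (epsDeltaRho K V B x) = TensorProduct.lid K (UExt K V)
      ((DoubleBialgebra.epsDelta (K := K) (B := B)).toLinearMap.rTensor (UExt K V)
        (BialgebraOver.rho (K := K) (W := UExt K V) x)) := by
  obtain ⟨t, ht⟩ := NonUnitalBialgebraOver.rho_mem (V := V) x hx
  rw [epsDeltaRho, LinearMap.comp_apply, LinearMap.comp_apply, LinearMap.comp_apply,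
    AlgHom.toLinearMap_apply, ← ht]
  clear ht
  induction t with
  | zero => simp
  | add a b ha hb => simp only [map_add, ha, hb]
  | tmul a v => simp

end Formula

/-! The proof rests on one invertible element of a convolution algebra. Linear maps from a coalgebra
`C` to `T(V)`, with the concatenation product, form an algebra under convolution. For `C = QSh(V)`
with deconcatenation, let `ι` be the identity `QSh(V) → T(V)` and `p` the projection onto the
letters. Cutting a nonempty word after its first letter, or before its last one, and gluing it back
gives `p * ι = ι * p = ι - 1`, so `ι` is a two-sided inverse of `1 - p`.

Composition with a coalgebra morphism `φ : C → QSh(V)` respects convolution and its unit, so `φ`,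
read in `T(V)`, is the inverse of `1 - p ∘ φ` and is determined by its letter part `pr ∘ φ`
(`coalgHom_ext`). Conversely, let `f : B → V` satisfy `f(1) = 0`. Since `f` kills the unit, its
convolution powers for `Δ` are the maps `f^{⊗n} ∘ Δ̃⁽ⁿ⁻¹⁾`. When `B` is connected they vanish
eventually on each element, the geometric series `∑ fⁿ` inverts `1 - f`, and it is a coalgebra
morphism with letter part `f` (`exists_conv_inverse`, `deconc_ofConvL`, `coalgLift`).

The right letter part is forced: a morphism of double bialgebras over `V` commutes with `(ε_δ ⊗ Id)
∘ ρ`, and on `QSh(V)` that map is `pr` (`epsDeltaRho_eq_pr`, `pr_hom`). This gives uniqueness, and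
the series for `f = (ε_δ ⊗ Id) ∘ ρ` is the formula.

It remains to see that the coalgebra morphism `φ` with this letter part respects everything else.
Each compatibility equates two maps into `QSh(V)`, or into `QSh(V) ⊗ A` with `A` a commutative
algebra, which are both compatible with the coproducts, so it suffices to compare their letter parts
(`coalgHom_ext`, `IsComultiplicative.ext`). The letter parts agree because `(ε_δ ⊗ Id) ∘ ρ` is an
algebra morphism to `uV` (products), because `ρ` is coassociative (coaction), and because `ρ`
commutes with `δ` (second coproduct). -/

open WithConv

namespace QSh

/-! ### The convolution inverse of the identity of `T(V)` -/

section ConvolutionInverse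

variable {K V : Type*} [CommRing K] [NonUnitalCommRing V] [Module K V]
  [IsScalarTower K V V] [SMulCommClass K V V]

variable (K V) in
/-- The identification `QSh(V) = T(V)`, as an element of the convolution algebra of linear maps from
the coalgebra `QSh(V)` to the algebra `T(V)` (with the concatenation product). -/
noncomputable def toTensor : WithConv (QSh K V →ₗ[K] TensorAlgebra K V) :=
  toConv (ofTensorAlgebra K V).symm.toLinearMap

variable (K V) in
/-- The projection onto the letters, with values in `T(V)`. -/
noncomputable def prTensor : WithConv (QSh K V →ₗ[K] TensorAlgebra K V) :=
  toConv (TensorAlgebra.ι K ∘ₗ pr K V)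

theorem toTensor_apply (w : QSh K V) : toTensor K V w = (ofTensorAlgebra K V).symm w := rfl

theorem toTensor_one : toTensor K V 1 = 1 := by
  rw [toTensor_apply, ← nil_eq_one, nil, LinearEquiv.symm_apply_apply]

theorem toTensor_cons (x : V) (w : QSh K V) :
    toTensor K V (cons x w) = TensorAlgebra.ι K x * toTensor K V w := symm_cons x w

/-- Among all cuts of a word, only the one after its first letter has a one-letter left part; gluing
the two parts restores the word, and the empty word contributes nothing. This is `cons_pr_deconc`
read in `T(V)`. -/
theorem prTensor_mul_toTensor : prTensor K V * toTensor K V = toTensor K V - 1 := by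
  ext w
  have h := congrArg (ofTensorAlgebra K V).symm (cons_pr_deconc w)
  have aux : ∀ t : QSh K V ⊗[K] QSh K V,
      LinearMap.mul' K (TensorAlgebra K V) (TensorProduct.map (prTensor K V).ofConv
        (toTensor K V).ofConv t) =
      (ofTensorAlgebra K V).symm (TensorProduct.lift (cons ∘ₗ pr K V) t) := by
    intro t
    induction t with
    | zero => simp
    | add a b ha hb => simp only [map_add, ha, hb]
    | tmul u v => rfl
  rw [LinearMap.convMul_apply, comul_eq, aux, h, map_sub, map_smul]
  refine congrArg₂ _ rfl ?_
  rw [← toTensor_apply, toTensor_one]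
  exact (Algebra.algebraMap_eq_smul_one _).symm

/-- The mirror image, cutting off the last letter. Words are built from the left, so here an
induction is needed. Both one-sided identities are required because convolution is not commutative.
-/
theorem toTensor_mul_prTensor : toTensor K V * prTensor K V = toTensor K V - 1 := by
  have aux : ∀ x, ∀ t : QSh K V ⊗[K] QSh K V,
      LinearMap.mul' K (TensorAlgebra K V) (TensorProduct.map (toTensor K V).ofConv
        (prTensor K V).ofConv ((cons x).rTensor _ t)) =
      TensorAlgebra.ι K x * LinearMap.mul' K (TensorAlgebra K V)
        (TensorProduct.map (toTensor K V).ofConv (prTensor K V).ofConv t) := by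
    intro x t
    induction t with
    | zero => simp
    | add a b ha hb => simp only [map_add, mul_add, ha, hb]
    | tmul u v =>
      simp only [LinearMap.rTensor_tmul, TensorProduct.map_tmul, LinearMap.mul'_apply]
      rw [← mul_assoc]
      rfl
  -- Adding the counit makes the left side commute with prefixing a letter: in `Δ(xw) = 1 ⊗ xw + (x
  -- ⊗ 1)Δ(w)` the first term contributes `ε(w)x`, which is `x` times the counit term for `w`.
  have key : ∀ w, (toTensor K V * prTensor K V) w + (1 : WithConv (QSh K V →ₗ[K] _)) w =
      toTensor K V w := by
    intro w
    rw [LinearMap.convMul_apply, LinearMap.convOne_apply, comul_eq, counit_eq]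
    induction w using ind with
    | hn =>
      have h1 : (prTensor K V).ofConv 1 = 0 := by
        change TensorAlgebra.ι K (pr K V 1) = 0
        rw [pr_one, map_zero]
      rw [deconc_one, TensorProduct.map_tmul, h1, TensorProduct.tmul_zero, map_zero, zero_add,
        counitL_one, map_one, toTensor_one]
    | hc x w ih =>
      have h1 : (toTensor K V).ofConv 1 = 1 := toTensor_one
      have h2 : (prTensor K V).ofConv (cons x w) =
          TensorAlgebra.ι K x * algebraMap K _ (counitL K V w) := by
        change TensorAlgebra.ι K (pr K V _) = _
        rw [pr_cons, map_smul, Algebra.smul_def, Algebra.commutes]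
      rw [deconc_cons, map_add, map_add, aux, TensorProduct.map_tmul, h1, h2, LinearMap.mul'_apply,
        one_mul, counitL_cons, map_zero, add_zero, toTensor_cons, ← ih, mul_add, add_comm]
    | ha u v hu hv =>
      have h1 : toTensor K V (u + v) = toTensor K V u + toTensor K V v := rfl
      rw [h1, ← hu, ← hv]; simp only [map_add]; abel
    | hs r u hu =>
      have h1 : toTensor K V (r • u) = r • toTensor K V u := rfl
      rw [h1, ← hu]; simp only [map_smul, smul_add, smul_eq_mul, map_mul, ← Algebra.smul_def]
  rw [eq_sub_iff_add_eq]
  ext w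
  exact key w

theorem toTensor_mul_one_sub : toTensor K V * (1 - prTensor K V) = 1 := by
  rw [mul_sub, mul_one, toTensor_mul_prTensor, sub_sub_cancel]

theorem one_sub_mul_toTensor : (1 - prTensor K V) * toTensor K V = 1 := by
  rw [sub_mul, one_mul, prTensor_mul_toTensor, sub_sub_cancel]

end ConvolutionInverse

/-! ### Maps into `QSh(V)` are determined by their letters -/

section Uniqueness

variable {K V : Type*} [CommRing K] [NonUnitalCommRing V] [Module K V]
  [IsScalarTower K V V] [SMulCommClass K V V]
variable {C A : Type*} [AddCommGroup C] [Module K C] [Coalgebra K C] [CommRing A] [Algebra K A]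

/-- A linear map `F : C → QSh(V) ⊗ A` which is compatible with the coproducts and the counits. -/
structure IsComultiplicative (F : C →ₗ[K] QSh K V ⊗[K] A) : Prop where
  comul : ∀ x, (deconc K V).rTensor A (F x) =
    m1324 K _ A (TensorProduct.map F F (Coalgebra.comul (R := K) x))
  counit : ∀ x, TensorProduct.lid K A ((counitL K V).rTensor A (F x)) =
    algebraMap K A (Coalgebra.counit x)

/-- `a ↦ (a ⊗ Id) ∘ F`, between convolution algebras. -/
noncomputable def pushConv (F : C →ₗ[K] QSh K V ⊗[K] A)
    (a : WithConv (QSh K V →ₗ[K] TensorAlgebra K V)) :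
    WithConv (C →ₗ[K] TensorAlgebra K V ⊗[K] A) :=
  toConv (a.ofConv.rTensor A ∘ₗ F)

theorem pushConv_apply (F : C →ₗ[K] QSh K V ⊗[K] A)
    (a : WithConv (QSh K V →ₗ[K] TensorAlgebra K V)) (x : C) :
    pushConv F a x = a.ofConv.rTensor A (F x) := rfl

theorem pushConv_sub (F : C →ₗ[K] QSh K V ⊗[K] A)
    (a b : WithConv (QSh K V →ₗ[K] TensorAlgebra K V)) :
    pushConv F (a - b) = pushConv F a - pushConv F b := by
  ext x
  change (a.ofConv - b.ofConv).rTensor A (F x) = _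
  rw [LinearMap.rTensor_sub]
  rfl

theorem IsComultiplicative.pushConv_one {F : C →ₗ[K] QSh K V ⊗[K] A} (hF : IsComultiplicative F) :
    pushConv F 1 = 1 := by
  ext x
  have aux : ∀ t : QSh K V ⊗[K] A, (Algebra.linearMap K (TensorAlgebra K V) ∘ₗ
      counitL K V).rTensor A t =
        1 ⊗ₜ (TensorProduct.lid K A ((counitL K V).rTensor A t)) := by
    intro t
    induction t with
    | zero => simp
    | add a b ha hb => simp only [map_add, TensorProduct.tmul_add, ha, hb]
    | tmul u c =>
      simp [Algebra.algebraMap_eq_smul_one, TensorProduct.smul_tmul]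
  refine (aux (F x)).trans ?_
  rw [hF.counit, LinearMap.convOne_apply, Algebra.algebraMap_eq_smul_one,
    TensorProduct.tmul_smul, Algebra.algebraMap_eq_smul_one]
  rfl

/-- Splitting the word in `F(x)` amounts to splitting `x` and multiplying the two `A`-components
through `m1324`; the latter is how `T(V) ⊗ A` multiplies its second legs. Hence `pushConv F` is a
morphism of convolution algebras. -/
theorem IsComultiplicative.pushConv_mul {F : C →ₗ[K] QSh K V ⊗[K] A} (hF : IsComultiplicative F)
    (a b : WithConv (QSh K V →ₗ[K] TensorAlgebra K V)) :
    pushConv F (a * b) = pushConv F a * pushConv F b := by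
  ext x
  have aux : ∀ s t : QSh K V ⊗[K] A,
      (LinearMap.mul' K _ ∘ₗ TensorProduct.map a.ofConv b.ofConv).rTensor A
        (m1324 K (QSh K V) A (s ⊗ₜ t)) = a.ofConv.rTensor A s * b.ofConv.rTensor A t := by
    intro s t
    induction s with
    | zero => simp
    | add a b ha hb => simp only [map_add, TensorProduct.add_tmul, add_mul, ha, hb]
    | tmul u c =>
    induction t with
    | zero => simp
    | add a b ha hb => simp only [map_add, TensorProduct.tmul_add, mul_add, ha, hb]
    | tmul v d => simp
  have h1 : pushConv F (a * b) x = (LinearMap.mul' K _ ∘ₗ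
      TensorProduct.map a.ofConv b.ofConv).rTensor A ((deconc K V).rTensor A (F x)) := by
    rw [← LinearMap.rTensor_comp_apply]
    rfl
  rw [h1, hF.comul, LinearMap.convMul_apply]
  induction Coalgebra.comul (R := K) x with
  | zero => simp
  | add a b ha hb => simp only [map_add, ha, hb]
  | tmul y z =>
    rw [TensorProduct.map_tmul, aux]
    rfl

/-- A comultiplicative map `F : C → QSh(V) ⊗ A` is determined by its projection to `V ⊗ A`. -/
theorem IsComultiplicative.ext {F G : C →ₗ[K] QSh K V ⊗[K] A} (hF : IsComultiplicative F)
    (hG : IsComultiplicative G) (h : ∀ x, (pr K V).rTensor A (F x) = (pr K V).rTensor A (G x)) :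
    F = G := by
  have hp : pushConv F (prTensor K V) = pushConv G (prTensor K V) := by
    ext x
    simp only [pushConv_apply, prTensor, ofConv_toConv, LinearMap.rTensor_comp_apply, h]
  have h1 := congrArg (pushConv F) (toTensor_mul_one_sub (K := K) (V := V))
  have h2 := congrArg (pushConv G) (one_sub_mul_toTensor (K := K) (V := V))
  rw [hF.pushConv_mul, pushConv_sub, hF.pushConv_one, hp] at h1
  rw [hG.pushConv_mul, pushConv_sub, hG.pushConv_one] at h2
  -- The images of `toTensor` under `F` and `G` are a left and a right inverse of one and the same
  -- element, `1` minus the common image of `prTensor`.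
  have h3 := left_inv_eq_right_inv h1 h2
  ext x
  have h4 := congrArg (fun a => a.ofConv x) h3
  -- Identifying `T(V)` with `QSh(V)` again recovers `F` and `G` from the images of `toTensor`.
  have h5 : ∀ t : QSh K V ⊗[K] A, (ofTensorAlgebra K V).toLinearMap.rTensor A
      ((toTensor K V).ofConv.rTensor A t) = t := by
    intro t
    rw [← LinearMap.rTensor_comp_apply]
    exact LinearMap.rTensor_id_apply _ _ t
  have h6 := congrArg ((ofTensorAlgebra K V).toLinearMap.rTensor A) h4
  exact (h5 (F x)).symm.trans (h6.trans (h5 (G x)))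

/-- A coalgebra morphism to `QSh(V)` is determined by its projection to `V`. -/
theorem coalgHom_ext {F G : C →ₗc[K] QSh K V} (h : ∀ x, pr K V (F x) = pr K V (G x)) : F = G := by
  have hp : (prTensor K V).ofConv ∘ₗ F.toLinearMap = (prTensor K V).ofConv ∘ₗ G.toLinearMap := by
    ext x
    exact congrArg (TensorAlgebra.ι K) (h x)
  -- Composition with a coalgebra morphism preserves the convolution unit; as it also preserves
  -- products, the uniqueness of inverses applies as in `IsComultiplicative.ext`.
  have h0 : ∀ F : C →ₗc[K] QSh K V,
      (1 : WithConv (QSh K V →ₗ[K] TensorAlgebra K V)).ofConv ∘ₗ F.toLinearMap =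
        (1 : WithConv (C →ₗ[K] TensorAlgebra K V)).ofConv := by
    intro F
    ext x
    change algebraMap K _ (Coalgebra.counit (R := K) (F x)) = algebraMap K _ (Coalgebra.counit x)
    rw [CoalgHomClass.counit_comp_apply]
  have h1 := congrArg (fun a => a.ofConv ∘ₗ F.toLinearMap) (toTensor_mul_one_sub (K := K) (V := V))
  have h2 := congrArg (fun a => a.ofConv ∘ₗ G.toLinearMap) (one_sub_mul_toTensor (K := K) (V := V))
  simp only [LinearMap.convMul_comp_coalgHom_distrib, h0, ofConv_sub, LinearMap.sub_comp, hp] at h1 h2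
  have h3 := left_inv_eq_right_inv (ofConv_injective h1) (ofConv_injective h2)
  ext x
  exact (ofTensorAlgebra K V).symm.injective (congrArg (fun a => a.ofConv x) h3)

end Uniqueness

end QSh

/-! ### Geometric series in a convolution algebra -/

section ConvolutionPowers

variable {K C R : Type*} [CommRing K] [AddCommGroup C] [Module K C] [Coalgebra K C] [Ring R]
  [Algebra K R]

/-- The geometric series of a locally nilpotent element of a convolution algebra. -/
theorem exists_conv_inverse (a : WithConv (C →ₗ[K] R))
    (ha : ∀ x, ∃ N, ∀ n, N ≤ n → (a ^ n) x = 0) :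
    ∃ s : WithConv (C →ₗ[K] R), s * (1 - a) = 1 ∧ (1 - a) * s = 1 ∧
      ∀ x N, (∀ n, N ≤ n → (a ^ n) x = 0) → s x = ∑ n ∈ Finset.range N, (a ^ n) x := by
  have hfin : ∀ x N, (∀ n, N ≤ n → (a ^ n) x = 0) →
      (Function.support fun n => (a ^ n) x) ⊆ (Finset.range N : Finset ℕ) := by
    intro x N h n hn
    rw [Finset.coe_range]
    by_contra hN
    exact hn (h n (not_lt.mp hN))
  have hfin' : ∀ x, (Function.support fun n => (a ^ n) x).Finite := by
    intro x
    obtain ⟨N, hN⟩ := ha x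
    exact (Finset.finite_toSet _).subset (hfin x N hN)
  -- The sum is finite at each point, with a bound that depends on the point; linearity uses the
  -- finiteness of the supports at all the points involved.
  let s : C →ₗ[K] R :=
    { toFun := fun x => ∑ᶠ n, (a ^ n) x
      map_add' := fun x y => by
        rw [← finsum_add_distrib (hfin' x) (hfin' y)]
        exact finsum_congr fun n => (a ^ n).ofConv.map_add x y
      map_smul' := fun r x => by
        rw [RingHom.id_apply, smul_finsum' r (hfin' x)]
        exact finsum_congr fun n => (a ^ n).ofConv.map_smul r x }
  have hs : ∀ x N, (∀ n, N ≤ n → (a ^ n) x = 0) → s x = ∑ n ∈ Finset.range N, (a ^ n) x :=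
    fun x N h => finsum_eq_sum_of_support_subset _ (hfin x N h)
  have hS : ∀ x, ∃ N, ∀ n, N ≤ n → s x = (∑ i ∈ Finset.range n, a ^ i).ofConv x := by
    intro x
    obtain ⟨N, hN⟩ := ha x
    refine ⟨N, fun n hn => ?_⟩
    rw [hs x n (fun m hm => hN m (hn.trans hm)), ofConv_sum, LinearMap.sum_apply]
  -- A tensor involves finitely many elements of `C`, so on it the series agrees with all long
  -- enough partial sums. This reduces a convolution product with the series to one with a
  -- polynomial in `a`.
  have hl : ∀ t : C ⊗[K] C, ∃ N, ∀ n, N ≤ n → TensorProduct.map s a.ofConv t =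
      TensorProduct.map (∑ i ∈ Finset.range n, a ^ i).ofConv a.ofConv t := by
    intro t
    induction t with
    | zero => exact ⟨0, fun n _ => by simp⟩
    | add t u ht hu =>
      obtain ⟨N, hN⟩ := ht
      obtain ⟨M, hM⟩ := hu
      exact ⟨max N M, fun n hn => by
        rw [map_add, map_add, hN n (le_trans (le_max_left _ _) hn),
          hM n (le_trans (le_max_right _ _) hn)]⟩
    | tmul x y =>
      obtain ⟨N, hN⟩ := hS x
      exact ⟨N, fun n hn => by rw [TensorProduct.map_tmul, TensorProduct.map_tmul, hN n hn]⟩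
  have hr : ∀ t : C ⊗[K] C, ∃ N, ∀ n, N ≤ n → TensorProduct.map a.ofConv s t =
      TensorProduct.map a.ofConv (∑ i ∈ Finset.range n, a ^ i).ofConv t := by
    intro t
    induction t with
    | zero => exact ⟨0, fun n _ => by simp⟩
    | add t u ht hu =>
      obtain ⟨N, hN⟩ := ht
      obtain ⟨M, hM⟩ := hu
      exact ⟨max N M, fun n hn => by
        rw [map_add, map_add, hN n (le_trans (le_max_left _ _) hn),
          hM n (le_trans (le_max_right _ _) hn)]⟩
    | tmul x y =>
      obtain ⟨N, hN⟩ := hS y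
      exact ⟨N, fun n hn => by rw [TensorProduct.map_tmul, TensorProduct.map_tmul, hN n hn]⟩
  refine ⟨toConv s, ?_, ?_, hs⟩
  · rw [mul_sub, mul_one, sub_eq_iff_eq_add']
    ext x
    obtain ⟨N, hN⟩ := hS x
    obtain ⟨M, hM⟩ := hl (Coalgebra.comul x)
    have h1 : (toConv s * a).ofConv x = ((∑ i ∈ Finset.range (max N M), a ^ i) * a).ofConv x :=
      congrArg (LinearMap.mul' K R) (hM _ (le_max_right _ _))
    -- One more term is taken for `s` than inside `s * a`: multiplication by `a` shifts the powers
    -- by one, and the zeroth power is the remaining `1`.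
    have h2 := congrArg (fun b => b.ofConv x) (Finset.sum_range_succ' (fun i => a ^ i) (max N M))
    refine (hN (max N M + 1) (by omega)).trans (h2.trans ?_)
    simp only [pow_succ, ← Finset.sum_mul, pow_zero]
    exact congrArg (· + _) h1.symm
  · rw [sub_mul, one_mul, sub_eq_iff_eq_add']
    ext x
    obtain ⟨N, hN⟩ := hS x
    obtain ⟨M, hM⟩ := hr (Coalgebra.comul x)
    have h1 : (a * toConv s).ofConv x = (a * (∑ i ∈ Finset.range (max N M), a ^ i)).ofConv x :=
      congrArg (LinearMap.mul' K R) (hM _ (le_max_right _ _))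
    have h2 := congrArg (fun b => b.ofConv x) (Finset.sum_range_succ' (fun i => a ^ i) (max N M))
    refine (hN (max N M + 1) (by omega)).trans (h2.trans ?_)
    simp only [pow_succ', ← Finset.mul_sum, pow_zero]
    exact congrArg (· + _) h1.symm

end ConvolutionPowers

/-! ### Iterated reduced coproducts as convolution powers -/

section IteratedCoproducts

variable {K B M : Type*} [CommRing K] [Ring B] [Bialgebra K B] [AddCommGroup M] [Module K M]

theorem conv_pow_succ_one {R : Type*} [Ring R] [Algebra K R] (a : WithConv (B →ₗ[K] R))
    (ha : a 1 = 0) (n : ℕ) : (a ^ (n + 1)) 1 = 0 := by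
  rw [pow_succ, LinearMap.convMul_apply, Bialgebra.comul_one, Algebra.TensorProduct.one_def,
    TensorProduct.map_tmul, LinearMap.mul'_apply]
  exact (congrArg _ ha).trans (mul_zero _)

theorem TensorPower.toTensorAlgebra_map {M' : Type*} [AddCommGroup M'] [Module K M']
    (f : M →ₗ[K] M') {n : ℕ} (a : ⨂[K]^n M) :
    TensorPower.toTensorAlgebra (PiTensorProduct.map (fun _ => f) a) =
      TensorAlgebra.lift K (TensorAlgebra.ι K ∘ₗ f) (TensorPower.toTensorAlgebra a) := by
  induction a using PiTensorProduct.induction_on with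
  | smul_tprod r x =>
    rw [map_smul, map_smul, map_smul, map_smul, PiTensorProduct.map_tprod,
      TensorPower.toTensorAlgebra_tprod, TensorPower.toTensorAlgebra_tprod,
      TensorAlgebra.tprod_apply, TensorAlgebra.tprod_apply, map_list_prod, List.map_ofFn]
    simp [Function.comp_def]
  | add a b ha hb => simp only [map_add, ha, hb]

theorem TensorPower.toTensorAlgebra_mulEquiv {n m : ℕ} (a : ⨂[K]^n M) (b : ⨂[K]^m M) :
    TensorPower.toTensorAlgebra (TensorPower.mulEquiv (a ⊗ₜ[K] b)) =
      TensorPower.toTensorAlgebra a * TensorPower.toTensorAlgebra b :=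
  TensorPower.toTensorAlgebra_gMul a b

theorem TensorPower.toTensorAlgebra_subsingletonEquiv_symm (x : M) :
    TensorPower.toTensorAlgebra ((PiTensorProduct.subsingletonEquiv (R := K) (s := fun _ => M)
      (0 : Fin 1)).symm x) = TensorAlgebra.ι K x := by
  rw [PiTensorProduct.subsingletonEquiv_symm_apply]
  simp [TensorPower.toTensorAlgebra_tprod, TensorAlgebra.tprod_apply]

/-- `T(M)` is the direct sum of the tensor powers of `M`. So the vanishing of `Δ̃⁽ⁿ⁾(x)` can be
tested in `T(B)`, where these elements are values of convolution powers. -/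
theorem TensorPower.toTensorAlgebra_injective (n : ℕ) : Function.Injective
    (TensorPower.toTensorAlgebra : ⨂[K]^n M →ₗ[K] TensorAlgebra K M) := by
  intro a b h
  have e : ∀ a : ⨂[K]^n M, TensorAlgebra.ofDirectSum (DirectSum.of (fun n => ⨂[K]^n M) n a) =
      TensorPower.toTensorAlgebra a := fun a =>
    DirectSum.toAddMonoid_of
      (fun _ => LinearMap.toAddMonoidHom TensorPower.toTensorAlgebra) _ _
  rw [← e, ← e] at h
  have h2 := congrArg TensorAlgebra.toDirectSum h
  rw [TensorAlgebra.toDirectSum_ofDirectSum, TensorAlgebra.toDirectSum_ofDirectSum] at h2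
  exact DirectSum.of_injective n h2

theorem toTensorAlgebra_iterReducedComul_zero (x : B) :
    TensorPower.toTensorAlgebra (iterReducedComul K B 0 x) = TensorAlgebra.ι K x :=
  TensorPower.toTensorAlgebra_subsingletonEquiv_symm x

variable (K) in
/-- A linear map `f`, with values in `T(M)`, as an element of the convolution algebra. -/
noncomputable def letterConv (f : B →ₗ[K] M) : WithConv (B →ₗ[K] TensorAlgebra K M) :=
  toConv (TensorAlgebra.ι K ∘ₗ f)

theorem letterConv_apply (f : B →ₗ[K] M) (x : B) : letterConv K f x = TensorAlgebra.ι K (f x) := rfl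

theorem letterConv_one (f : B →ₗ[K] M) (hf : f 1 = 0) : letterConv K f 1 = 0 := by
  rw [letterConv_apply, hf, map_zero]

/-- If `f(1) = 0`, then `f^{⊗(n+1)} ∘ Δ̃⁽ⁿ⁾` is a convolution power for the full coproduct. -/
theorem toTensorAlgebra_map_iterReducedComul (f : B →ₗ[K] M) (hf : f 1 = 0) (n : ℕ) (x : B) :
    TensorPower.toTensorAlgebra (PiTensorProduct.map (fun _ => f) (iterReducedComul K B n x)) =
      (letterConv K f ^ (n + 1)) x := by
  have h1 := conv_pow_succ_one _ (letterConv_one f hf)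
  induction n generalizing x with
  | zero =>
    rw [TensorPower.toTensorAlgebra_map, toTensorAlgebra_iterReducedComul_zero, zero_add, pow_one, letterConv_apply]
    simp
  | succ n ih =>
    have aux : ∀ t : B ⊗[K] B, TensorPower.toTensorAlgebra (PiTensorProduct.map (fun _ => f)
        (TensorPower.mulEquiv (TensorProduct.map (iterReducedComul K B n)
          (PiTensorProduct.subsingletonEquiv (R := K) (s := fun _ => B) (0 : Fin 1)).symm.toLinearMap
          t))) = LinearMap.mul' K _ (TensorProduct.map (letterConv K f ^ (n + 1)).ofConv
            (letterConv K f).ofConv t) := by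
      intro t
      induction t with
      | zero => simp only [map_zero]
      | add a b ha hb => simp only [map_add, ha, hb]
      | tmul y z =>
        rw [TensorProduct.map_tmul, TensorPower.toTensorAlgebra_map,
          TensorPower.toTensorAlgebra_mulEquiv, map_mul, ← TensorPower.toTensorAlgebra_map, ih,
          LinearEquiv.coe_coe, TensorPower.toTensorAlgebra_subsingletonEquiv_symm,
          TensorProduct.map_tmul, LinearMap.mul'_apply]
        simp [letterConv]
    -- The terms `x ⊗ 1` and `1 ⊗ x` which separate `Δ̃` from `Δ` do not contribute, because `f` and
    -- its convolution powers of positive exponent vanish at `1`.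
    have h2 : (letterConv K f).ofConv 1 = 0 := letterConv_one f hf
    have h3 : (letterConv K f ^ (n + 1)).ofConv 1 = 0 := h1 n
    refine (aux _).trans ?_
    rw [reducedComul, LinearMap.sub_apply, LinearMap.sub_apply, map_sub, map_sub, map_sub, map_sub,
      LinearMap.flip_apply, TensorProduct.mk_apply, TensorProduct.mk_apply, TensorProduct.map_tmul,
      TensorProduct.map_tmul, h2, h3, TensorProduct.tmul_zero, TensorProduct.zero_tmul, map_zero,
      sub_zero, sub_zero, pow_succ _ (n + 1), LinearMap.convMul_apply]

/-! ### Reduction to the augmentation ideal and consequences of connectedness -/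

variable (K B) in
/-- The projection `x ↦ x - ε(x) 1` onto the augmentation ideal. -/
noncomputable def augProj : B →ₗ[K] B :=
  LinearMap.id - (Coalgebra.counit (R := K) (A := B)).smulRight 1

theorem augProj_apply (x : B) : augProj K B x = x - Coalgebra.counit (R := K) x • 1 := rfl

theorem augProj_one : augProj K B 1 = 0 := by
  rw [augProj_apply, Bialgebra.counit_one, one_smul, sub_self]

theorem counit_augProj (x : B) : Coalgebra.counit (R := K) (augProj K B x) = 0 := by
  rw [augProj_apply, map_sub, map_smul, Bialgebra.counit_one, smul_eq_mul, mul_one, sub_self]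

/-- The projection changes `x` only by a multiple of `1`. This removes or inserts the projection in
front of any map that vanishes at `1`. -/
theorem apply_augProj {N : Type*} [AddCommGroup N] [Module K N] (u : B →ₗ[K] N) (hu : u 1 = 0)
    (x : B) : u (augProj K B x) = u x := by
  rw [augProj_apply, map_sub, map_smul, hu, smul_zero, sub_zero]

/-- With `π = Id - ε(·)1`, expanding `(π ⊗ π) ∘ Δ` and using the counit axioms gives `Δ̃(x) + ε(x) 1
⊗ 1`. In this form both legs of `Δ̃(x)` visibly lie in the augmentation ideal, as inductions on
`Δ̃⁽ⁿ⁾` need. -/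
theorem reducedComul_eq (x : B) (hx : Coalgebra.counit (R := K) x = 0) :
    reducedComul K B x = TensorProduct.map (augProj K B) (augProj K B) (Coalgebra.comul x) := by
  have aux : ∀ t : B ⊗[K] B, TensorProduct.map (augProj K B) (augProj K B) t =
      t - (TensorProduct.rid K B ((Coalgebra.counit (R := K) (A := B)).lTensor B t)) ⊗ₜ 1 -
        1 ⊗ₜ (augProj K B (TensorProduct.lid K B
          ((Coalgebra.counit (R := K) (A := B)).rTensor B t))) := by
    intro t
    induction t with
    | zero => simp
    | add a b ha hb =>
      simp only [map_add, ha, hb, TensorProduct.add_tmul, TensorProduct.tmul_add]; abel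
    | tmul y z =>
      simp only [TensorProduct.map_tmul, LinearMap.lTensor_tmul, LinearMap.rTensor_tmul,
        TensorProduct.lid_tmul, TensorProduct.rid_tmul, map_smul]
      rw [TensorProduct.tmul_smul, ← TensorProduct.smul_tmul', TensorProduct.smul_tmul',
        TensorProduct.smul_tmul', augProj_apply y, TensorProduct.sub_tmul, augProj_apply z,
        TensorProduct.tmul_sub, TensorProduct.tmul_smul, TensorProduct.smul_tmul']
  rw [aux, Coalgebra.lTensor_counit_comul, Coalgebra.rTensor_counit_comul, TensorProduct.lid_tmul,
    TensorProduct.rid_tmul, one_smul, augProj_apply, hx, zero_smul, sub_zero]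
  rfl

/-- On the augmentation ideal, `Δ̃⁽ⁿ⁾` is a convolution power. -/
theorem toTensorAlgebra_iterReducedComul (n : ℕ) (x : B) (hx : Coalgebra.counit (R := K) x = 0) :
    TensorPower.toTensorAlgebra (iterReducedComul K B n x) =
      (letterConv K (augProj K B) ^ (n + 1)) x := by
  have h0 := letterConv_one (augProj K B) augProj_one
  induction n generalizing x with
  | zero =>
    rw [toTensorAlgebra_iterReducedComul_zero, zero_add, pow_one, letterConv_apply,
      augProj_apply, hx, zero_smul, sub_zero]
  | succ n ih =>
    -- The induction hypothesis holds only on the augmentation ideal, so it is applied after `π ⊗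
    -- π`, which `reducedComul_eq` allows.
    have aux : ∀ t : B ⊗[K] B, TensorPower.toTensorAlgebra
        (TensorPower.mulEquiv (TensorProduct.map (iterReducedComul K B n)
          (PiTensorProduct.subsingletonEquiv (R := K) (s := fun _ => B) (0 : Fin 1)).symm.toLinearMap
          (TensorProduct.map (augProj K B) (augProj K B) t))) =
        LinearMap.mul' K _ (TensorProduct.map (letterConv K (augProj K B) ^ (n + 1)).ofConv
            (letterConv K (augProj K B)).ofConv t) := by
      intro t
      induction t with
      | zero => simp only [map_zero]
      | add a b ha hb => simp only [map_add, ha, hb]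
      | tmul y z =>
        rw [TensorProduct.map_tmul, TensorProduct.map_tmul,
          TensorPower.toTensorAlgebra_mulEquiv, ih _ (counit_augProj y),
          LinearEquiv.coe_coe, TensorPower.toTensorAlgebra_subsingletonEquiv_symm,
          TensorProduct.map_tmul, LinearMap.mul'_apply]
        -- In the left factor the projection can be dropped, since the convolution power vanishes at
        -- `1`; in the last letter it is part of `letterConv`.
        exact congrArg (· * _)
          (apply_augProj (letterConv K (augProj K B) ^ (n + 1)).ofConv (conv_pow_succ_one _ h0 n) y)
    have h := aux (Coalgebra.comul x)
    rw [← reducedComul_eq x hx] at h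
    rw [pow_succ]
    exact h

/-- Replacing the first letter of a word by a tensor. -/
theorem TensorAlgebra.exists_map_ι_mul (u : M →ₗ[K] TensorAlgebra K M) :
    ∃ D : TensorAlgebra K M →ₗ[K] TensorAlgebra K M,
      ∀ x w, D (TensorAlgebra.ι K x * w) = u x * w := by
  -- A recursion on words whose recursive term is zero: it looks at the first letter only. The value
  -- at the empty word plays no role and is set to `0`.
  refine ⟨QSh.recLin 0 ((LinearMap.mul K (TensorAlgebra K M)).compl₁₂ u
    (QSh.ofTensorAlgebra K M).symm.toLinearMap) 0 ∘ₗ (QSh.ofTensorAlgebra K M).toLinearMap,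
    fun x w => ?_⟩
  have h := QSh.recLin_cons 0 ((LinearMap.mul K (TensorAlgebra K M)).compl₁₂ u
    (QSh.ofTensorAlgebra K M).symm.toLinearMap) 0 x (QSh.ofTensorAlgebra K M w)
  refine h.trans ?_
  simp

/-- With `π` the letter map of the augmentation projection, `π^{n+2} = π² * πⁿ` is obtained from
`π^{n+1} = π * πⁿ` by replacing each first letter `y` by `(π * π)(y)`. This is `Δ̃⁽ⁿ⁺¹⁾ = (Δ̃ ⊗ Id)
∘ Δ̃⁽ⁿ⁾`, with `Δ̃` on the first leg, whereas the definition expands `Δ̃(x)` from the outside.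
Coassociativity enters as the associativity of convolution. -/
theorem conv_pow_eq_zero_succ (n : ℕ) (x : B)
    (h : (letterConv K (augProj K B) ^ (n + 1)) x = 0) :
    (letterConv K (augProj K B) ^ (n + 1 + 1)) x = 0 := by
  obtain ⟨D, hD⟩ := TensorAlgebra.exists_map_ι_mul
    (letterConv K (augProj K B) * letterConv K (augProj K B)).ofConv
  have h0 := letterConv_one (augProj K B) augProj_one
  have h1 := conv_pow_succ_one _ h0 1
  rw [pow_succ, pow_one] at h1
  have key : ∀ t : B ⊗[K] B, D (LinearMap.mul' K _ (TensorProduct.map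
      (letterConv K (augProj K B)).ofConv (letterConv K (augProj K B) ^ n).ofConv t)) =
      LinearMap.mul' K _ (TensorProduct.map
        (letterConv K (augProj K B) * letterConv K (augProj K B)).ofConv
        (letterConv K (augProj K B) ^ n).ofConv t) := by
    intro t
    induction t with
    | zero => simp only [map_zero]
    | add a b ha hb => simp only [map_add, ha, hb]
    | tmul y z =>
      rw [TensorProduct.map_tmul, TensorProduct.map_tmul, LinearMap.mul'_apply,
        LinearMap.mul'_apply]
      -- The first letter seen by `D` is the projection of `y`, not `y`; the difference is harmless
      -- because `π * π` vanishes at `1`.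
      exact (hD (augProj K B y) _).trans (congrArg (· * _) (apply_augProj _ h1 y))
  rw [pow_succ'] at h
  rw [pow_succ', pow_succ', ← mul_assoc]
  exact (key _).symm.trans ((congrArg D h).trans (map_zero D))

/-- Once an iterated reduced coproduct of `x` vanishes, so do all later ones. Connectedness provides
a single such index for each element, while the convergence of the series needs all the later ones.
-/
theorem iterReducedComul_eq_zero_of_le {n m : ℕ} (hnm : n ≤ m) (x : B)
    (hx : Coalgebra.counit (R := K) x = 0) (h : iterReducedComul K B n x = 0) :
    iterReducedComul K B m x = 0 := by
  induction m, hnm using Nat.le_induction with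
  | base => exact h
  | succ m _ ih =>
    apply TensorPower.toTensorAlgebra_injective
    rw [map_zero, toTensorAlgebra_iterReducedComul _ _ hx]
    apply conv_pow_eq_zero_succ
    rw [← toTensorAlgebra_iterReducedComul _ _ hx, ih, map_zero]

/-- Connectedness as local nilpotency for convolution. An arbitrary `x` can be replaced by its
projection to `ker ε`, since positive powers of `f` vanish at `1`; there the powers factor through
`Δ̃⁽ⁿ⁾`. -/
theorem IsConnectedBialgebra.exists_conv_pow_eq_zero (hB : IsConnectedBialgebra K B)
    (f : B →ₗ[K] M) (hf : f 1 = 0) (x : B) :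
    ∃ N, ∀ n, N ≤ n → (letterConv K f ^ n) x = 0 := by
  obtain ⟨N, hN⟩ := hB _ (counit_augProj x)
  -- `Δ̃⁽ᴺ⁾` has `N + 1` legs and so governs the power of exponent `N + 1`.
  refine ⟨N + 1, fun n hn => ?_⟩
  obtain ⟨m, rfl⟩ := Nat.exists_eq_add_of_le' hn
  have h1 : (letterConv K f ^ (m + N + 1)).ofConv (augProj K B x) = _ :=
    apply_augProj _ (conv_pow_succ_one _ (letterConv_one f hf) (m + N)) x
  have h2 := toTensorAlgebra_map_iterReducedComul f hf (m + N) (augProj K B x)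
  rw [iterReducedComul_eq_zero_of_le (Nat.le_add_left N m) _ (counit_augProj x) hN, map_zero,
    map_zero] at h2
  exact h1.symm.trans h2.symm

end IteratedCoproducts

/-- Solves the linear equation `(1 - j ∘ a) * d = e`: composition with the algebra morphism `j`
preserves convolution and its unit, so `j ∘ s` is a left inverse of `1 - j ∘ a`. In `deconc_ofConvL`
the map `j` puts `T(V)` in the left factor of `T(V) ⊗ T(V)`. -/
theorem conv_eq_mul_of_eq_add {K C R R' : Type*} [CommRing K] [AddCommGroup C] [Module K C]
    [Coalgebra K C] [Ring R] [Algebra K R] [Ring R'] [Algebra K R'] (j : R →ₐ[K] R')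
    {a s : WithConv (C →ₗ[K] R)} (hs : s * (1 - a) = 1) {d e : WithConv (C →ₗ[K] R')}
    (hd : d = e + toConv (j.toLinearMap ∘ₗ a.ofConv) * d) :
    d = toConv (j.toLinearMap ∘ₗ s.ofConv) * e := by
  have h1 : s = 1 + s * a := by rwa [mul_sub, mul_one, sub_eq_iff_eq_add] at hs
  have h2 : toConv (j.toLinearMap ∘ₗ s.ofConv) = 1 +
      toConv (j.toLinearMap ∘ₗ s.ofConv) * toConv (j.toLinearMap ∘ₗ a.ofConv) := by
    have h3 : toConv (j.toLinearMap ∘ₗ (1 : WithConv (C →ₗ[K] R)).ofConv) = 1 := by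
      ext x
      exact j.commutes _
    conv_lhs => rw [h1]
    rw [ofConv_add, LinearMap.comp_add, LinearMap.algHom_comp_convMul_distrib, toConv_add, h3,
      toConv_ofConv]
  have h3 := congrArg (· * d) h2
  have h4 := congrArg (toConv (j.toLinearMap ∘ₗ s.ofConv) * ·) hd
  simp only [add_mul, one_mul, mul_add, ← mul_assoc] at h3 h4
  exact add_right_cancel (h3.symm.trans h4)

namespace QSh

/-! ### Lifting a linear map `B → V` to a coalgebra morphism `B → QSh(V)` -/

section Lift

variable {K V B : Type*} [CommRing K] [NonUnitalCommRing V] [Module K V]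
  [IsScalarTower K V V] [SMulCommClass K V V] [Ring B] [Bialgebra K B]
  (f : B →ₗ[K] V) (s : WithConv (B →ₗ[K] TensorAlgebra K V))

/-- The map to `QSh(V)` given by a map to `T(V)`. -/
noncomputable def ofConvL : B →ₗ[K] QSh K V := (ofTensorAlgebra K V).toLinearMap ∘ₗ s.ofConv

theorem ofConvL_apply (x : B) : ofConvL s x = ofTensorAlgebra K V (s x) := rfl

theorem ofTensorAlgebra_one : ofTensorAlgebra K V 1 = 1 := rfl

variable (hs : (1 - letterConv K f) * s = 1)
include hs

/-- The identity `s = 1 + f * s` read in words, that is `φ(x) = ε(x) 1 + ∑ f(x')φ(x'')`. It exhibits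
the first letter, which is what the recursive definitions of the counit, `pr` and the
deconcatenation act upon. -/
theorem ofConvL_eq (x : B) : ofConvL s x = Coalgebra.counit (R := K) x • 1 +
    TensorProduct.lift (cons ∘ₗ f) ((ofConvL s).lTensor B (Coalgebra.comul x)) := by
  have h1 : s = 1 + letterConv K f * s := by rwa [sub_mul, one_mul, sub_eq_iff_eq_add] at hs
  have aux : ∀ t : B ⊗[K] B, ofTensorAlgebra K V (LinearMap.mul' K _
      (TensorProduct.map (letterConv K f).ofConv s.ofConv t)) =
      TensorProduct.lift (cons ∘ₗ f) ((ofConvL s).lTensor B t) := by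
    intro t
    induction t with
    | zero => simp
    | add a b ha hb => simp only [map_add, ha, hb]
    | tmul y z => rfl
  rw [← aux, ofConvL_apply]
  have h2 : s x = algebraMap K _ (Coalgebra.counit x) + (letterConv K f * s) x :=
    congrArg (fun a => a.ofConv x) h1
  rw [h2, map_add, Algebra.algebraMap_eq_smul_one, map_smul, ofTensorAlgebra_one]
  rfl

theorem counitL_ofConvL (x : B) : counitL K V (ofConvL s x) = Coalgebra.counit x := by
  have aux : ∀ t : B ⊗[K] QSh K V, counitL K V (TensorProduct.lift (cons ∘ₗ f) t) = 0 := by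
    intro t
    induction t with
    | zero => simp
    | add a b ha hb => simp only [map_add, ha, hb, add_zero]
    | tmul y z => simp
  rw [ofConvL_eq f s hs, map_add, aux, map_smul, counitL_one, smul_eq_mul, mul_one, add_zero]

theorem pr_ofConvL (x : B) : pr K V (ofConvL s x) = f x := by
  have aux : ∀ t : B ⊗[K] B, pr K V (TensorProduct.lift (cons ∘ₗ f) ((ofConvL s).lTensor B t)) =
      f (TensorProduct.rid K B ((Coalgebra.counit (R := K) (A := B)).lTensor B t)) := by
    intro t
    induction t with
    | zero => simp
    | add a b ha hb => simp only [map_add, ha, hb]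
    | tmul y z => simp [counitL_ofConvL f s hs]
  rw [ofConvL_eq f s hs, map_add, aux, map_smul, pr_one, smul_zero, zero_add,
    Coalgebra.lTensor_counit_comul, TensorProduct.rid_tmul, one_smul]

variable (hs' : s * (1 - letterConv K f) = 1)
include hs'

/-- Substituting `φ(x) = ε(x) 1 + ∑ f(x')φ(x'')` and using `Δ(vw) = 1 ⊗ vw + (v ⊗ 1)Δ(w)` shows that
`D = Δ ∘ φ` solves `D = (1 ⊗ φ) + (f ⊗ 1) * D`. Since `φ` inverts `1 - f`, the solution is `(φ ⊗ 1)
* (1 ⊗ φ)`, which is `(φ ⊗ φ) ∘ Δ`. -/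
theorem deconc_ofConvL (x : B) : deconc K V (ofConvL s x) =
    TensorProduct.map (ofConvL s) (ofConvL s) (Coalgebra.comul (R := K) x) := by
  -- The equation is solved in `T(V) ⊗ T(V)`, where prefixing a letter is a multiplication; the
  -- quasishuffle product plays no role here.
  let J : QSh K V ⊗[K] QSh K V ≃ₗ[K] TensorAlgebra K V ⊗[K] TensorAlgebra K V :=
    TensorProduct.congr (ofTensorAlgebra K V).symm (ofTensorAlgebra K V).symm
  let j₁ : TensorAlgebra K V →ₐ[K] TensorAlgebra K V ⊗[K] TensorAlgebra K V :=
    Algebra.TensorProduct.includeLeft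
  let j₂ : TensorAlgebra K V →ₐ[K] TensorAlgebra K V ⊗[K] TensorAlgebra K V :=
    Algebra.TensorProduct.includeRight
  let D : WithConv (B →ₗ[K] TensorAlgebra K V ⊗[K] TensorAlgebra K V) :=
    toConv (J.toLinearMap ∘ₗ deconc K V ∘ₗ ofConvL s)
  let S₁ : WithConv (B →ₗ[K] TensorAlgebra K V ⊗[K] TensorAlgebra K V) :=
    toConv (j₁.toLinearMap ∘ₗ s.ofConv)
  let S₂ : WithConv (B →ₗ[K] TensorAlgebra K V ⊗[K] TensorAlgebra K V) :=
    toConv (j₂.toLinearMap ∘ₗ s.ofConv)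
  let G₁ : WithConv (B →ₗ[K] TensorAlgebra K V ⊗[K] TensorAlgebra K V) :=
    toConv (j₁.toLinearMap ∘ₗ (letterConv K f).ofConv)
  have hJ : ∀ v t, J ((cons v).rTensor _ t) = j₁ (TensorAlgebra.ι K v) * J t := by
    intro v t
    induction t with
    | zero => simp
    | add a b ha hb => simp only [map_add, mul_add, ha, hb]
    | tmul y z =>
      simp only [J, j₁, LinearMap.rTensor_tmul, TensorProduct.congr_tmul, symm_cons,
        Algebra.TensorProduct.includeLeft_apply, Algebra.TensorProduct.tmul_mul_tmul, one_mul]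
  -- The two terms of the deconcatenation of a word with a first letter: either the cut is before
  -- that letter, or the letter stays in the left part. The empty-word terms `ε(x) 1 ⊗ 1` complete
  -- the first kind to `1 ⊗ φ(x)`.
  have h1 : D = S₂ + G₁ * D := by
    have aux : ∀ t : B ⊗[K] B,
        J (deconc K V (TensorProduct.lift (cons ∘ₗ f) ((ofConvL s).lTensor B t))) =
        J (1 ⊗ₜ TensorProduct.lift (cons ∘ₗ f) ((ofConvL s).lTensor B t)) +
          LinearMap.mul' K _ (TensorProduct.map G₁.ofConv D.ofConv t) := by
      intro t
      induction t with
      | zero => simp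
      | add a b ha hb =>
        simp only [map_add, ha, hb, TensorProduct.tmul_add]
        exact add_add_add_comm _ _ _ _
      | tmul y z =>
        rw [LinearMap.lTensor_tmul, TensorProduct.lift.tmul, LinearMap.comp_apply, deconc_cons,
          map_add, hJ, TensorProduct.map_tmul, LinearMap.mul'_apply]
        rfl
    ext x
    have h2 : D x = J (deconc K V (ofConvL s x)) := rfl
    have h3 : S₂ x = J (1 ⊗ₜ ofConvL s x) := rfl
    refine h2.trans ?_
    refine Eq.trans ?_ (congrArg (· + (G₁ * D) x) h3.symm)
    rw [ofConvL_eq f s hs x, map_add, map_add, map_smul, deconc_one, aux, TensorProduct.tmul_add,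
      map_add, TensorProduct.tmul_smul, LinearMap.convMul_apply, add_assoc]
  have h3 : D = S₁ * S₂ := conv_eq_mul_of_eq_add j₁ hs' h1
  have aux : ∀ t : B ⊗[K] B, LinearMap.mul' K _ (TensorProduct.map S₁.ofConv S₂.ofConv t) =
      J (TensorProduct.map (ofConvL s) (ofConvL s) t) := by
    intro t
    induction t with
    | zero => simp
    | add a b ha hb => simp only [map_add, ha, hb]
    | tmul y z =>
      simp [S₁, S₂, J, j₁, j₂, ofConvL, LinearEquiv.symm_apply_apply]
  apply J.injective
  exact (congrArg (fun a => a.ofConv x) h3).trans (aux _)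

/-- The coalgebra morphism `B → QSh(V)` which lifts `f : B → V`. -/
noncomputable def coalgLift : B →ₗc[K] QSh K V :=
  { ofConvL s with
    counit_comp := LinearMap.ext fun x => counitL_ofConvL f s hs x
    map_comp_comul := LinearMap.ext fun x => (deconc_ofConvL f s hs hs' x).symm }

theorem coalgLift_apply (x : B) : coalgLift f s hs hs' x = ofTensorAlgebra K V (s x) := rfl

theorem pr_coalgLift (x : B) : pr K V (coalgLift f s hs hs' x) = f x := pr_ofConvL f s hs x

end Lift

/-! ### The letter projection and the structure maps of `QSh(V)` -/

section LetterProjection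

variable {K V : Type*} [CommRing K] [NonUnitalCommRing V] [Module K V]
  [IsScalarTower K V V] [SMulCommClass K V V]

/-- In a quasishuffle of two nonempty words a one-letter word occurs only if both are letters, as
their product in `V`. Equivalently, `w ↦ ε(w) + pr(w)` is an algebra morphism to `uV`. -/
theorem pr_mul (u v : QSh K V) : pr K V (u * v) = pr K V u * pr K V v +
    counitL K V v • pr K V u + counitL K V u • pr K V v := by
  induction u using ind generalizing v with
  | hn => simp
  | hc x u ihu =>
    induction v using ind with
    | hn => simp
    | hc y v ihv =>
      simp [cons_mul_cons, counitL_mul, smul_mul_assoc, mul_smul_comm, mul_smul]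
      rw [smul_comm]
    | ha u v hu hv => simp only [hu, hv, mul_add, map_add, add_smul, smul_add]; abel
    | hs r u hu => simp only [hu, mul_smul_comm, map_smul, smul_add, smul_assoc, smul_comm r]
  | ha a b hu hv => simp only [hu, hv, add_mul, map_add, add_smul, smul_add]; abel
  | hs r u hu => simp only [hu, smul_mul_assoc, map_smul, smul_add, smul_assoc, smul_comm r]

variable [NonUnitalBialgebra K V]

/-- The coaction preserves the length of words and is `δ_V` on letters. -/
theorem pr_coactL (w : QSh K V) :
    (pr K V).rTensor _ (coactL K V w) = comulU K V (pr K V w) := by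
  have aux : ∀ (ζ : V ⊗[K] UExt K V) (t : QSh K V ⊗[K] UExt K V),
      (pr K V).rTensor _ (consA K V _ ζ t) =
        (LinearMap.mulRight K (TensorProduct.lid K _ ((counitL K V).rTensor _ t))).lTensor V ζ := by
    intro ζ t
    induction t with
    | zero => simp
    | add a b ha hb =>
      simp only [map_add, ha, hb]
      rw [← LinearMap.add_apply, ← LinearMap.lTensor_add]
      congr 2
      ext c
      simp [mul_add]
    | tmul u c =>
      induction ζ with
      | zero => simp
      | add a b ha hb => simp only [map_add, ha, hb, LinearMap.add_apply]
      | tmul x a => simp [TensorProduct.smul_tmul]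
  induction w using ind with
  | hn => simp [coactL]
  | hc x w ih =>
    have h := foldA_counitL (comulU K V) w
    rw [coactL, foldA_cons, aux, h, TensorProduct.lid_tmul, pr_cons, map_smul]
    induction comulU K V x with
    | zero => simp
    | add a b ha hb => simp only [map_add, smul_add, ha, hb]
    | tmul x a => simp
  | ha a b ha hb => simp only [map_add, ha, hb]
  | hs r u hu => simp only [map_smul, hu]

variable [Coalgebra.IsCocomm K V]

/-- In `QSh(V)`, the map `(ε_δ ⊗ Id) ∘ ρ` is the projection onto the letters. -/
theorem epsDeltaRho_eq_pr (w : QSh K V) : epsDeltaRho K V (QSh K V) w = pr K V w := by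
  have h0 : ∀ w : QSh K V, epsDeltaRho K V (QSh K V) w = UExt.snd K V (TensorProduct.lid K _
      ((epsDeltaL K V).rTensor _ (coactL K V w))) := fun w => rfl
  -- Of the two summands, `ε` gives a multiple of `1 ∈ uV`, which the projection to `V` kills; `ε_V
  -- ∘ pr` gives `(ε_V ⊗ Id) ∘ δ_V ∘ pr = pr`.
  have e : epsDeltaL K V = Coalgebra.counit (R := K) (A := V) ∘ₗ pr K V + counitL K V := by
    ext w; exact epsDeltaL_eq w
  have h1 := foldA_counitL (comulU K V) w
  have h2 : ∀ v : V, UExt.snd K V (TensorProduct.lid K _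
      ((Coalgebra.counit (R := K) (A := V)).rTensor _ (comulU K V v))) = v := by
    intro v
    rw [comulU, LinearMap.comp_apply, ← lTensor_rTensor', Coalgebra.rTensor_counit_comul]
    simp
  rw [h0, e, LinearMap.rTensor_add, LinearMap.add_apply, LinearMap.rTensor_comp,
    LinearMap.comp_apply, pr_coactL, map_add, map_add, h2, coactL, h1, TensorProduct.lid_tmul,
    map_smul, UExt.snd_one, smul_zero, add_zero]

end LetterProjection

end QSh

/-! ### The map `(ε_δ ⊗ Id) ∘ ρ` on a double bialgebra over `V` -/

section Character

variable {K V B : Type*} [CommRing K] [NonUnitalCommRing V] [Module K V]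
  [IsScalarTower K V V] [SMulCommClass K V V] [NonUnitalBialgebra K V]
  [Ring B] [Bialgebra K B] [DoubleBialgebra K B] [DoubleBialgebraOver K V B]

variable (K V B) in
/-- `(ε_δ ⊗ Id) ∘ ρ : B → uV`, as an algebra morphism. -/
noncomputable def epsDeltaRhoU : B →ₐ[K] UExt K V :=
  (Algebra.TensorProduct.lid K (UExt K V)).toAlgHom.comp
    ((Algebra.TensorProduct.map (DoubleBialgebra.epsDelta (K := K) (B := B))
      (AlgHom.id K (UExt K V))).comp (BialgebraOver.rho (K := K) (W := UExt K V) (B := B)))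

theorem epsDeltaRhoU_apply (x : B) : epsDeltaRhoU K V B x = TensorProduct.lid K (UExt K V)
    ((DoubleBialgebra.epsDelta (K := K) (B := B)).toLinearMap.rTensor (UExt K V)
      (BialgebraOver.rho (K := K) (W := UExt K V) x)) := rfl

theorem snd_epsDeltaRhoU (x : B) : UExt.snd K V (epsDeltaRhoU K V B x) = epsDeltaRho K V B x := rfl

theorem epsDeltaRho_one : epsDeltaRho K V B 1 = 0 := by
  rw [← snd_epsDeltaRhoU, map_one, UExt.snd_one]

/-- The decomposition along `uV = K ⊕ V`: the unit goes to the unit, and the augmentation ideal goes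
into `V` because `ρ(ker ε_Δ) ⊆ B ⊗ V`. -/
theorem epsDeltaRhoU_eq (x : B) : epsDeltaRhoU K V B x = Coalgebra.counit (R := K) x • 1 +
    UExt.inr K V (epsDeltaRho K V B x) := by
  have h := inr_epsDeltaRho K V B _ (counit_augProj (K := K) x)
  rw [← epsDeltaRhoU_apply, apply_augProj _ epsDeltaRho_one, augProj_apply, map_sub, map_smul,
    map_one] at h
  rw [h, add_sub_cancel]

/-- Multiplicativity of `ε_Δ + (ε_δ ⊗ Id) ∘ ρ` in `uV`, projected to `V`. It has the same shape as
`pr_mul`, and this match makes the lifted map multiplicative. -/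
theorem epsDeltaRho_mul (x y : B) : epsDeltaRho K V B (x * y) =
    epsDeltaRho K V B x * epsDeltaRho K V B y +
      Coalgebra.counit (R := K) y • epsDeltaRho K V B x +
      Coalgebra.counit (R := K) x • epsDeltaRho K V B y := by
  rw [← snd_epsDeltaRhoU, map_mul, epsDeltaRhoU_eq x, epsDeltaRhoU_eq y]
  simp only [mul_add, add_mul, smul_mul_assoc, mul_smul_comm, one_mul, mul_one, map_add, map_smul,
    UExt.snd_one, smul_zero, ← UExt.inr_mul, UExt.snd_inr]
  abel_nf

/-- The counit of `uV` cancels the coaction and leaves `ε_δ`; thus `ε_δ` can be recovered from `(ε_δ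
⊗ Id) ∘ ρ`. -/
theorem counit_epsDeltaRhoU (x : B) : Coalgebra.counit (R := K) (epsDeltaRhoU K V B x) =
    DoubleBialgebra.epsDelta (K := K) x := by
  have aux : ∀ t : B ⊗[K] UExt K V, Coalgebra.counit (R := K) (TensorProduct.lid K (UExt K V)
      ((DoubleBialgebra.epsDelta (K := K) (B := B)).toLinearMap.rTensor (UExt K V) t)) =
      DoubleBialgebra.epsDelta (K := K) (TensorProduct.rid K B
        ((Coalgebra.counit (R := K) (A := UExt K V)).lTensor B t)) := by
    intro t
    induction t with
    | zero => simp
    | add a b ha hb => simp only [map_add, ha, hb]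
    | tmul a v => simp [mul_comm]
  rw [epsDeltaRhoU_apply, aux, BialgebraOver.rho_counit]

/-- `((ε_δ ⊗ Id) ∘ ρ ⊗ Id) ∘ ρ = δ_V ∘ (ε_δ ⊗ Id) ∘ ρ`, in `V`. -/
theorem epsDeltaRho_rho (x : B) : (epsDeltaRho K V B).rTensor (UExt K V)
    (BialgebraOver.rho (K := K) (W := UExt K V) x) = QSh.comulU K V (epsDeltaRho K V B x) := by
  -- The inner `ρ` is made explicit, so that coassociativity can move the second coaction to a
  -- coproduct of `uV`. After that `ε_δ` acts alone on the first leg.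
  have h1 : ∀ t : B ⊗[K] UExt K V, (epsDeltaRho K V B).rTensor (UExt K V) t =
      (UExt.snd K V).rTensor _ (TensorProduct.lid K (UExt K V ⊗[K] UExt K V)
        ((DoubleBialgebra.epsDelta (K := K) (B := B)).toLinearMap.rTensor _
          (TensorProduct.assoc K _ _ _ ((BialgebraOver.rho (K := K) (W := UExt K V)
            (B := B)).toLinearMap.rTensor _ t)))) := by
    intro t
    induction t with
    | zero => simp
    | add a b ha hb => simp only [map_add, ha, hb]
    | tmul a v =>
      rw [LinearMap.rTensor_tmul, LinearMap.rTensor_tmul, ← snd_epsDeltaRhoU, epsDeltaRhoU_apply,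
        AlgHom.toLinearMap_apply]
      induction BialgebraOver.rho (K := K) (W := UExt K V) a with
      | zero => simp
      | add a b ha hb => simp only [map_add, TensorProduct.add_tmul, ha, hb]
      | tmul b u => simp [TensorProduct.smul_tmul']
  have h2 : ∀ t : B ⊗[K] UExt K V, TensorProduct.lid K (UExt K V ⊗[K] UExt K V)
      ((DoubleBialgebra.epsDelta (K := K) (B := B)).toLinearMap.rTensor _
        ((Coalgebra.comul (R := K) (A := UExt K V)).lTensor B t)) =
      Coalgebra.comul (R := K) (TensorProduct.lid K (UExt K V)
        ((DoubleBialgebra.epsDelta (K := K) (B := B)).toLinearMap.rTensor _ t)) := by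
    intro t
    induction t with
    | zero => simp
    | add a b ha hb => simp only [map_add, ha, hb]
    | tmul a v => simp
  have h3 : ∀ t : V ⊗[K] V, (UExt.snd K V).rTensor _
      (TensorProduct.map (UExt.inr K V) (UExt.inr K V) t) = (UExt.inr K V).lTensor V t := by
    intro t
    induction t with
    | zero => simp
    | add a b ha hb => simp only [map_add, ha, hb]
    | tmul a v => simp
  rw [h1, BialgebraOver.rho_coassoc, h2, ← epsDeltaRhoU_apply, epsDeltaRhoU_eq, map_add, map_smul,
    Bialgebra.comul_one, UExt.comul_inr, map_add, h3, map_smul, Algebra.TensorProduct.one_def,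
    LinearMap.rTensor_tmul, UExt.snd_one, TensorProduct.zero_tmul, smul_zero, zero_add]
  rfl

/-- `((ε_δ ⊗ Id) ∘ ρ ⊗ Id) ∘ δ = c ∘ ρ`, in `V`. -/
theorem epsDeltaRho_delta (x : B) : (epsDeltaRho K V B).rTensor B
    (DoubleBialgebra.delta (K := K) x) =
      QSh.sndComm K V B (BialgebraOver.rho (K := K) (W := UExt K V) x) := by
  -- Here too the inner `ρ` is made explicit: the flip brings `(ρ ⊗ Id) ∘ δ` to `(δ ⊗ Id) ∘ ρ`,
  -- after which `ε_δ` cancels `δ`.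
  have h1 : ∀ t : B ⊗[K] B, (epsDeltaRho K V B).rTensor B t =
      QSh.sndComm K V B ((TensorProduct.lid K B).toLinearMap.rTensor _
        (((DoubleBialgebra.epsDelta (K := K) (B := B)).toLinearMap.rTensor B).rTensor _
          (TensorProduct.rightComm K B (UExt K V) B ((BialgebraOver.rho (K := K) (W := UExt K V)
            (B := B)).toLinearMap.rTensor B t)))) := by
    intro t
    induction t with
    | zero => simp
    | add a b ha hb => simp only [map_add, ha, hb]
    | tmul a v =>
      rw [LinearMap.rTensor_tmul, LinearMap.rTensor_tmul, ← snd_epsDeltaRhoU, epsDeltaRhoU_apply,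
        AlgHom.toLinearMap_apply]
      induction BialgebraOver.rho (K := K) (W := UExt K V) a with
      | zero => simp
      | add a b ha hb => simp only [map_add, TensorProduct.add_tmul, ha, hb]
      | tmul b u => simp [TensorProduct.smul_tmul]
  have h2 : ∀ t : B ⊗[K] UExt K V, (TensorProduct.lid K B).toLinearMap.rTensor _
      (((DoubleBialgebra.epsDelta (K := K) (B := B)).toLinearMap.rTensor B).rTensor _
        ((DoubleBialgebra.delta (K := K) (B := B)).toLinearMap.rTensor (UExt K V) t)) = t := by
    intro t
    induction t with
    | zero => simp
    | add a b ha hb => simp only [map_add, ha, hb]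
    | tmul a v =>
      rw [LinearMap.rTensor_tmul, LinearMap.rTensor_tmul, LinearMap.rTensor_tmul,
        AlgHom.toLinearMap_apply, LinearEquiv.coe_coe, DoubleBialgebra.rTensor_epsDelta]
  rw [h1, DoubleBialgebraOver.rho_delta, h2]

end Character

namespace QSh

/-! ### Compatibility with all structures follows from the letter part -/

section Morphism

variable {K V B : Type*} [CommRing K] [NonUnitalCommRing V] [Module K V]
  [IsScalarTower K V V] [SMulCommClass K V V] [Ring B] [Bialgebra K B]

theorem deconc_map (φ : B →ₗc[K] QSh K V) (x : B) : deconc K V (φ x) =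
    TensorProduct.map φ.toLinearMap φ.toLinearMap (Coalgebra.comul (R := K) x) :=
  (LinearMap.congr_fun φ.map_comp_comul x).symm

theorem counitL_map (φ : B →ₗc[K] QSh K V) (x : B) :
    counitL K V (φ x) = Coalgebra.counit (R := K) x :=
  LinearMap.congr_fun φ.counit_comp x

/-- Products of bialgebras are coalgebra morphisms, so both `φ ∘ m` and `m ∘ (φ ⊗ φ)` are coalgebra
morphisms from `B ⊗ B` to `QSh(V)`, determined by their letter parts. -/
theorem map_mul_of_pr (φ : B →ₗc[K] QSh K V)
    (h : ∀ x y, pr K V (φ (x * y)) = pr K V (φ x * φ y)) (x y : B) : φ (x * y) = φ x * φ y := by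
  have key : φ.comp (Bialgebra.mulCoalgHom K B) =
      (Bialgebra.mulCoalgHom K (QSh K V)).comp (Coalgebra.TensorProduct.map φ φ) := by
    refine coalgHom_ext fun t => ?_
    induction t with
    | zero => simp only [map_zero]
    | add a b ha hb => simp only [map_add, ha, hb]
    | tmul a b => exact h a b
  exact congrArg (fun F => F (x ⊗ₜ[K] y)) key

/-- `φ(1)` is group-like. A group-like word-sum with no one-letter component is empty: splitting off
the first letter gives `φ(1) - 1 = pr(φ(1)) φ(1)`. -/
theorem map_one_of_pr (φ : B →ₗc[K] QSh K V) (h : pr K V (φ 1) = 0) : φ 1 = 1 := by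
  have h1 := cons_pr_deconc (φ 1)
  rw [deconc_map, Bialgebra.comul_one, Algebra.TensorProduct.one_def, TensorProduct.map_tmul,
    TensorProduct.lift.tmul, LinearMap.comp_apply] at h1
  have h2 : pr K V (φ.toLinearMap 1) = 0 := h
  rw [h2, map_zero, LinearMap.zero_apply, counitL_map, Bialgebra.counit_one, one_smul] at h1
  exact (sub_eq_zero.mp h1.symm)

section
variable {A : Type*} [CommRing A] [Algebra K A]

/-- Precomposition with a coalgebra morphism. -/
theorem IsComultiplicative.comp_coalgHom {F : QSh K V →ₗ[K] QSh K V ⊗[K] A}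
    (hF : IsComultiplicative F) (φ : B →ₗc[K] QSh K V) :
    IsComultiplicative (F ∘ₗ φ.toLinearMap) where
  comul x := by
    rw [LinearMap.comp_apply, hF.comul, TensorProduct.map_comp, LinearMap.comp_apply]
    exact congrArg _ (congrArg _ (deconc_map φ x))
  counit x := by
    rw [LinearMap.comp_apply, hF.counit]
    exact congrArg _ (counitL_map φ x)

/-- Postcomposition of a bialgebra coaction with a coalgebra morphism and an algebra morphism. -/
theorem isComultiplicative_map_comp {A' : Type*} [Ring A'] [Algebra K A']
    (r : B →ₗ[K] B ⊗[K] A')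
    (hr : ∀ x, (Coalgebra.comul (R := K) (A := B)).rTensor A' (r x) =
      m1324 K B A' (TensorProduct.map r r (Coalgebra.comul x)))
    (hr' : ∀ x, TensorProduct.lid K A' ((Coalgebra.counit (R := K) (A := B)).rTensor A' (r x)) =
      algebraMap K A' (Coalgebra.counit x))
    (φ : B →ₗc[K] QSh K V) (j : A' →ₐ[K] A) :
    IsComultiplicative (TensorProduct.map φ.toLinearMap j.toLinearMap ∘ₗ r) where
  comul x := by
    have h1 : ∀ t : B ⊗[K] A', (deconc K V).rTensor A
        (TensorProduct.map φ.toLinearMap j.toLinearMap t) =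
        TensorProduct.map (TensorProduct.map φ.toLinearMap φ.toLinearMap) j.toLinearMap
          ((Coalgebra.comul (R := K) (A := B)).rTensor A' t) := by
      intro t
      induction t with
      | zero => simp only [map_zero]
      | add a b ha hb => simp only [map_add, ha, hb]
      | tmul a c => exact congrArg (· ⊗ₜ j c) (deconc_map φ a)
    have h2 : ∀ s t : B ⊗[K] A', TensorProduct.map
        (TensorProduct.map φ.toLinearMap φ.toLinearMap) j.toLinearMap (m1324 K B A' (s ⊗ₜ t)) =
        m1324 K (QSh K V) A (TensorProduct.map φ.toLinearMap j.toLinearMap s ⊗ₜ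
          TensorProduct.map φ.toLinearMap j.toLinearMap t) := by
      intro s t
      induction s with
      | zero => simp only [map_zero, TensorProduct.zero_tmul]
      | add a b ha hb => simp only [map_add, TensorProduct.add_tmul, ha, hb]
      | tmul a c =>
      induction t with
      | zero => simp only [map_zero, TensorProduct.tmul_zero]
      | add a b ha hb => simp only [map_add, TensorProduct.tmul_add, ha, hb]
      | tmul b d =>
        simp only [m1324_tmul, TensorProduct.map_tmul, AlgHom.toLinearMap_apply, map_mul]
    rw [LinearMap.comp_apply, h1, hr]
    induction Coalgebra.comul (R := K) x with
    | zero => simp only [map_zero]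
    | add a b ha hb => simp only [map_add, ha, hb]
    | tmul a b => rw [TensorProduct.map_tmul, h2, TensorProduct.map_tmul]; rfl
  counit x := by
    have h1 : ∀ t : B ⊗[K] A', TensorProduct.lid K A ((counitL K V).rTensor A
        (TensorProduct.map φ.toLinearMap j.toLinearMap t)) =
        j (TensorProduct.lid K A' ((Coalgebra.counit (R := K) (A := B)).rTensor A' t)) := by
      intro t
      induction t with
      | zero => simp only [map_zero]
      | add a b ha hb => simp only [map_add, ha, hb]
      | tmul a c =>
        rw [TensorProduct.map_tmul, LinearMap.rTensor_tmul, LinearMap.rTensor_tmul,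
          TensorProduct.lid_tmul, TensorProduct.lid_tmul, map_smul]
        exact congrArg (· • j c) (counitL_map φ a)
    rw [LinearMap.comp_apply, h1, hr', AlgHom.commutes]

end

variable [NonUnitalBialgebra K V]

theorem isComultiplicative_coactL : IsComultiplicative (coactL K V) where
  comul := foldA_deconc (comulU K V)
  counit x := by
    rw [coactL, foldA_counitL, TensorProduct.lid_tmul, ← Algebra.algebraMap_eq_smul_one]
    rfl

theorem isComultiplicative_deltaL : IsComultiplicative (deltaL K V) where
  comul := deconc_deltaL
  counit x := by
    rw [counitL_deltaL, TensorProduct.lid_tmul, ← Algebra.algebraMap_eq_smul_one]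
    rfl

variable [Coalgebra.IsCocomm K V] [DoubleBialgebra K B] [DoubleBialgebraOver K V B]

/-- Both sides are comultiplicative with values in `QSh(V) ⊗ uV`, and their letter parts are `δ_V ∘
(ε_δ ⊗ Id) ∘ ρ`: on the left by `pr_coactL`, on the right by the coassociativity of `ρ`. -/
theorem map_rho_of_pr (φ : B →ₗc[K] QSh K V) (h : ∀ x, pr K V (φ x) = epsDeltaRho K V B x) (x : B) :
    coactL K V (φ x) =
      φ.toLinearMap.rTensor _ (BialgebraOver.rho (K := K) (W := UExt K V) x) := by
  have h1 := isComultiplicative_coactL.comp_coalgHom φ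
  have h2 := isComultiplicative_map_comp
    (BialgebraOver.rho (K := K) (W := UExt K V) (B := B)).toLinearMap
    BialgebraOver.comul_rho BialgebraOver.counit_rho φ (AlgHom.id K (UExt K V))
  have hφ : pr K V ∘ₗ φ.toLinearMap = epsDeltaRho K V B := LinearMap.ext h
  refine LinearMap.congr_fun (h1.ext h2 fun x => ?_) x
  have h3 : (pr K V).rTensor (UExt K V) (coactL K V (φ x)) = comulU K V (epsDeltaRho K V B x) := by
    rw [pr_coactL, h]
  refine h3.trans ((epsDeltaRho_rho x).symm.trans ?_)
  rw [← hφ, LinearMap.rTensor_comp]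
  rfl

/-- The same comparison in `QSh(V) ⊗ QSh(V)`. In `QSh(V)` the letter part of `δ` is the flipped `ρ`,
and in `B` the map `(ε_δ ⊗ Id) ∘ ρ` turns `δ` into the flipped `ρ` (`epsDeltaRho_delta`), so the
compatibility with `ρ` finishes it. Here `φ` must be multiplicative, since it also acts on the right
leg, where `m1324` multiplies. -/
theorem map_delta_of_pr (φ : B →ₐc[K] QSh K V) (h : ∀ x, pr K V (φ x) = epsDeltaRho K V B x)
    (x : B) : deltaL K V (φ x) = TensorProduct.map (φ : B →ₗ[K] QSh K V) (φ : B →ₗ[K] QSh K V)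
      (DoubleBialgebra.delta (K := K) x) := by
  have h1 := isComultiplicative_deltaL.comp_coalgHom φ.toCoalgHom
  have h2 := isComultiplicative_map_comp
    (DoubleBialgebra.delta (K := K) (B := B)).toLinearMap
    DoubleBialgebra.comul_delta DoubleBialgebra.counit_delta φ.toCoalgHom (φ : B →ₐ[K] QSh K V)
  have hφ : pr K V ∘ₗ (φ : B →ₗ[K] QSh K V) = epsDeltaRho K V B := LinearMap.ext h
  refine LinearMap.congr_fun (h1.ext h2 fun x => ?_) x
  have h3 : (pr K V).rTensor (QSh K V) (deltaL K V (φ x)) =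
      sndComm K V _ ((φ : B →ₗ[K] QSh K V).rTensor _
        (BialgebraOver.rho (K := K) (W := UExt K V) x)) := by
    rw [pr_deltaL]
    exact congrArg _ (map_rho_of_pr φ.toCoalgHom h x)
  have h4 : ∀ t : B ⊗[K] UExt K V, sndComm K V _ ((φ : B →ₗ[K] QSh K V).rTensor _ t) =
      (φ : B →ₗ[K] QSh K V).lTensor V (sndComm K V _ t) := by
    intro t
    induction t with
    | zero => simp only [map_zero]
    | add a b ha hb => simp only [map_add, ha, hb]
    | tmul a b => rfl
  have h5 : ∀ t : B ⊗[K] B, (φ : B →ₗ[K] QSh K V).lTensor V ((epsDeltaRho K V B).rTensor B t) =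
      (pr K V).rTensor _ (TensorProduct.map (φ : B →ₗ[K] QSh K V) (φ : B →ₗ[K] QSh K V) t) := by
    intro t
    induction t with
    | zero => simp only [map_zero]
    | add a b ha hb => simp only [map_add, ha, hb]
    | tmul a b => rw [← hφ]; rfl
  exact h3.trans ((h4 _).trans ((congrArg _ (epsDeltaRho_delta x).symm).trans (h5 _)))

/-- A coalgebra morphism to `QSh(V)` whose projection to the letters is `(ε_δ ⊗ Id) ∘ ρ` is a
morphism of double bialgebras over `V`. -/
theorem exists_hom_of_pr (φ : B →ₗc[K] QSh K V) (h : ∀ x, pr K V (φ x) = epsDeltaRho K V B x) :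
    ∃ ψ : B →ₐc[K] QSh K V, IsDoubleBialgebraOverHom K V ψ ∧ ∀ x, ψ x = φ x := by
  have h1 : φ 1 = 1 := map_one_of_pr φ (by rw [h, epsDeltaRho_one])
  have h2 : ∀ x y, φ (x * y) = φ x * φ y := map_mul_of_pr φ fun x y => by
    rw [h, pr_mul, h, h, counitL_map, counitL_map, epsDeltaRho_mul]
  let ψ : B →ₐc[K] QSh K V := { φ with map_one' := h1, map_mul' := h2 }
  refine ⟨ψ, ⟨map_delta_of_pr ψ h, fun x => ?_, map_rho_of_pr φ h⟩, fun _ => rfl⟩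
  -- On `QSh(V)`, `ε_δ = ε_V ∘ pr + ε`, which through the letter part of `φ` is the counit of `uV`
  -- applied to `(ε_δ ⊗ Id) ∘ ρ`, that is `ε_δ` on `B`.
  have h3 : epsDeltaL K V (φ x) = DoubleBialgebra.epsDelta (K := K) x := by
    rw [epsDeltaL_eq, h, counitL_map, ← counit_epsDeltaRhoU (V := V), epsDeltaRhoU_eq, map_add,
      map_smul, Bialgebra.counit_one, UExt.counit_inr, smul_eq_mul, mul_one, add_comm]
  exact h3

/-- A morphism commutes with `ρ` and `ε_δ`, hence with `(ε_δ ⊗ Id) ∘ ρ`, which is `pr` on the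
target. So no freedom is left in the letter part. -/
theorem pr_hom {ψ : B →ₐc[K] QSh K V} (hψ : IsDoubleBialgebraOverHom K V ψ) (x : B) :
    pr K V (ψ x) = epsDeltaRho K V B x := by
  have aux : ∀ t : B ⊗[K] UExt K V,
      (DoubleBialgebra.epsDelta (K := K) (B := QSh K V)).toLinearMap.rTensor (UExt K V)
        ((ψ : B →ₗ[K] QSh K V).rTensor (UExt K V) t) =
      (DoubleBialgebra.epsDelta (K := K) (B := B)).toLinearMap.rTensor (UExt K V) t := by
    intro t
    induction t with
    | zero => simp only [map_zero]
    | add a b ha hb => simp only [map_add, ha, hb]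
    | tmul a b => exact congrArg (· ⊗ₜ b) (hψ.map_epsDelta a)
  rw [← epsDeltaRho_eq_pr, ← snd_epsDeltaRhoU, epsDeltaRhoU_apply, hψ.map_rho, aux,
    ← epsDeltaRhoU_apply, snd_epsDeltaRhoU]

end Morphism

end QSh

/-! ### The universal property of `QSh(V)` -/

theorem mainTheorem2 {K : Type*} [Field K] [CharZero K]
    {V : Type*} [NonUnitalCommRing V] [Module K V] [IsScalarTower K V V] [SMulCommClass K V V]
    [NonUnitalBialgebra K V] [Coalgebra.IsCocomm K V]
    {B : Type*} [Ring B] [Bialgebra K B] [DoubleBialgebra K B] [DoubleBialgebraOver K V B]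
    (hB : IsConnectedBialgebra K B) :
    ∃ φ : B →ₐc[K] QSh K V, IsDoubleBialgebraOverHom K V φ ∧
      (∀ ψ : B →ₐc[K] QSh K V, IsDoubleBialgebraOverHom K V ψ → ψ = φ) ∧
      ∀ x : B, Coalgebra.counit (R := K) x = 0 →
        ∃ N : ℕ, (∀ n, N ≤ n → iterReducedComul K B n x = 0) ∧
          φ x = ∑ n ∈ Finset.range N, wordTerm K V B n x := by
  have hf := epsDeltaRho_one (K := K) (V := V) (B := B)
  have hN := hB.exists_conv_pow_eq_zero (epsDeltaRho K V B) hf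
  obtain ⟨s, hs', hs, hsum⟩ := exists_conv_inverse (letterConv K (epsDeltaRho K V B)) hN
  obtain ⟨φ, hφ, hφs⟩ := QSh.exists_hom_of_pr (QSh.coalgLift (epsDeltaRho K V B) s hs hs')
    (QSh.pr_coalgLift (epsDeltaRho K V B) s hs hs')
  refine ⟨φ, hφ, fun ψ hψ => ?_, fun x hx => ?_⟩
  · have h : ψ.toCoalgHom = φ.toCoalgHom := QSh.coalgHom_ext fun x =>
      (QSh.pr_hom hψ x).trans (QSh.pr_hom hφ x).symm
    exact BialgHom.ext fun x => congrArg (fun F => F x) h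
  · obtain ⟨N, hN0⟩ := hB x hx
    have hN1 : ∀ n, N ≤ n → iterReducedComul K B n x = 0 := fun n hn =>
      iterReducedComul_eq_zero_of_le hn x hx hN0
    refine ⟨N, hN1, ?_⟩
    have h1 := toTensorAlgebra_map_iterReducedComul (epsDeltaRho K V B) hf
    -- The series has one more term than the formula: the power `n + 1` is the summand for `Δ̃⁽ⁿ⁾`,
    -- and the zeroth power is `ε(x)`, which vanishes on `ker ε`.
    have h2 : s x = ∑ n ∈ Finset.range (N + 1), (letterConv K (epsDeltaRho K V B) ^ n) x := by
      refine hsum x (N + 1) fun n hn => ?_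
      obtain ⟨m, rfl⟩ := Nat.exists_eq_add_of_le' hn
      rw [← add_assoc, ← h1, hN1 _ (Nat.le_add_left N m), map_zero, map_zero]
    rw [hφs, QSh.coalgLift_apply, h2, Finset.sum_range_succ', pow_zero, LinearMap.convOne_apply, hx,
      map_zero, add_zero, map_sum]
    refine Finset.sum_congr rfl fun n _ => ?_
    rw [← h1]
    rfl
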